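/- Let $J\in\mathbb R$ and $K=e^{-2J}$ (temperature $T=1$, external field $h=0$). For $|m|<1$ put $$c_1=-2s\Big(1+\frac{s}{m^2-1}\Big),\quad c_2=\frac{m-1}{2}+s+\frac{s^2}{m^2-1},\quad c_3=-\frac{m+1}{2}+s+\frac{s^2}{m^2-1},$$ $$D_1(m,s)=m+c_1\tanh(Km)+c_2\tanh(Km-2J)+c_3\tanh(Km+2J),$$ $$D_2(m,s)=2s-1+c_2\tanh(Km-2J)-c_3\tanh(Km+2J),$$ and consider the noiseless dynamics of the magnetization $m$ and the defect density $s$ in the Nagle–Kardar model, $$\dot m=-D_1(m,s),\qquad \dot s=-D_2(m,s).\tag{1}$$ Let $s^*=K/(K+1)$. A center manifold of (1) at $(0,s^*)$ is (locally) a graph $s=s^*+\eta(m)$, with $\eta$ of class $C^2$ near $0$ and $\eta(0)=\eta'(0)=0$, that is locally invariant, i.e. $-D_2(x,s^*+\eta(x))=-\eta'(x)\,D_1(x,s^*+\eta(x))$ for all $x$ near $0$. 1. $(0,s^*)$ is a fixed point of (1), and the linearisation of (1) there is $\mathrm{diag}\big(0,-\tfrac{4K}{1+K^2}\big)$. 2.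 If $K\le\sqrt3$, a center manifold exists. For every $K=e^{-2J}$, every center manifold satisfies $\eta(x)=-\frac K2x^2+O(x^4)$, and the dynamics reduced to it is $$\frac{dm}{dt}=\frac{K^2(K^2-3)}{3(1+K^2)}\,m^3+O(m^5)\qquad(m\to0).$$ 3. (Critical line.) If $K<\sqrt3$, the cubic coefficient is negative, and $m(t)\sim t^{-1/2}$: there is $r>0$ such that for all $m_0\ne0$, $s_0$ with $|m_0|<r$, $|s_0-s^*|<r$, system (1) has a solution on $[0,\infty)$ starting at $(m_0,s_0)$, and every such solution satisfies $(m(t),s(t))\to(0,s^*)$ and $$t^{1/2}\,m(t)\to \operatorname{sign}(m_0)\Big(\tfrac{3(1+K^2)}{2K^2(3-K^2)}\Big)^{1/2}\qquad(t\to\infty).$$ 4. (Tricritical point.) If $K=\sqrt3$, the cubic coefficient vanishes, the dynamics reduced to any center manifold is $\frac{dm}{dt}=-\frac{9}{20}m^5+O(m^7)$, and $m(t)\sim t^{-1/4}$: in the same sense as in 3, $t^{1/4}m(t)\to\operatorname{sign}(m_0)\,(5/9)^{1/4}$. 5. (Dynamical exponent.) Call $\lambda$ a relaxation exponent if, for some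 $C>0$ and for all initial conditions near $(0,s^*)$ with $m_0\neq0$, in the sense of 3, $(m(t),s(t))\to(0,s^*)$ and $t^{\lambda}m(t)\to\operatorname{sign}(m_0)C$. Let $$\mathcal F_\kappa(m)=\frac\kappa2m^2-J-\log\Big(\cosh(\kappa m)+\sqrt{\sinh^2(\kappa m)+e^{-4J}}\Big)$$ be the canonical free-energy density at couplings $(J,\kappa)$. Call $\beta$ an order-parameter exponent if there is $B>0$ such that $|m_\kappa|/(\kappa-K)^{\beta}\to B$ as $\kappa\downarrow K$ for every choice of global minimizers $m_\kappa$ of $\mathcal F_\kappa$. Call $\nu$ a correlation-length exponent if $(K-\kappa)^{\nu}\,\mathcal F_\kappa''(0)^{-1/2}$ tends to a positive limit as $\kappa\uparrow K$ (the mean-field correlation length being $\mathcal F_\kappa''(0)^{-1/2}$). Call $z$ a dynamical critical exponent if $\lambda=\beta/(z\nu)$ for some such $\lambda,\beta,\nu$. Then $\lambda=\beta=\nu=\frac12$ are such exponents if $K<\sqrt3$, and $\lambda=\beta=\frac14$, $\nu=\frac12$ are such exponents if $K=\sqrt3$. In both cases $z=2$ is the one and only dynamical critical exponent. -/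

import Mathlib

open Filter Topology Asymptotics

noncomputable section

namespace NagleKardar

/-! Temperature is set to one throughout. `m` is the magnetization per site, `s` the density of
defects, `J` and `K` the nearest-neighbour and mean-field couplings, `h` the external field and
`ε = 1 / N` the noise strength. -/

def c₁ (m s : ℝ) : ℝ := -2 * s * (1 + s / (m ^ 2 - 1))

def c₂ (m s : ℝ) : ℝ := (m - 1) / 2 + s + s ^ 2 / (m ^ 2 - 1)

def c₃ (m s : ℝ) : ℝ := -((m + 1) / 2) + s + s ^ 2 / (m ^ 2 - 1)

def c₄ (m s : ℝ) : ℝ := -2 * (m * s ^ 2 / (m ^ 2 - 1))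

def c₅ (m s : ℝ) : ℝ := (m - 1) / 2 + s + m * s ^ 2 / (m ^ 2 - 1)

def c₆ (m s : ℝ) : ℝ := (m + 1) / 2 - s + m * s ^ 2 / (m ^ 2 - 1)

/-- First drift coefficient of the Fokker-Planck equation. -/
def D₁ (ε h J K m s : ℝ) : ℝ :=
  m + c₁ m s * Real.tanh (h + K * m)
    + c₂ m s * Real.tanh (h + K * m - 2 * J)
    + c₃ m s * Real.tanh (h + K * m + 2 * J)
    + K * ε * (c₄ m s / Real.cosh (h + K * m) ^ 2
      + c₅ m s / Real.cosh (h + K * m - 2 * J) ^ 2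
      + c₆ m s / Real.cosh (h + K * m + 2 * J) ^ 2)

/-- Second drift coefficient of the Fokker-Planck equation. -/
def D₂ (ε h J K m s : ℝ) : ℝ :=
  2 * s - 1 + c₂ m s * Real.tanh (h + K * m - 2 * J)
    - c₃ m s * Real.tanh (h + K * m + 2 * J)
    + K * ε * (c₅ m s / Real.cosh (h + K * m - 2 * J) ^ 2
      - c₆ m s / Real.cosh (h + K * m + 2 * J) ^ 2)

/-- Drift of the Langevin equation for `(m, s)`; the Fokker-Planck equation reads
`∂ₜ p = ∂ₘ (D₁ p) + ∂ₛ (D₂ p) + O(ε)`, hence the minus signs. -/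
def langevinDrift (ε h J K : ℝ) (p : ℝ × ℝ) : ℝ × ℝ :=
  (-D₁ ε h J K p.1 p.2, -D₂ ε h J K p.1 p.2)

/-- Drift without noise and without external field. -/
def drift (J K : ℝ) : ℝ × ℝ → ℝ × ℝ := langevinDrift 0 0 J K

/-- Density of defects at the paramagnetic equilibrium on the line `K = exp (-2 J)`. -/
def sStar (K : ℝ) : ℝ := K / (K + 1)

/-- Solutions, for all times `t ≥ 0`, of the noiseless dynamics `(m, s)' = drift (m, s)`. -/
def IsTrajectory (J K : ℝ) (X : ℝ → ℝ × ℝ) : Prop :=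
  ∀ t : ℝ, 0 ≤ t → HasDerivWithinAt X (drift J K (X t)) (Set.Ici 0) t

/-- The graph `s = sStar K + η m` is a (local, twice continuously differentiable) center manifold
of the fixed point `(0, sStar K)`: it passes through that point, is tangent there to the
`m`-direction, and is locally invariant, `s' = η' (m) m'`. -/
def IsCenterManifold (J K : ℝ) (η : ℝ → ℝ) : Prop :=
  ContDiffAt ℝ 2 η 0 ∧ η 0 = 0 ∧ deriv η 0 = 0 ∧
    ∀ᶠ x in 𝓝 (0 : ℝ),
      (drift J K (x, sStar K + η x)).2 = deriv η x * (drift J K (x, sStar K + η x)).1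

/-- The right-hand side of the reduced equation `dm/dt = reducedDrift J K η m` on the graph
of `η`. -/
def reducedDrift (J K : ℝ) (η : ℝ → ℝ) (x : ℝ) : ℝ :=
  (drift J K (x, sStar K + η x)).1

/-- The magnetization relaxes as `± C t ^ (-a)`: every initial condition close to the fixed point
and with non-zero magnetization has a trajectory, and each such trajectory tends to the fixed point
with `m t ~ sign (m 0) * C * t ^ (-a)` at large times. -/
def RelaxesAs (J K a C : ℝ) : Prop :=
  ∃ r : ℝ, 0 < r ∧ ∀ m₀ s₀ : ℝ, m₀ ≠ 0 → |m₀| < r → |s₀ - sStar K| < r →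
    (∃ X : ℝ → ℝ × ℝ, IsTrajectory J K X ∧ X 0 = (m₀, s₀)) ∧
    ∀ X : ℝ → ℝ × ℝ, IsTrajectory J K X → X 0 = (m₀, s₀) →
      Tendsto X atTop (𝓝 (0, sStar K)) ∧
      Tendsto (fun t : ℝ => (X t).1 * t ^ a) atTop (𝓝 (Real.sign m₀ * C))

/-- The exponent of the decay in time of the magnetization. -/
def IsRelaxationExponent (J K a : ℝ) : Prop :=
  ∃ C : ℝ, 0 < C ∧ RelaxesAs J K a C

/-- Canonical free-energy density (temperature one) as a function of the magnetization. -/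
def freeEnergy (h J K m : ℝ) : ℝ :=
  K / 2 * m ^ 2 - J
    - Real.log (Real.cosh (K * m + h)
      + Real.sqrt (Real.sinh (K * m + h) ^ 2 + Real.exp (-4 * J)))

/-- Equilibrium magnetizations are the global minimizers of the free-energy density. -/
def IsEquilibriumMagnetization (h J K m : ℝ) : Prop :=
  IsMinOn (freeEnergy h J K) Set.univ m

/-- Static exponent of the order parameter at the point `(J, K)`: the spontaneous magnetization
at couplings `(J, κ)` behaves as `B (κ - K) ^ b` when `κ` decreases to `K`. -/
def IsMagnetizationExponent (J K b : ℝ) : Prop :=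
  ∃ B : ℝ, 0 < B ∧ ∀ mEq : ℝ → ℝ,
    (∀ᶠ κ in 𝓝[>] K, IsEquilibriumMagnetization 0 J κ (mEq κ)) →
    Tendsto (fun κ : ℝ => |mEq κ| / (κ - K) ^ b) (𝓝[>] K) (𝓝 B)

/-- Mean-field (Landau) correlation length in the disordered phase: the inverse square root of the
second derivative at `m = 0` of the free-energy density (unit stiffness). -/
def correlationLength (J K : ℝ) : ℝ :=
  1 / Real.sqrt (iteratedDeriv 2 (freeEnergy 0 J K) 0)

/-- Static exponent of the correlation length at the point `(J, K)`, approached from the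
disordered side. -/
def IsCorrelationExponent (J K n : ℝ) : Prop :=
  ∃ B : ℝ, 0 < B ∧
    Tendsto (fun κ : ℝ => correlationLength J κ * (K - κ) ^ n) (𝓝[<] K) (𝓝 B)

/-- The dynamical critical exponent `z`, given by the scaling relation `a = b / (z n)` between the
exponents of relaxation (`a`), of the order parameter (`b`) and of the correlation
length (`n`). -/
def IsDynamicalExponent (J K z : ℝ) : Prop :=
  ∃ a b n : ℝ, IsRelaxationExponent J K a ∧ IsMagnetizationExponent J K b ∧
    IsCorrelationExponent J K n ∧ a = b / (z * n)

end NagleKardar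

end

/-! At (0, s*) the s-direction contracts at rate c = 4K/(1+K²), while the linear part along m
vanishes on the line K = e^{-2J}, so the relaxation is decided by the first nonzero nonlinear term.
By the addition formula for tanh, both drift coefficients become polynomials in m, s and tanh(Km)
after multiplication by `driftDenom`, which is 1 + O(m²). With s = s* + m²y one gets m² times
`fastPoly` for D₂ and m³ times `slowPoly` for D₁. At m = 0 the first is affine in y with zero y =
-K/2, which is the leading coefficient of every center manifold; the second, evaluated there, is
minus the cubic coefficient. At K² = 3 it vanishes, and one more order gives y = -K/2 + (K/4)m² and
the coefficient 9/20. `approxManifold_expansion` and its tricritical version require only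
approximate invariance, so they serve for center manifolds and for polynomials alike.

For the relaxation, a polynomial p is built whose graph is invariant up to O(m^N)
(`exists_polynomial_invarianceDefect_isBigO`). With w = s - s* - p(m) the system reads m' = -mF, w'
= -G, where F ≈ a m^{2k} and G ≈ c w (`exists_slowFast`); k is 1 below √3 and 2 at √3. The function
V = w² + m^{2k+2} satisfies V' ≤ -δV², which confines solutions and drives them to 0. A Gronwall
estimate for (w/m^j)² makes w negligible against m^{2k}, so (m^{-2k})' = 2kF/m^{2k} → 2ka and
m^{-2k} ~ 2kat (`IsSolutionInBox.tendsto_mul_rpow`).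

A center manifold is obtained from a single orbit with m > 0: m eventually decreases, so the orbit
is a graph η with η' = D₂/D₁. It agrees with p to an order high enough to survive two divisions by
D₁ ~ a m^{2k+1}, hence η'' has a limit at 0. As D₁ is odd and D₂ even in m, the even extension is a
C² invariant graph (`exists_isCenterManifold`).

For the statics, put u = κm. The squared stationarity equation is (κ²-K²) sinh²u = u² sinh²u -
K²(sinh²u - u²). For K² ≤ 3 the right side is at least u⁶/5, so minimizers tend to 0 as κ decreases
to K; its leading term, (1-K²/3)u⁴ or u⁶/5, gives β. The identity F''(0) = κ(1-κ/K) gives ν = 1/2.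
All three exponents are unique, and λ = β then forces z = 2. -/

namespace NagleKardar

/-! ### Ordinary differential equations on a half-line -/

/-- A field bounded by `L` cannot leave the ball of radius `L * n` before time n, so Picard-Lindelöf
applies on every interval [0, n]; uniqueness glues the pieces. -/
theorem exists_hasDerivWithinAt_Ici_of_lipschitzWith {E : Type*} [NormedAddCommGroup E]
    [NormedSpace ℝ E] [CompleteSpace E] {f : E → E} {K L : NNReal} (hf : LipschitzWith K f)
    (hL : ∀ x, ‖f x‖ ≤ L) (x₀ : E) :
    ∃ X : ℝ → E, X 0 = x₀ ∧ ∀ t : ℝ, 0 ≤ t → HasDerivWithinAt X (f (X t)) (Set.Ici 0) t := by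
  have hex : ∀ n : ℕ, ∃ α : ℝ → E, α 0 = x₀ ∧
      ∀ t ∈ Set.Icc (0 : ℝ) n, HasDerivWithinAt α (f (α t)) (Set.Icc 0 n) t := by
    intro n
    have hn : (0 : ℝ) ≤ n := n.cast_nonneg
    have : IsPicardLindelof (fun _ : ℝ => f) (⟨0, ⟨le_rfl, hn⟩⟩ : Set.Icc (0 : ℝ) n) x₀
        (L * n) 0 L K :=
      { lipschitzOnWith := fun _ _ => hf.lipschitzOnWith
        continuousOn := fun _ _ => continuousOn_const
        norm_le := fun _ _ x _ => hL x
        mul_max_le := by simp }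
    exact this.exists_eq_forall_mem_Icc_hasDerivWithinAt₀
  choose α hα0 hα using hex
  have hright : ∀ (n : ℕ) (s : ℝ), s ≤ n → ∀ t ∈ Set.Ico (0 : ℝ) s,
      HasDerivWithinAt (α n) (f (α n t)) (Set.Ici t) t := by
    intro n s hs t ht
    refine ((hα n t ⟨ht.1, ht.2.le.trans hs⟩).mono_of_mem_nhdsWithin ?_)
    exact mem_of_superset (Icc_mem_nhdsGE (ht.2.trans_le hs)) (Set.Icc_subset_Icc_left ht.1)
  have hcont : ∀ (n : ℕ) (s : ℝ), s ≤ n → ContinuousOn (α n) (Set.Icc 0 s) := by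
    intro n s hs t ht
    exact ((hα n t ⟨ht.1, ht.2.trans hs⟩).continuousWithinAt).mono (Set.Icc_subset_Icc_right hs)
  have huniq : ∀ (n k : ℕ) (s : ℝ), 0 ≤ s → s ≤ n → s ≤ k → α n s = α k s := by
    intro n k s h0 hn hk
    exact ODE_solution_unique_of_mem_Icc_right (v := fun _ => f) (s := fun _ => Set.univ) (K := K)
      (fun _ _ => hf.lipschitzOnWith) (hcont n s hn) (hright n s hn) (fun _ _ => trivial)
      (hcont k s hk) (hright k s hk) (fun _ _ => trivial) (by rw [hα0, hα0]) ⟨h0, le_rfl⟩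
  -- The extra 1 puts t strictly below the right end of the chosen interval, so that piece is a
  -- solution on a whole neighbourhood of t in the half-line.
  refine ⟨fun t => α (⌈t⌉₊ + 1) t, by simp [hα0], fun t ht => ?_⟩
  have hlt : t < ((⌈t⌉₊ + 1 : ℕ) : ℝ) := by
    push_cast; linarith [Nat.le_ceil t]
  have hder : HasDerivWithinAt (α (⌈t⌉₊ + 1)) (f (α (⌈t⌉₊ + 1) t)) (Set.Ici 0) t := by
    refine (hα _ t ⟨ht, hlt.le⟩).mono_of_mem_nhdsWithin ?_
    rw [← Set.Ici_inter_Iic, Set.inter_comm]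
    exact inter_mem (mem_nhdsWithin_of_mem_nhds (Iic_mem_nhds hlt)) self_mem_nhdsWithin
  refine hder.congr_of_eventuallyEq ?_ rfl
  filter_upwards [self_mem_nhdsWithin, mem_nhdsWithin_of_mem_nhds (Iio_mem_nhds hlt)] with s h0 hs
  refine huniq _ _ s h0 ?_ (le_of_lt hs)
  push_cast; linarith [Nat.le_ceil s]

theorem antitoneOn_Icc_of_hasDerivAt_nonpos {u : ℝ → ℝ} {a b : ℝ}
    (hc : ContinuousOn u (Set.Icc a b))
    (hd : ∀ t, a < t → t < b → ∃ d, HasDerivAt u d t ∧ d ≤ 0) : AntitoneOn u (Set.Icc a b) := by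
  refine antitoneOn_of_deriv_nonpos (convex_Icc a b) hc ?_ ?_
  · intro t ht
    rw [interior_Icc] at ht
    obtain ⟨d, h, -⟩ := hd t ht.1 ht.2
    exact h.differentiableAt.differentiableWithinAt
  · intro t ht
    rw [interior_Icc] at ht
    obtain ⟨d, h, h'⟩ := hd t ht.1 ht.2
    rwa [h.deriv]

theorem antitoneOn_Ici_of_hasDerivAt_nonpos {u : ℝ → ℝ} {a : ℝ}
    (hc : ContinuousOn u (Set.Ici a))
    (hd : ∀ t, a < t → ∃ d, HasDerivAt u d t ∧ d ≤ 0) : AntitoneOn u (Set.Ici a) :=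
  fun _ hs _ ht hst => antitoneOn_Icc_of_hasDerivAt_nonpos (hc.mono Set.Icc_subset_Ici_self)
    (fun r hr _ => hd r (lt_of_le_of_lt (le_refl a) hr)) ⟨hs, hst⟩ ⟨ht, le_rfl⟩ hst

/-- A function that is nonincreasing as long as it stays below a level never reaches it. -/
theorem lt_of_hasDerivAt_nonpos_of_lt {V : ℝ → ℝ} {R : ℝ} (hc : ContinuousOn V (Set.Ici 0))
    (h0 : V 0 < R) (hd : ∀ t, 0 < t → V t < R → ∃ d, HasDerivAt V d t ∧ d ≤ 0) {t : ℝ}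
    (ht : 0 ≤ t) : V t < R := by
  by_contra! hV
  set S : Set ℝ := {s ∈ Set.Icc 0 t | R ≤ V s}
  have hSc : IsClosed S :=
    (hc.mono (Set.Icc_subset_Ici_self : Set.Icc 0 t ⊆ _)).preimage_isClosed_of_isClosed
      isClosed_Icc (isClosed_Ici (a := R))
  have hne : S.Nonempty := ⟨t, ⟨ht, le_rfl⟩, hV⟩
  have hbdd : BddBelow S := ⟨0, fun s hs => hs.1.1⟩
  have hmem := hSc.csInf_mem hne hbdd
  set τ := sInf S
  have hlt : ∀ s, 0 ≤ s → s < τ → V s < R := by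
    intro s hs hsτ
    by_contra! h
    exact absurd (csInf_le hbdd (show s ∈ S from ⟨⟨hs, hsτ.le.trans hmem.1.2⟩, h⟩)) (not_le.2 hsτ)
  have hanti : AntitoneOn V (Set.Icc 0 τ) :=
    antitoneOn_Icc_of_hasDerivAt_nonpos (hc.mono Set.Icc_subset_Ici_self)
      (fun s hs hsτ => hd s hs (hlt s hs.le hsτ))
  have := hanti ⟨le_rfl, hmem.1.1⟩ ⟨hmem.1.1, le_rfl⟩ hmem.1.1
  exact absurd hmem.2 (not_le.2 (this.trans_lt h0))

/-- The reciprocal of V grows at least at rate δ, hence V ≤ 1/(δt). -/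
theorem tendsto_zero_of_hasDerivAt_le_neg_sq {V : ℝ → ℝ} {δ : ℝ} (hδ : 0 < δ)
    (hc : ContinuousOn V (Set.Ici 0)) (hpos : ∀ t, 0 ≤ t → 0 < V t)
    (hd : ∀ t, 0 < t → ∃ d, HasDerivAt V d t ∧ d ≤ -δ * V t ^ 2) : Tendsto V atTop (𝓝 0) := by
  have hanti : AntitoneOn (fun t => δ * t - (V t)⁻¹) (Set.Ici 0) := by
    refine antitoneOn_Ici_of_hasDerivAt_nonpos ?_ ?_
    · exact (by fun_prop : ContinuousOn (fun t : ℝ => δ * t) _).sub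
        (hc.inv₀ fun t ht => (hpos t ht).ne')
    · intro t ht
      obtain ⟨d, h, hle⟩ := hd t ht
      have hp := hpos t ht.le
      refine ⟨_, ((hasDerivAt_id t).const_mul δ).sub (h.inv hp.ne'), ?_⟩
      have : δ ≤ -d / V t ^ 2 := by
        rw [le_div_iff₀ (by positivity)]; linarith
      simp only [mul_one]
      linarith
  have hbound : ∀ t, 0 < t → V t ≤ (δ * t)⁻¹ := by
    intro t ht
    have h1 := hanti (Set.mem_Ici.2 le_rfl) (Set.mem_Ici.2 ht.le) ht.le
    have h2 : 0 < (V 0)⁻¹ := inv_pos.2 (hpos 0 le_rfl)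
    have h3 : δ * t ≤ (V t)⁻¹ := by simp only at h1; linarith
    rw [← inv_inv (V t)]
    exact inv_anti₀ (by positivity) h3
  refine tendsto_of_tendsto_of_tendsto_of_le_of_le' tendsto_const_nhds
    (tendsto_inv_atTop_zero.comp (tendsto_id.const_mul_atTop hδ)) ?_ ?_
  · filter_upwards [eventually_ge_atTop 0] with t ht using (hpos t ht).le
  · filter_upwards [eventually_gt_atTop 0] with t ht using hbound t ht

/-- Gronwall with the integrating factor exp(γ(t-T)), applied to the distance of u from the
equilibrium e/γ. -/
theorem le_exp_add_of_hasDerivAt_le {u : ℝ → ℝ} {γ e T : ℝ} (hγ : 0 < γ)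
    (hc : ContinuousOn u (Set.Ici T))
    (hd : ∀ t, T < t → ∃ d, HasDerivAt u d t ∧ d ≤ -γ * u t + e) {t : ℝ} (ht : T ≤ t) :
    u t ≤ |u T - e / γ| * Real.exp (-γ * (t - T)) + e / γ := by
  have hanti : AntitoneOn (fun t => (u t - e / γ) * Real.exp (γ * (t - T))) (Set.Ici T) := by
    refine antitoneOn_Ici_of_hasDerivAt_nonpos ?_ ?_
    · exact (hc.sub continuousOn_const).mul (by fun_prop)
    · intro t ht
      obtain ⟨d, h, hle⟩ := hd t ht
      refine ⟨_, (h.sub_const (e / γ)).mul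
        ((((hasDerivAt_id t).sub_const T).const_mul γ).exp), ?_⟩
      have hE := Real.exp_pos (γ * (t - T))
      have : d + (u t - e / γ) * γ ≤ 0 := by
        rw [sub_mul, div_mul_cancel₀ _ hγ.ne']; linarith
      simp only [id_eq, mul_one]
      nlinarith
  have h := hanti (Set.mem_Ici.2 le_rfl) (Set.mem_Ici.2 ht) ht
  simp only [sub_self, mul_zero, Real.exp_zero, mul_one] at h
  have h2 : u t - e / γ ≤ (u T - e / γ) * Real.exp (-γ * (t - T)) := by
    rw [neg_mul, Real.exp_neg, ← div_eq_mul_inv, le_div_iff₀ (Real.exp_pos _)]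
    exact h
  have h3 := mul_le_mul_of_nonneg_right (le_abs_self (u T - e / γ))
    (Real.exp_pos (-γ * (t - T))).le
  linarith

theorem tendsto_zero_of_hasDerivAt_le {u : ℝ → ℝ} {γ : ℝ} (hγ : 0 < γ)
    (hc : ContinuousOn u (Set.Ici 0)) (h0 : ∀ t, 0 ≤ t → 0 ≤ u t)
    (hd : ∀ e > 0, ∀ᶠ t in atTop, ∃ d, HasDerivAt u d t ∧ d ≤ -γ * u t + e) :
    Tendsto u atTop (𝓝 0) := by
  rw [Metric.tendsto_atTop']
  intro ε hε
  -- This choice of e makes the equilibrium level e/γ equal to ε/2.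
  obtain ⟨T₀, hT₀⟩ := eventually_atTop.1 (hd (γ * (ε / 2)) (by positivity))
  set T := max T₀ 0
  have hle : ∀ t, T ≤ t → u t ≤ |u T - ε / 2| * Real.exp (-γ * (t - T)) + ε / 2 := by
    intro t ht
    have := le_exp_add_of_hasDerivAt_le hγ (hc.mono (Set.Ici_subset_Ici.2 (le_max_right T₀ 0)))
      (fun s hs => hT₀ s ((le_max_left _ _).trans hs.le)) ht
    rwa [mul_div_cancel_left₀ _ hγ.ne'] at this
  have hlim : Tendsto (fun t => |u T - ε / 2| * Real.exp (-γ * (t - T)) + ε / 2) atTop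
      (𝓝 (|u T - ε / 2| * 0 + ε / 2)) := by
    refine ((Real.tendsto_exp_atBot.comp ?_).const_mul _).add_const _
    exact (tendsto_atTop_add_const_right _ (-T) tendsto_id).const_mul_atTop_of_neg (by linarith)
  obtain ⟨T₁, hT₁⟩ := eventually_atTop.1 (hlim.eventually (gt_mem_nhds (by linarith :
    |u T - ε / 2| * 0 + ε / 2 < ε)))
  refine ⟨max T T₁, fun t ht => ?_⟩
  have h1 : T ≤ t := (le_max_left _ _).trans (le_of_lt ht)
  rw [Real.dist_0_eq_abs, abs_of_nonneg (h0 t ((le_max_right T₀ 0).trans h1))]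
  exact (hle t h1).trans_lt (hT₁ t ((le_max_right _ _).trans (le_of_lt ht)))

/-- Beyond some T the function g - Lt has slope at most ε/2, so it is at most a constant plus εt/2;
the constant is absorbed for large t. -/
theorem tendsto_div_of_tendsto_hasDerivAt {g g' : ℝ → ℝ} {L : ℝ}
    (hd : ∀ᶠ t in atTop, HasDerivAt g (g' t) t) (hL : Tendsto g' atTop (𝓝 L)) :
    Tendsto (fun t => g t / t) atTop (𝓝 L) := by
  have key : (fun t => g t - L * t) =o[atTop] (fun t : ℝ => t) := by
    rw [isLittleO_iff]
    intro ε hε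
    obtain ⟨T, hT⟩ := eventually_atTop.1 (hd.and ((Metric.tendsto_nhds.1 hL (ε / 2)
      (by positivity))))
    have hbd : ∀ t, T ≤ t → ‖(g t - L * t) - (g T - L * T)‖ ≤ ε / 2 * ‖t - T‖ := by
      intro t ht
      refine (convex_Ici T).norm_image_sub_le_of_norm_hasDerivWithin_le
        (f := fun t => g t - L * t) (f' := fun t => g' t - L) (fun s hs => ?_) (fun s hs => ?_)
        (Set.mem_Ici.2 le_rfl) (Set.mem_Ici.2 ht)
      · simpa using ((hT s hs).1.fun_sub ((hasDerivAt_id' s).const_mul L)).hasDerivWithinAt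
      · exact ((hT s hs).2).le
    filter_upwards [eventually_ge_atTop T, eventually_ge_atTop 0, eventually_ge_atTop
      (2 / ε * (‖g T - L * T‖ + ε / 2 * |T|))] with t h1 h2 h3
    have h4 := hbd t h1
    have h5 : ‖g t - L * t‖ ≤ ‖g T - L * T‖ + ε / 2 * ‖t - T‖ := by
      calc _ = ‖(g T - L * T) + ((g t - L * t) - (g T - L * T))‖ := by congr 1; ring
        _ ≤ _ := (norm_add_le _ _).trans (by linarith)
    have h6 : ‖t - T‖ ≤ t + |T| := by
      refine (norm_sub_le _ _).trans ?_
      rw [Real.norm_of_nonneg h2, Real.norm_eq_abs]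
    have h7 : ‖g T - L * T‖ + ε / 2 * |T| ≤ ε / 2 * t := by
      rw [div_mul_eq_mul_div, div_le_iff₀ hε] at h3
      linarith
    rw [Real.norm_of_nonneg h2]
    nlinarith
  have h2 := key.tendsto_div_nhds_zero
  have h3 := h2.add_const L
  rw [zero_add] at h3
  refine h3.congr' ?_
  filter_upwards [eventually_gt_atTop 0] with t ht
  field_simp
  ring

section

/-! ### Planar systems with a slow and a fast variable -/

/-- Bounds for the system `x' = -x * F x w`, `w' = -G x w` near its fixed point `(0, 0)`. -/
structure SlowFast (k N : ℕ) (a c C ρ : ℝ) (F G : ℝ → ℝ → ℝ) : Prop where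
  one_le : 1 ≤ k
  le_order : 2 * k + 2 ≤ N
  a_pos : 0 < a
  c_pos : 0 < c
  C_nonneg : 0 ≤ C
  ρ_pos : 0 < ρ
  slow : ∀ x w, |x| ≤ ρ → |w| ≤ ρ → |F x w - a * x ^ (2 * k)| ≤ C * (|w| + |x| ^ (2 * k + 2))
  fast : ∀ x w, |x| ≤ ρ → |w| ≤ ρ → |G x w - c * w| ≤ C * (|w| * (|x| + |w|) + |x| ^ N)

/-- A curve that solves the system at all times `t ≥ 0` at which it is in the box of radius `r`. -/
structure IsSolutionInBox (F G : ℝ → ℝ → ℝ) (r : ℝ) (x w : ℝ → ℝ) : Prop where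
  contx : ContinuousOn x (Set.Ici 0)
  contw : ContinuousOn w (Set.Ici 0)
  deriv : ∀ t, 0 < t → |x t| ≤ r → |w t| ≤ r →
    HasDerivAt x (-(x t * F (x t) (w t))) t ∧ HasDerivAt w (-G (x t) (w t)) t

/-- With Z = X^{2k+1}, the linear damping controls Q = W² + Z², at least 2·min(a,c)·Q. The errors
are at most rCQ times 2·3 (fast equation) plus (2k+2)·2 (slow equation), which is the constant
4k+10; smallness of r leaves min(a,c)·Q. Finally (W² + XZ)² ≤ 2Q. -/
theorem SlowFast.dissipation_aux {k : ℕ} {a c C r X W : ℝ} (hC : 0 ≤ C) (hr1 : r ≤ 1)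
    (ha : 0 ≤ a) (hc : 0 ≤ c) (hr : r * (C * (4 * k + 10)) ≤ min a c)
    (hX : 0 ≤ X) (hW : 0 ≤ W) (hXr : X ≤ r) (hWr : W ≤ r) :
    min a c / 2 * (W ^ 2 + X ^ (2 * k + 2)) ^ 2 ≤
      2 * (c * W ^ 2 - C * W * (W * (X + W) + X ^ (2 * k + 2)))
      + (2 * k + 2) * (X ^ (2 * k + 2) * (a * X ^ (2 * k) - C * (W + X ^ (2 * k + 2)))) := by
  obtain ⟨Z, hZ⟩ : ∃ Z, Z = X ^ (2 * k + 1) := ⟨_, rfl⟩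
  have hZ0 : 0 ≤ Z := hZ ▸ pow_nonneg hX _
  have e1 : X ^ (2 * k + 2) = X * Z := by rw [hZ]; ring
  have e2 : X * Z * X ^ (2 * k) = Z ^ 2 := by rw [hZ]; ring
  have hZ1 : Z ≤ 1 := hZ ▸ pow_le_one₀ hX (hXr.trans hr1)
  have hr0 : 0 ≤ r := hX.trans hXr
  rw [e1]
  set δ := min a c
  have hδa : δ ≤ a := min_le_left _ _
  have hδc : δ ≤ c := min_le_right _ _
  have hδ0 : 0 ≤ δ := le_min ha hc
  set Q := W ^ 2 + Z ^ 2
  have hQ0 : 0 ≤ Q := by positivity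
  have h1 : W * (X * Z) ≤ r * Q := by
    have : W * Z ≤ Q := by nlinarith [sq_nonneg (W - Z)]
    calc W * (X * Z) = X * (W * Z) := by ring
      _ ≤ r * Q := mul_le_mul hXr this (by positivity) hr0
  have h2 : (X * Z) * (X * Z) ≤ r * Q := by
    have : X * X ≤ r := by nlinarith
    calc (X * Z) * (X * Z) = (X * X) * Z ^ 2 := by ring
      _ ≤ r * Q := mul_le_mul this (by nlinarith) (by positivity) hr0
  have h3 : W ^ 2 * (X + W) ≤ 2 * (r * Q) := by
    calc W ^ 2 * (X + W) ≤ Q * (2 * r) :=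
          mul_le_mul (by nlinarith) (by linarith) (by positivity) hQ0
      _ = 2 * (r * Q) := by ring
  have h4 : (W ^ 2 + X * Z) ^ 2 ≤ 2 * Q := by
    have hW1 : W ^ 2 ≤ 1 := by nlinarith
    have hX1 : X ^ 2 ≤ 1 := by nlinarith
    have p1 : W ^ 2 * W ^ 2 ≤ 1 * W ^ 2 := mul_le_mul_of_nonneg_right hW1 (sq_nonneg _)
    have p2 : X ^ 2 * Z ^ 2 ≤ 1 * Z ^ 2 := mul_le_mul_of_nonneg_right hX1 (sq_nonneg _)
    nlinarith [sq_nonneg (W ^ 2 - X * Z)]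
  have h5 : r * (C * (4 * k + 10)) * Q ≤ δ * Q := mul_le_mul_of_nonneg_right hr hQ0
  have hk : (0 : ℝ) ≤ k := k.cast_nonneg
  have hmain : (2 * (k : ℝ) + 2) * (X * Z * (a * X ^ (2 * k) - C * (W + X * Z)))
      = (2 * k + 2) * (a * Z ^ 2) - (2 * k + 2) * C * (W * (X * Z) + (X * Z) * (X * Z)) := by
    rw [← e2]; ring
  rw [hmain]
  have g1 : (2 * (k : ℝ) + 2) * C * (W * (X * Z) + (X * Z) * (X * Z))
      ≤ (2 * k + 2) * C * (2 * (r * Q)) :=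
    mul_le_mul_of_nonneg_left (by linarith) (by positivity)
  have g2 : C * (W ^ 2 * (X + W) + W * (X * Z)) ≤ C * (3 * (r * Q)) :=
    mul_le_mul_of_nonneg_left (by linarith) hC
  have g3 : 2 * (δ * Q) ≤ 2 * (c * W ^ 2) + (2 * k + 2) * (a * Z ^ 2) := by
    have q1 : δ * W ^ 2 ≤ c * W ^ 2 := mul_le_mul_of_nonneg_right hδc (sq_nonneg _)
    have q2 : δ * Z ^ 2 ≤ a * Z ^ 2 := mul_le_mul_of_nonneg_right hδa (sq_nonneg _)
    have q3 : 0 ≤ k * (a * Z ^ 2) := by positivity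
    calc 2 * (δ * Q) = 2 * (δ * W ^ 2) + 2 * (δ * Z ^ 2) := by ring
      _ ≤ _ := by linarith
  have g4 : δ / 2 * (W ^ 2 + X * Z) ^ 2 ≤ δ / 2 * (2 * Q) :=
    mul_le_mul_of_nonneg_left h4 (by linarith)
  nlinarith

variable {k N : ℕ} {a c C ρ : ℝ} {F G : ℝ → ℝ → ℝ}

/-- The radii of the boxes in which the Lyapunov function `w ^ 2 + x ^ (2 * k + 2)` decreases. -/
def IsSmallRadius (k : ℕ) (a c C ρ r : ℝ) : Prop :=
  0 < r ∧ r ≤ 1 ∧ r ≤ ρ ∧ r * (C * (4 * k + 10)) ≤ min a c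

theorem SlowFast.eventually_isSmallRadius (H : SlowFast k N a c C ρ F G) :
    ∀ᶠ r in 𝓝[>] (0 : ℝ), IsSmallRadius k a c C ρ r := by
  have h1 : Tendsto (fun r : ℝ => r * (C * (4 * k + 10))) (𝓝[>] 0) (𝓝 0) :=
    (Continuous.tendsto' (by fun_prop) 0 0 (by simp)).mono_left nhdsWithin_le_nhds
  filter_upwards [self_mem_nhdsWithin, Ioc_mem_nhdsGT one_pos, Ioc_mem_nhdsGT H.ρ_pos,
    h1.eventually (ge_mem_nhds (lt_min H.a_pos H.c_pos))] with r h1 h2 h3 h4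
  exact ⟨h1, h2.2, h3.2, h4⟩

/-- The left side is the derivative of the Lyapunov function along the flow. All powers of x that
have to be signed are even, so the bound for |x| and |w| transfers. -/
theorem SlowFast.dissipation (H : SlowFast k N a c C ρ F G) {r : ℝ}
    (hr : IsSmallRadius k a c C ρ r) {x w : ℝ} (hx : |x| ≤ r) (hw : |w| ≤ r) :
    2 * w * -G x w + (2 * k + 2) * x ^ (2 * k + 1) * -(x * F x w)
      ≤ -(min a c / 2) * (w ^ 2 + x ^ (2 * k + 2)) ^ 2 := by
  obtain ⟨hr0, hr1, hrρ, hrδ⟩ := hr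
  have h1 := H.slow x w (hx.trans hrρ) (hw.trans hrρ)
  have h2 := H.fast x w (hx.trans hrρ) (hw.trans hrρ)
  have h3 := SlowFast.dissipation_aux (k := k) H.C_nonneg hr1 H.a_pos.le H.c_pos.le hrδ
    (abs_nonneg x) (abs_nonneg w) hx hw
  have e1 : |x| ^ (2 * k) = x ^ (2 * k) := by rw [pow_mul, pow_mul, sq_abs]
  have e2 : |x| ^ (2 * k + 2) = x ^ (2 * k + 2) := by
    rw [show 2 * k + 2 = 2 * (k + 1) by ring, pow_mul, pow_mul, sq_abs]
  have e3 : |x| ^ N ≤ |x| ^ (2 * k + 2) :=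
    pow_le_pow_of_le_one (abs_nonneg x) (hx.trans hr1) H.le_order
  have hp : 0 ≤ x ^ (2 * k + 2) := e2 ▸ pow_nonneg (abs_nonneg x) _
  rw [e1, e2, sq_abs] at h3
  rw [e2] at h1 e3
  have f1 : a * x ^ (2 * k) - C * (|w| + x ^ (2 * k + 2)) ≤ F x w := by
    have := neg_abs_le (F x w - a * x ^ (2 * k)); linarith
  have f2 : x ^ (2 * k + 2) * (a * x ^ (2 * k) - C * (|w| + x ^ (2 * k + 2)))
      ≤ x ^ (2 * k + 2) * F x w := mul_le_mul_of_nonneg_left f1 hp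
  have f3 : -(|w| * (C * (|w| * (|x| + |w|) + x ^ (2 * k + 2)))) ≤ w * (G x w - c * w) := by
    have : |w * (G x w - c * w)| ≤ |w| * (C * (|w| * (|x| + |w|) + x ^ (2 * k + 2))) := by
      rw [abs_mul]
      refine mul_le_mul_of_nonneg_left (h2.trans ?_) (abs_nonneg w)
      exact mul_le_mul_of_nonneg_left (by linarith) H.C_nonneg
    linarith [neg_abs_le (w * (G x w - c * w))]
  have f4 : (2 * (k : ℝ) + 2) *
      (x ^ (2 * k + 2) * (a * x ^ (2 * k) - C * (|w| + x ^ (2 * k + 2))))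
      ≤ (2 * k + 2) * (x ^ (2 * k + 2) * F x w) := mul_le_mul_of_nonneg_left f2 (by positivity)
  have e4 : (2 * (k : ℝ) + 2) * x ^ (2 * k + 1) * -(x * F x w)
      = -((2 * k + 2) * (x ^ (2 * k + 2) * F x w)) := by ring
  rw [e4]
  nlinarith

/-! ### Confinement and convergence of solutions in a box -/

section Solutions

variable {r : ℝ} {x w : ℝ → ℝ}

theorem abs_le_of_lyapunov_lt {k : ℕ} {r x w : ℝ} (hr0 : 0 < r) (hr1 : r ≤ 1)
    (h : w ^ 2 + x ^ (2 * k + 2) < r ^ (2 * k + 2)) : |x| ≤ r ∧ |w| ≤ r := by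
  have e2 : |x| ^ (2 * k + 2) = x ^ (2 * k + 2) := by
    rw [show 2 * k + 2 = 2 * (k + 1) by ring, pow_mul, pow_mul, sq_abs]
  have hp : 0 ≤ x ^ (2 * k + 2) := e2 ▸ pow_nonneg (abs_nonneg x) _
  constructor
  · refine le_of_pow_le_pow_left₀ (n := 2 * k + 2) (by lia) hr0.le ?_
    rw [e2]; nlinarith [sq_nonneg w]
  · refine abs_le_of_sq_le_sq ?_ hr0.le
    have : r ^ (2 * k + 2) ≤ r ^ 2 := pow_le_pow_of_le_one hr0.le hr1 (by lia)
    linarith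

theorem hasDerivAt_lyapunov {k : ℕ} {x w : ℝ → ℝ} {dx dw t : ℝ} (hx : HasDerivAt x dx t)
    (hw : HasDerivAt w dw t) :
    HasDerivAt (fun t => w t ^ 2 + x t ^ (2 * k + 2))
      (2 * w t * dw + (2 * k + 2) * x t ^ (2 * k + 1) * dx) t := by
  refine ((hw.pow 2).add (hx.pow (2 * k + 2))).congr_deriv ?_
  push_cast
  simp

theorem IsSolutionInBox.lyapunov_lt (H : SlowFast k N a c C ρ F G)
    (hr : IsSmallRadius k a c C ρ r) (S : IsSolutionInBox F G r x w)
    (h0 : w 0 ^ 2 + x 0 ^ (2 * k + 2) < r ^ (2 * k + 2)) {t : ℝ} (ht : 0 ≤ t) :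
    w t ^ 2 + x t ^ (2 * k + 2) < r ^ (2 * k + 2) := by
  refine lt_of_hasDerivAt_nonpos_of_lt (V := fun t => w t ^ 2 + x t ^ (2 * k + 2))
    ((S.contw.pow 2).add (S.contx.pow _)) h0 (fun s hs hV => ?_) ht
  obtain ⟨hx, hw⟩ := abs_le_of_lyapunov_lt hr.1 hr.2.1 hV
  obtain ⟨dx, dw⟩ := S.deriv s hs hx hw
  refine ⟨_, hasDerivAt_lyapunov dx dw, (H.dissipation hr hx hw).trans ?_⟩
  have := lt_min H.a_pos H.c_pos
  nlinarith [mul_nonneg this.le (sq_nonneg (w s ^ 2 + x s ^ (2 * k + 2)))]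

theorem IsSolutionInBox.abs_le_radius (H : SlowFast k N a c C ρ F G)
    (hr : IsSmallRadius k a c C ρ r) (S : IsSolutionInBox F G r x w)
    (h0 : w 0 ^ 2 + x 0 ^ (2 * k + 2) < r ^ (2 * k + 2)) {t : ℝ} (ht : 0 ≤ t) :
    |x t| ≤ r ∧ |w t| ≤ r :=
  abs_le_of_lyapunov_lt hr.1 hr.2.1 (S.lyapunov_lt H hr h0 ht)

theorem SlowFast.abs_slow_le (H : SlowFast k N a c C ρ F G) (hr : IsSmallRadius k a c C ρ r)
    {x w : ℝ} (hx : |x| ≤ r) (hw : |w| ≤ r) : |F x w| ≤ a + 2 * C := by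
  obtain ⟨hr0, hr1, hrρ, hrδ⟩ := hr
  have h1 := H.slow x w (hx.trans hrρ) (hw.trans hrρ)
  have h2 : |a * x ^ (2 * k)| ≤ a := by
    rw [abs_mul, abs_of_pos H.a_pos, abs_pow]
    exact mul_le_of_le_one_right H.a_pos.le (pow_le_one₀ (abs_nonneg x) (hx.trans hr1))
  have h3 : |w| + |x| ^ (2 * k + 2) ≤ 2 := by
    have := pow_le_one₀ (n := 2 * k + 2) (abs_nonneg x) (hx.trans hr1)
    linarith
  have h4 := mul_le_mul_of_nonneg_left h3 H.C_nonneg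
  calc |F x w| = |(F x w - a * x ^ (2 * k)) + a * x ^ (2 * k)| := by ring_nf
    _ ≤ _ := (abs_add_le _ _).trans (by linarith)

/-- The slow equation is x' = -xF with |F| ≤ M, so x² exp(2Mt) is nondecreasing: x decays at most
exponentially and cannot vanish in finite time. -/
theorem IsSolutionInBox.ne_zero (H : SlowFast k N a c C ρ F G)
    (hr : IsSmallRadius k a c C ρ r) (S : IsSolutionInBox F G r x w)
    (h0 : w 0 ^ 2 + x 0 ^ (2 * k + 2) < r ^ (2 * k + 2)) (hx0 : x 0 ≠ 0) {t : ℝ} (ht : 0 ≤ t) :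
    x t ≠ 0 := by
  set M := a + 2 * C
  have hanti : AntitoneOn (fun t => -(x t ^ 2 * Real.exp (2 * M * t))) (Set.Ici 0) := by
    refine antitoneOn_Ici_of_hasDerivAt_nonpos ?_ (fun s hs => ?_)
    · exact ((S.contx.pow 2).mul (by fun_prop)).neg
    · obtain ⟨hx, hw⟩ := S.abs_le_radius H hr h0 hs.le
      obtain ⟨dx, -⟩ := S.deriv s hs hx hw
      refine ⟨_, ((dx.pow 2).mul (((hasDerivAt_id s).const_mul (2 * M)).exp)).neg, ?_⟩
      have hF := (abs_le.1 (H.abs_slow_le hr hx hw)).2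
      have hE := Real.exp_pos (2 * M * s)
      have : 0 ≤ x s ^ 2 * Real.exp (2 * M * s) * (M - F (x s) (w s)) :=
        mul_nonneg (by positivity) (by linarith)
      simp only [Nat.cast_ofNat, Nat.add_one_sub_one, pow_one, id_eq, mul_one, Pi.pow_apply]
      nlinarith
  have h := hanti (Set.mem_Ici.2 le_rfl) (Set.mem_Ici.2 ht) ht
  intro hxt
  simp only [hxt, mul_zero, Real.exp_zero, mul_one] at h
  norm_num at h
  exact hx0 h

theorem IsSolutionInBox.sign_eq (H : SlowFast k N a c C ρ F G)
    (hr : IsSmallRadius k a c C ρ r) (S : IsSolutionInBox F G r x w)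
    (h0 : w 0 ^ 2 + x 0 ^ (2 * k + 2) < r ^ (2 * k + 2)) (hx0 : x 0 ≠ 0) {t : ℝ} (ht : 0 ≤ t) :
    Real.sign (x t) = Real.sign (x 0) := by
  have hne : ∀ s, 0 ≤ s → x s ≠ 0 := fun s hs => S.ne_zero H hr h0 hx0 hs
  have hpre : IsPreconnected (x '' Set.Icc 0 t) :=
    isPreconnected_Icc.image _ (S.contx.mono Set.Icc_subset_Ici_self)
  have m0 : x 0 ∈ x '' Set.Icc 0 t := ⟨0, ⟨le_rfl, ht⟩, rfl⟩
  have mt : x t ∈ x '' Set.Icc 0 t := ⟨t, ⟨ht, le_rfl⟩, rfl⟩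
  have hz : (0 : ℝ) ∉ x '' Set.Icc 0 t := by
    rintro ⟨s, hs, h⟩
    exact hne s hs.1 h
  rcases hx0.lt_or_gt with h | h <;> rcases (hne t ht).lt_or_gt with h' | h'
  · rw [Real.sign_of_neg h, Real.sign_of_neg h']
  · exact absurd (hpre.Icc_subset m0 mt ⟨h.le, h'.le⟩) hz
  · exact absurd (hpre.Icc_subset mt m0 ⟨h'.le, h.le⟩) hz
  · rw [Real.sign_of_pos h, Real.sign_of_pos h']

/-- The comparison lemma divides by V, and its positivity comes from x never vanishing. -/
theorem IsSolutionInBox.tendsto_zero (H : SlowFast k N a c C ρ F G)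
    (hr : IsSmallRadius k a c C ρ r) (S : IsSolutionInBox F G r x w)
    (h0 : w 0 ^ 2 + x 0 ^ (2 * k + 2) < r ^ (2 * k + 2)) (hx0 : x 0 ≠ 0) :
    Tendsto x atTop (𝓝 0) ∧ Tendsto w atTop (𝓝 0) := by
  have hev : ∀ x : ℝ, |x| ^ (2 * k + 2) = x ^ (2 * k + 2) := fun x => by
    rw [show 2 * k + 2 = 2 * (k + 1) by ring, pow_mul, pow_mul, sq_abs]
  have hV : Tendsto (fun t => w t ^ 2 + x t ^ (2 * k + 2)) atTop (𝓝 0) := by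
    refine tendsto_zero_of_hasDerivAt_le_neg_sq (δ := min a c / 2)
      (half_pos (lt_min H.a_pos H.c_pos)) ((S.contw.pow 2).add (S.contx.pow _)) ?_ ?_
    · intro t ht
      have : 0 < x t ^ (2 * k + 2) := by
        rw [← hev]; exact pow_pos (abs_pos.2 (S.ne_zero H hr h0 hx0 ht)) _
      positivity
    · intro t ht
      obtain ⟨hx, hw⟩ := S.abs_le_radius H hr h0 ht.le
      obtain ⟨dx, dw⟩ := S.deriv t ht hx hw
      exact ⟨_, hasDerivAt_lyapunov dx dw, H.dissipation hr hx hw⟩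
  constructor
  · have h1 : Tendsto (fun t => |x t| ^ (2 * k + 2)) atTop (𝓝 0) := by
      refine squeeze_zero (fun t => pow_nonneg (abs_nonneg _) _) (fun t => ?_) hV
      rw [hev]; nlinarith [sq_nonneg (w t)]
    rw [Metric.tendsto_atTop'] at h1 ⊢
    intro ε hε
    obtain ⟨T, hT⟩ := h1 (ε ^ (2 * k + 2)) (by positivity)
    refine ⟨T, fun t ht => ?_⟩
    have := hT t ht
    rw [Real.dist_0_eq_abs, abs_of_nonneg (by positivity)] at this
    rw [Real.dist_0_eq_abs]
    exact lt_of_pow_lt_pow_left₀ _ hε.le this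
  · have h1 : Tendsto (fun t => w t ^ 2) atTop (𝓝 0) := by
      refine squeeze_zero (fun t => sq_nonneg _) (fun t => ?_) hV
      have := pow_nonneg (abs_nonneg (x t)) (2 * k + 2)
      rw [hev] at this
      linarith
    have h2 := h1.sqrt
    simp only [Real.sqrt_sq_eq_abs, Real.sqrt_zero] at h2
    exact (tendsto_zero_iff_abs_tendsto_zero _).2 h2

end Solutions

end

/-! ### Asymptotics of the slow and fast variables -/

section

variable {k N : ℕ} {a c C ρ : ℝ} {F G : ℝ → ℝ → ℝ} {r : ℝ} {x w : ℝ → ℝ}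

theorem SlowFast.tendsto_slow (H : SlowFast k N a c C ρ F G)
    (hx : Tendsto x atTop (𝓝 0)) (hw : Tendsto w atTop (𝓝 0)) :
    Tendsto (fun t => F (x t) (w t)) atTop (𝓝 0) := by
  have hk := H.one_le
  have h1 : Tendsto (fun t => C * (|w t| + |x t| ^ (2 * k + 2)) + |a * x t ^ (2 * k)|)
      atTop (𝓝 0) := by
    have := ((hw.abs.add (hx.abs.pow (2 * k + 2))).const_mul C).add
      (((hx.pow (2 * k)).const_mul a).abs)
    simpa [zero_pow (show 2 * k ≠ 0 by lia)] using this
  rw [tendsto_zero_iff_abs_tendsto_zero]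
  refine tendsto_of_tendsto_of_tendsto_of_le_of_le' tendsto_const_nhds h1
    (Eventually.of_forall fun t => abs_nonneg _) ?_
  have hx' : Tendsto (fun t => |x t|) atTop (𝓝 0) := by simpa using hx.abs
  have hw' : Tendsto (fun t => |w t|) atTop (𝓝 0) := by simpa using hw.abs
  filter_upwards [hx'.eventually (ge_mem_nhds H.ρ_pos), hw'.eventually (ge_mem_nhds H.ρ_pos)]
    with t h2 h3
  have := H.slow _ _ h2 h3
  calc |F (x t) (w t)| = |(F (x t) (w t) - a * x t ^ (2 * k)) + a * x t ^ (2 * k)| := by ring_nf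
    _ ≤ _ := (abs_add_le _ _).trans (by linarith)

/-- The fast variable becomes negligible against every power of the slow variable below the order
of the remainder. -/
theorem IsSolutionInBox.tendsto_fast_div_pow (H : SlowFast k N a c C ρ F G)
    (hr : IsSmallRadius k a c C ρ r) (S : IsSolutionInBox F G r x w)
    (h0 : w 0 ^ 2 + x 0 ^ (2 * k + 2) < r ^ (2 * k + 2)) (hx0 : x 0 ≠ 0) {j : ℕ} (hj : j < N) :
    Tendsto (fun t => w t / x t ^ j) atTop (𝓝 0) := by
  obtain ⟨hx, hw⟩ := S.tendsto_zero H hr h0 hx0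
  have hF := H.tendsto_slow hx hw
  have hne : ∀ t, 0 ≤ t → x t ≠ 0 := fun t ht => S.ne_zero H hr h0 hx0 ht
  -- With y = w/x^j, the derivative of y² is at most -2cy² + E y² + E: the last term of E is the
  -- drift of x^j, the middle one needs j < N and 2|y| ≤ y² + 1. Once E ≤ c and E ≤ e this is at
  -- most -cy² + e.
  set E : ℝ → ℝ := fun t => 2 * C * (|x t| + |w t|) + C * |x t| ^ (N - j)
    + 2 * j * |F (x t) (w t)|
  have hE : Tendsto E atTop (𝓝 0) := by
    have := (((hx.abs.add hw.abs).const_mul (2 * C)).add ((hx.abs.pow (N - j)).const_mul C)).add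
      (hF.abs.const_mul (2 * (j : ℝ)))
    simpa [zero_pow (show N - j ≠ 0 by lia)] using this
  have hu : Tendsto (fun t => (w t / x t ^ j) ^ 2) atTop (𝓝 0) := by
    refine tendsto_zero_of_hasDerivAt_le H.c_pos ?_ (fun t _ => sq_nonneg _) ?_
    · exact (S.contw.div (S.contx.pow j) fun t ht => pow_ne_zero j (hne t ht)).pow 2
    · intro e he
      filter_upwards [hE.eventually (ge_mem_nhds H.c_pos), hE.eventually (ge_mem_nhds he),
        eventually_gt_atTop 0] with t hEc hEe ht
      obtain ⟨hxr, hwr⟩ := S.abs_le_radius H hr h0 ht.le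
      obtain ⟨dx, dw⟩ := S.deriv t ht hxr hwr
      have hxt := hne t ht.le
      have hfast := H.fast _ _ (hxr.trans hr.2.2.1) (hwr.trans hr.2.2.1)
      refine ⟨_, (dw.div (dx.pow j) (pow_ne_zero j hxt)).pow 2, ?_⟩
      set X := x t
      set W := w t
      set y := W / X ^ j with hy
      set f := F X W
      set q := (G X W - c * W) / X ^ j with hq
      have hpow : (X ^ j) ≠ 0 := pow_ne_zero j hxt
      have hW : W = y * X ^ j := by rw [hy, div_mul_cancel₀ _ hpow]
      have hder : (-G X W * X ^ j - W * ((j : ℝ) * X ^ (j - 1) * -(X * f))) / (X ^ j) ^ 2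
          = -(c * y) - q + j * (y * f) := by
        have hj' : (j : ℝ) * X ^ (j - 1) * -(X * f) = -(j * X ^ j * f) := by
          rcases Nat.eq_zero_or_pos j with h | h
          · simp [h]
          · have : X ^ j = X ^ (j - 1) * X := by rw [← pow_succ, Nat.sub_add_cancel h]
            rw [this]; ring
        rw [hj', hq, hy]
        field_simp
        ring
      have hqb : |q| ≤ C * (|y| * (|X| + |W|) + |X| ^ (N - j)) := by
        rw [hq, abs_div, div_le_iff₀ (abs_pos.2 hpow)]
        refine hfast.trans (le_of_eq ?_)
        have e1 : |W| = |y| * |X| ^ j := by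
          conv_lhs => rw [hW, abs_mul, abs_pow]
        have e2 : |X| ^ N = |X| ^ (N - j) * |X| ^ j := by rw [← pow_add, Nat.sub_add_cancel hj.le]
        rw [e2, abs_pow]
        nth_rewrite 1 [e1]
        ring
      simp only [Nat.cast_ofNat, Nat.add_one_sub_one, pow_one, Pi.pow_apply, Pi.div_apply]
      have hgoal : 2 * y * ((-G X W * X ^ j - W * ((j : ℝ) * X ^ (j - 1) * -(X * f))) /
          (X ^ j) ^ 2) ≤ -c * y ^ 2 + e := by
        rw [hder]
        have b1 : -(y * q) ≤ |y| * (C * (|y| * (|X| + |W|) + |X| ^ (N - j))) :=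
          (neg_le_abs _).trans (by rw [abs_mul]; exact mul_le_mul_of_nonneg_left hqb (abs_nonneg y))
        have b2 : y ^ 2 * f ≤ y ^ 2 * |f| := mul_le_mul_of_nonneg_left (le_abs_self f) (sq_nonneg y)
        have b3 : (j : ℝ) * (y ^ 2 * f) ≤ j * (y ^ 2 * |f|) :=
          mul_le_mul_of_nonneg_left b2 j.cast_nonneg
        have b4 : 2 * |y| ≤ y ^ 2 + 1 := by nlinarith [sq_nonneg (|y| - 1), sq_abs y]
        have b5 : 2 * |y| * (C * |X| ^ (N - j)) ≤ (y ^ 2 + 1) * (C * |X| ^ (N - j)) :=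
          mul_le_mul_of_nonneg_right b4 (mul_nonneg H.C_nonneg (pow_nonneg (abs_nonneg _) _))
        have b6 : |y| * (C * (|y| * (|X| + |W|) + |X| ^ (N - j)))
            = C * (y ^ 2 * (|X| + |W|)) + |y| * (C * |X| ^ (N - j)) := by
          rw [← sq_abs y]; ring
        have hEt : E t = 2 * C * (|X| + |W|) + C * |X| ^ (N - j) + 2 * j * |f| := rfl
        have b7 : y ^ 2 * E t ≤ y ^ 2 * c := mul_le_mul_of_nonneg_left hEc (sq_nonneg y)
        rw [hEt] at b7 hEe
        have p1 : 0 ≤ C * (|X| + |W|) := mul_nonneg H.C_nonneg (by positivity)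
        have p2 : 0 ≤ (j : ℝ) * |f| := by positivity
        nlinarith
      exact hgoal
  have h2 := hu.sqrt
  simp only [Real.sqrt_sq_eq_abs, Real.sqrt_zero] at h2
  exact (tendsto_zero_iff_abs_tendsto_zero _).2 h2

/-- The case j = 2k of the previous estimate makes the term C|w| in the bound for F negligible
against x^{2k}. -/
theorem IsSolutionInBox.tendsto_slow_div_pow (H : SlowFast k N a c C ρ F G)
    (hr : IsSmallRadius k a c C ρ r) (S : IsSolutionInBox F G r x w)
    (h0 : w 0 ^ 2 + x 0 ^ (2 * k + 2) < r ^ (2 * k + 2)) (hx0 : x 0 ≠ 0) :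
    Tendsto (fun t => F (x t) (w t) / x t ^ (2 * k)) atTop (𝓝 a) := by
  obtain ⟨hx, -⟩ := S.tendsto_zero H hr h0 hx0
  have hy := S.tendsto_fast_div_pow H hr h0 hx0 (j := 2 * k) (by have := H.le_order; lia)
  have hlim : Tendsto (fun t => C * (|w t / x t ^ (2 * k)| + x t ^ 2)) atTop (𝓝 0) := by
    have := (hy.abs.add (hx.pow 2)).const_mul C
    simpa using this
  rw [tendsto_iff_norm_sub_tendsto_zero]
  refine tendsto_of_tendsto_of_tendsto_of_le_of_le' tendsto_const_nhds hlim
    (Eventually.of_forall fun t => norm_nonneg _) ?_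
  filter_upwards [eventually_ge_atTop 0] with t ht
  obtain ⟨hxr, hwr⟩ := S.abs_le_radius H hr h0 ht
  have hslow := H.slow _ _ (hxr.trans hr.2.2.1) (hwr.trans hr.2.2.1)
  have hp : x t ^ (2 * k) ≠ 0 := pow_ne_zero _ (S.ne_zero H hr h0 hx0 ht)
  have e1 : F (x t) (w t) / x t ^ (2 * k) - a
      = (F (x t) (w t) - a * x t ^ (2 * k)) / x t ^ (2 * k) := by field_simp
  rw [e1, Real.norm_eq_abs, abs_div, div_le_iff₀ (abs_pos.2 hp)]
  refine hslow.trans (le_of_eq ?_)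
  rw [abs_div, mul_assoc, add_mul, div_mul_cancel₀ _ (abs_ne_zero.2 hp), abs_pow, pow_add, sq_abs,
    mul_comm (x t ^ 2)]

/-- Algebraic relaxation of the slow variable. -/
theorem IsSolutionInBox.tendsto_mul_rpow (H : SlowFast k N a c C ρ F G)
    (hr : IsSmallRadius k a c C ρ r) (S : IsSolutionInBox F G r x w)
    (h0 : w 0 ^ 2 + x 0 ^ (2 * k + 2) < r ^ (2 * k + 2)) (hx0 : x 0 ≠ 0) :
    Tendsto (fun t => x t * t ^ (1 / (2 * k) : ℝ)) atTop
      (𝓝 (Real.sign (x 0) * (1 / (2 * k * a)) ^ (1 / (2 * k) : ℝ))) := by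
  have hk := H.one_le
  have hne : ∀ t, 0 ≤ t → x t ≠ 0 := fun t ht => S.ne_zero H hr h0 hx0 ht
  -- The derivative of x^{-2k} is 2kF/x^{2k}, which tends to 2ka; taking the root of order 2k of the
  -- reciprocal gives the decay law.
  have hg : Tendsto (fun t => (x t ^ (2 * k))⁻¹ / t) atTop (𝓝 (2 * k * a)) := by
    refine tendsto_div_of_tendsto_hasDerivAt
      (g' := fun t => 2 * k * (F (x t) (w t) / x t ^ (2 * k))) ?_
      ((S.tendsto_slow_div_pow H hr h0 hx0).const_mul _)
    filter_upwards [eventually_gt_atTop 0] with t ht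
    obtain ⟨hxr, hwr⟩ := S.abs_le_radius H hr h0 ht.le
    obtain ⟨dx, -⟩ := S.deriv t ht hxr hwr
    have hxt := hne t ht.le
    refine ((dx.pow (2 * k)).fun_inv (pow_ne_zero _ hxt)).congr_deriv ?_
    have : x t ^ (2 * k) = x t ^ (2 * k - 1) * x t := by
      rw [← pow_succ, Nat.sub_add_cancel (by lia)]
    simp only [Pi.pow_apply]
    have hp : x t ^ (2 * k) ≠ 0 := pow_ne_zero _ hxt
    push_cast
    field_simp
    rw [this]
    ring
  have hpos : (2 * k * a : ℝ) ≠ 0 := by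
    have := H.a_pos
    have : (0 : ℝ) < k := by exact_mod_cast hk
    positivity
  have h1 := (hg.inv₀ hpos).rpow_const (p := (1 / (2 * k) : ℝ)) (Or.inr (by positivity))
  have h2 := h1.const_mul (Real.sign (x 0))
  rw [one_div (2 * k * a)]
  refine h2.congr' ?_
  filter_upwards [eventually_gt_atTop 0] with t ht
  have e1 : ((x t ^ (2 * k))⁻¹ / t)⁻¹ = |x t| ^ (2 * k) * t := by
    rw [inv_div, div_inv_eq_mul, mul_comm, pow_mul, pow_mul, sq_abs]
  rw [e1, Real.mul_rpow (by positivity) ht.le, ← Real.rpow_natCast, ← Real.rpow_mul (abs_nonneg _)]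
  have e2 : ((2 * k : ℕ) : ℝ) * (1 / (2 * k)) = 1 := by
    have : (k : ℝ) ≠ 0 := by exact_mod_cast (show k ≠ 0 by lia)
    push_cast
    field_simp
  rw [e2, Real.rpow_one, ← S.sign_eq H hr h0 hx0 ht.le, ← mul_assoc]
  congr 1
  rcases (hne t ht.le).lt_or_gt with h | h
  · rw [Real.sign_of_neg h, abs_of_neg h]; ring
  · rw [Real.sign_of_pos h, abs_of_pos h]; ring

end

/-! ### Bounds at the origin -/

theorem IsBigO.exists_eq_mul_bounded {l : Filter ℝ} {f g : ℝ → ℝ} (h : f =O[l] g) :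
    ∃ φ : ℝ → ℝ, φ =O[l] (fun _ => (1 : ℝ)) ∧ ∀ᶠ x in l, f x = φ x * g x := by
  obtain ⟨φ, hφ, he⟩ := isBigO_iff_exists_eq_mul.1 h
  exact ⟨φ, (isBigO_one_iff ℝ).2 hφ, he⟩

theorem isBigO_one_of_continuous {l : Filter ℝ} {E : Type*} [NormedAddCommGroup E]
    [ProperSpace E] {f : E → ℝ} (hf : Continuous f) {u : ℝ → E}
    (hu : u =O[l] (fun _ => (1 : ℝ))) : (fun x => f (u x)) =O[l] (fun _ => (1 : ℝ)) := by
  obtain ⟨C, hC⟩ := hu.bound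
  obtain ⟨M, hM⟩ := (isCompact_closedBall (0 : E) C).exists_bound_of_continuousOn hf.continuousOn
  refine IsBigO.of_bound M ?_
  filter_upwards [hC] with x hx
  simpa using hM (u x) (by simpa using hx)

theorem isBigO_sub_of_contDiff {l : Filter ℝ} {E : Type*} [NormedAddCommGroup E] [NormedSpace ℝ E]
    [ProperSpace E] {f : E → ℝ} (hf : ContDiff ℝ 1 f) {u v : ℝ → E}
    (hu : u =O[l] (fun _ => (1 : ℝ))) (hv : v =O[l] (fun _ => (1 : ℝ))) :
    (fun x => f (u x) - f (v x)) =O[l] (fun x => u x - v x) := by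
  obtain ⟨C, hC⟩ := hu.bound
  obtain ⟨C', hC'⟩ := hv.bound
  obtain ⟨L, hL⟩ := (hf.locallyLipschitz.locallyLipschitzOn (s := Metric.closedBall (0 : E)
    (max C C'))).exists_lipschitzOnWith_of_compact (isCompact_closedBall _ _)
  refine IsBigO.of_bound L ?_
  filter_upwards [hC, hC'] with x hx hx'
  refine hL.norm_sub_le ?_ ?_
  · simpa using Or.inl (by simpa using hx)
  · simpa using Or.inr (by simpa using hx')

theorem isBigO_pow_succ_of_hasDerivAt {f f' : ℝ → ℝ} {n : ℕ} (hf : ∀ᶠ x in 𝓝 0,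
    HasDerivAt f (f' x) x) (h0 : f 0 = 0) (h : f' =O[𝓝 0] (fun x : ℝ => x ^ n)) :
    f =O[𝓝 0] (fun x : ℝ => x ^ (n + 1)) := by
  obtain ⟨C, hC⟩ := h.bound
  obtain ⟨ε, hε, hb⟩ := Metric.eventually_nhds_iff_ball.1 (hf.and hC)
  refine IsBigO.of_bound C ?_
  filter_upwards [Metric.ball_mem_nhds 0 hε] with x hx
  have hsub : ∀ y ∈ Metric.closedBall (0 : ℝ) |x|, y ∈ Metric.ball (0 : ℝ) ε := fun y hy => by
    simp only [Metric.mem_closedBall, Metric.mem_ball, dist_zero_right, Real.norm_eq_abs] at *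
    exact hy.trans_lt hx
  have hC0 : 0 ≤ C * |x| ^ n := by
    have := (norm_nonneg _).trans (hb x hx).2
    simpa using this
  have := (convex_closedBall (0 : ℝ) |x|).norm_image_sub_le_of_norm_hasDerivWithin_le
    (f := f) (f' := f') (C := C * |x| ^ n) (x := 0) (y := x)
    (fun y hy => (hb y (hsub y hy)).1.hasDerivWithinAt) (fun y hy => ?_) (by simp) (by simp)
  · rw [h0, sub_zero, sub_zero] at this
    refine this.trans (le_of_eq ?_)
    rw [norm_pow, Real.norm_eq_abs]
    ring
  · refine (hb y (hsub y hy)).2.trans ?_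
    have hy' : |y| ≤ |x| := by simpa using hy
    rw [norm_pow, Real.norm_eq_abs]
    rcases eq_or_ne x 0 with rfl | hx0
    · have : y = 0 := by simpa using hy'
      rw [this]
    · have hC1 : 0 ≤ C := nonneg_of_mul_nonneg_left hC0 (by positivity)
      gcongr

theorem isBigO_pow_of_le {m n : ℕ} (h : m ≤ n) :
    (fun x : ℝ => x ^ n) =O[𝓝 0] (fun x : ℝ => x ^ m) := by
  obtain ⟨d, rfl⟩ := Nat.exists_eq_add_of_le h
  have h1 : (fun x : ℝ => x ^ d) =O[𝓝 0] (fun _ => (1 : ℝ)) :=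
    (continuous_pow d).continuousAt.isBigO_one ℝ
  simpa [pow_add] using (isBigO_refl (fun x : ℝ => x ^ m) (𝓝 0)).mul h1

/-! ### The hyperbolic tangent -/

theorem hasDerivAt_tanh (x : ℝ) : HasDerivAt Real.tanh (1 - Real.tanh x ^ 2) x := by
  have h := (Real.hasDerivAt_sinh x).div (Real.hasDerivAt_cosh x) (Real.cosh_pos x).ne'
  have he : Real.tanh = Real.sinh / Real.cosh := funext fun y => Real.tanh_eq_sinh_div_cosh y
  rw [he]
  refine h.congr_deriv ?_
  have := (Real.cosh_pos x).ne'
  simp only [Pi.div_apply]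
  field_simp

theorem analyticAt_tanh (x : ℝ) : AnalyticAt ℝ Real.tanh x := by
  have he : Real.tanh = fun y => Real.sinh y / Real.cosh y :=
    funext fun y => Real.tanh_eq_sinh_div_cosh y
  rw [he]
  fun_prop (disch := exact (Real.cosh_pos _).ne')

theorem contDiff_tanh {n : WithTop ℕ∞} : ContDiff ℝ n Real.tanh :=
  contDiff_iff_contDiffAt.2 fun x => (analyticAt_tanh x).contDiffAt

theorem tanh_isBigO : Real.tanh =O[𝓝 0] (fun x : ℝ => x) := by
  have := (hasDerivAt_tanh 0).isBigO_sub
  simpa using this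

/-- Start of a bootstrap on tanh' = 1 - tanh²: an error O(xⁿ) in tanh gives O(xⁿ⁺¹) in tanh², and
integration gives O(xⁿ⁺²). -/
theorem tanh_sub_isBigO_three : (fun x => Real.tanh x - x) =O[𝓝 0] (fun x : ℝ => x ^ 3) := by
  refine isBigO_pow_succ_of_hasDerivAt (f' := fun x => (1 - Real.tanh x ^ 2) - 1)
    (Eventually.of_forall fun x => (hasDerivAt_tanh x).sub (hasDerivAt_id' x)) (by simp) ?_
  simpa using tanh_isBigO.pow 2

theorem tanh_sub_isBigO_five :
    (fun x => Real.tanh x - x + x ^ 3 / 3) =O[𝓝 0] (fun x : ℝ => x ^ 5) := by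
  refine isBigO_pow_succ_of_hasDerivAt (f' := fun x => -((Real.tanh x - x) * (Real.tanh x + x)))
    (Eventually.of_forall fun x => ?_) (by simp) ?_
  · refine (((hasDerivAt_tanh x).sub (hasDerivAt_id' x)).add
      ((hasDerivAt_pow 3 x).div_const 3)).congr_deriv ?_
    norm_num; ring
  · have h := (tanh_sub_isBigO_three.mul (tanh_isBigO.add (isBigO_refl _ _))).neg_left
    refine h.congr_right fun x => ?_
    ring

theorem tanh_sub_isBigO_seven :
    (fun x => Real.tanh x - x + x ^ 3 / 3 - 2 * x ^ 5 / 15) =O[𝓝 0] (fun x : ℝ => x ^ 7) := by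
  refine isBigO_pow_succ_of_hasDerivAt (f' := fun x => -((Real.tanh x - x + x ^ 3 / 3) *
    (Real.tanh x + (x - x ^ 3 / 3))) - x ^ 6 / 9) (Eventually.of_forall fun x => ?_) (by simp) ?_
  · refine ((((hasDerivAt_tanh x).sub (hasDerivAt_id' x)).add
      ((hasDerivAt_pow 3 x).div_const 3)).sub
      (((hasDerivAt_pow 5 x).const_mul 2).div_const 15)).congr_deriv ?_
    norm_num; ring
  · have h1 : (fun x : ℝ => x - x ^ 3 / 3) =O[𝓝 0] (fun x : ℝ => x) := by
      refine (isBigO_refl _ _).sub ?_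
      have := (isBigO_pow_of_le (show 1 ≤ 3 by norm_num)).const_mul_left (1 / 3)
      simpa [div_eq_inv_mul] using this
    have h := (tanh_sub_isBigO_five.mul (tanh_isBigO.add h1)).neg_left
    refine IsBigO.sub (h.congr_right fun x => by ring) ?_
    have := (isBigO_refl (fun x : ℝ => x ^ 6) (𝓝 0)).const_mul_left (1 / 9)
    simpa [div_eq_inv_mul] using this

theorem tendsto_const_mul_zero (K : ℝ) : Tendsto (fun x : ℝ => K * x) (𝓝 0) (𝓝 0) :=
  Continuous.tendsto' (by fun_prop) 0 0 (by simp)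

theorem isBigO_const_mul_pow (K : ℝ) (n : ℕ) :
    (fun x : ℝ => (K * x) ^ n) =O[𝓝 0] (fun x : ℝ => x ^ n) := by
  simp_rw [mul_pow]
  exact (isBigO_refl _ _).const_mul_left _

/-! ### The drift coefficients as rational functions of `tanh (K x)` -/

/-- The value of `tanh (2 J)` on the line `K = exp (-2 J)`. -/
noncomputable def tau (K : ℝ) : ℝ := (1 - K ^ 2) / (1 + K ^ 2)

theorem tanh_two_mul_eq_tau {J K : ℝ} (hK : K = Real.exp (-2 * J)) :
    Real.tanh (2 * J) = tau K := by
  have hp : 0 < K := hK ▸ Real.exp_pos _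
  have h1 : Real.exp (2 * J) = K⁻¹ := by rw [hK, ← Real.exp_neg]; ring_nf
  have h2 : Real.exp (-(2 * J)) = K := by rw [hK]; ring_nf
  rw [Real.tanh_eq, h1, h2, tau]
  field_simp

theorem tanh_add_eq (x y : ℝ) : Real.tanh (x + y)
    = (Real.tanh x + Real.tanh y) / (1 + Real.tanh x * Real.tanh y) := by
  have hx := (Real.cosh_pos x).ne'
  have hy := (Real.cosh_pos y).ne'
  simp only [Real.tanh_eq_sinh_div_cosh, Real.sinh_add, Real.cosh_add]
  field_simp

theorem abs_tau_lt_one {K : ℝ} (hK : 0 < K) : |tau K| < 1 := by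
  rw [tau, abs_div, abs_of_pos (by positivity : (0 : ℝ) < 1 + K ^ 2), div_lt_one (by positivity),
    abs_lt]
  constructor <;> nlinarith

theorem one_sub_tanh_mul_tau_pos {K : ℝ} (hK : 0 < K) (z : ℝ) :
    0 < 1 - Real.tanh z * tau K ∧ 0 < 1 + Real.tanh z * tau K := by
  have h : |Real.tanh z * tau K| < 1 := by
    rw [abs_mul]
    exact mul_lt_one_of_nonneg_of_lt_one_left (abs_nonneg _)
      (Real.abs_tanh_lt_one z) (abs_tau_lt_one hK).le
  obtain ⟨h1, h2⟩ := abs_lt.1 h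
  constructor <;> linarith

/-- The common denominator of the drift coefficients. -/
noncomputable def driftDenom (K x : ℝ) : ℝ :=
  (1 - Real.tanh (K * x) ^ 2 * tau K ^ 2) * (1 - x ^ 2)

/-- The addition formula turns tanh(Kx ± 2J) into fractions with denominators 1 ± tτ, where t =
tanh(Kx) and τ = tanh(2J); these and 1 - x² are exactly the factors of `driftDenom`. -/
theorem D₂_mul_driftDenom {J K x s : ℝ} (hK : K = Real.exp (-2 * J)) (hx : |x| < 1) :
    D₂ 0 0 J K x s * driftDenom K x
      = (1 - Real.tanh (K * x) ^ 2 * tau K ^ 2) * (2 * s - 1) * (1 - x ^ 2)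
        - 2 * tau K * ((s - 1 / 2) * (1 - x ^ 2) - s ^ 2) * (1 - Real.tanh (K * x) ^ 2)
        + x * (1 - x ^ 2) * Real.tanh (K * x) * (1 - tau K ^ 2) := by
  have hp : 0 < K := hK ▸ Real.exp_pos _
  obtain ⟨h1, h2⟩ := one_sub_tanh_mul_tau_pos hp (K * x)
  have h3 : x ^ 2 - 1 ≠ 0 := by
    have : x ^ 2 < 1 := (sq_lt_one_iff_abs_lt_one x).2 hx
    linarith
  have e1 := tanh_add_eq (K * x) (2 * J)
  have e2 := tanh_add_eq (K * x) (-(2 * J))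
  rw [Real.tanh_neg, ← sub_eq_add_neg] at e2
  rw [tanh_two_mul_eq_tau hK] at e1 e2
  rw [mul_neg, ← sub_eq_add_neg, ← sub_eq_add_neg] at e2
  simp only [D₂, zero_add, mul_zero, zero_mul, add_zero, driftDenom, c₂, c₃, e1, e2]
  set t := Real.tanh (K * x)
  set τ := tau K
  have h1' := h1.ne'
  have h2' := h2.ne'
  field_simp
  ring

theorem D₁_mul_driftDenom {J K x s : ℝ} (hK : K = Real.exp (-2 * J)) (hx : |x| < 1) :
    D₁ 0 0 J K x s * driftDenom K x
      = (1 - Real.tanh (K * x) ^ 2 * tau K ^ 2) * (1 - x ^ 2) * (x - Real.tanh (K * x))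
        + ((s - 1 / 2) * (1 - x ^ 2) - s ^ 2) *
          (2 * Real.tanh (K * x) * tau K ^ 2 * (Real.tanh (K * x) ^ 2 - 1))
        - x * (1 - x ^ 2) * tau K * (1 - Real.tanh (K * x) ^ 2) := by
  have hp : 0 < K := hK ▸ Real.exp_pos _
  obtain ⟨h1, h2⟩ := one_sub_tanh_mul_tau_pos hp (K * x)
  have h3 : x ^ 2 - 1 ≠ 0 := by
    have : x ^ 2 < 1 := (sq_lt_one_iff_abs_lt_one x).2 hx
    linarith
  have e1 := tanh_add_eq (K * x) (2 * J)
  have e2 := tanh_add_eq (K * x) (-(2 * J))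
  rw [Real.tanh_neg, ← sub_eq_add_neg] at e2
  rw [tanh_two_mul_eq_tau hK] at e1 e2
  rw [mul_neg, ← sub_eq_add_neg, ← sub_eq_add_neg] at e2
  simp only [D₁, zero_add, mul_zero, zero_mul, add_zero, driftDenom, c₁, c₂, c₃, e1, e2]
  set t := Real.tanh (K * x)
  set τ := tau K
  have h1' := h1.ne'
  have h2' := h2.ne'
  field_simp
  ring

/-! ### Blow-up of the drift at the fixed point -/

/-- `D₂` times its denominator, divided by `q = x ^ 2`, in the variables `q`, `y = (s - s*) / q`
and `t = tanh (K x) / x`. -/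
noncomputable def fastPoly (K : ℝ) (v : ℝ × ℝ × ℝ) : ℝ :=
  2 * v.2.1 * (1 - v.1 * v.2.2 ^ 2 * tau K ^ 2) * (1 - v.1)
    - (2 * sStar K - 1) * (v.2.2 ^ 2 * tau K ^ 2 + 1 - v.1 * v.2.2 ^ 2 * tau K ^ 2)
    + (2 * sStar K - 1) * v.2.2 ^ 2
    - 2 * tau K * (v.2.1 - (sStar K + v.1 * v.2.1 - 1 / 2) - 2 * sStar K * v.2.1
      - v.1 * v.2.1 ^ 2) * (1 - v.1 * v.2.2 ^ 2)
    + (1 - v.1) * v.2.2 * (1 - tau K ^ 2)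

/-- `D₁` times its denominator, divided by `x ^ 3`, in the variables `q = x ^ 2`,
`y = (s - s*) / q` and `t = (tanh (K x) / x - K) / q`. -/
noncomputable def slowPoly (K : ℝ) (v : ℝ × ℝ × ℝ) : ℝ :=
  -(1 - (K + v.1 * v.2.2)) * ((K + v.1 * v.2.2) ^ 2 * tau K ^ 2 + 1
      - v.1 * (K + v.1 * v.2.2) ^ 2 * tau K ^ 2)
    + 2 * (K + v.1 * v.2.2) * tau K ^ 2 * ((sStar K - 1 / 2 - sStar K ^ 2) * (K + v.1 * v.2.2) ^ 2
      + (v.2.1 - (sStar K + v.1 * v.2.1 - 1 / 2) - 2 * sStar K * v.2.1 - v.1 * v.2.1 ^ 2)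
        * (v.1 * (K + v.1 * v.2.2) ^ 2 - 1))
    + tau K * (1 + (K + v.1 * v.2.2) ^ 2 - v.1 * (K + v.1 * v.2.2) ^ 2)
    - v.2.2 * (1 + (2 * sStar K - 1) * tau K)

theorem contDiff_fastPoly (K : ℝ) : ContDiff ℝ 1 (fastPoly K) := by
  unfold fastPoly; fun_prop

theorem contDiff_slowPoly (K : ℝ) : ContDiff ℝ 1 (slowPoly K) := by
  unfold slowPoly; fun_prop

/-- This is the equation D₂(0, s*) = 0 that determines s*; it removes the terms of order zero in the
blow-up. -/
theorem two_mul_tau_mul {K : ℝ} (hK : 0 < K) :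
    2 * tau K * (sStar K - 1 / 2 - sStar K ^ 2) = 2 * sStar K - 1 := by
  unfold tau sStar
  field_simp
  ring

theorem D₂_blowup {J K x y t : ℝ} (hK : K = Real.exp (-2 * J)) (hx : |x| < 1)
    (ht : Real.tanh (K * x) = x * t) :
    D₂ 0 0 J K x (sStar K + x ^ 2 * y) * driftDenom K x = x ^ 2 * fastPoly K (x ^ 2, y, t) := by
  have hp : 0 < K := hK ▸ Real.exp_pos _
  rw [D₂_mul_driftDenom hK hx, ht]
  simp only [fastPoly]
  linear_combination (-1 + x ^ 2 * t ^ 2) * two_mul_tau_mul hp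

theorem D₁_blowup {J K x y t : ℝ} (hK : K = Real.exp (-2 * J)) (hx : |x| < 1)
    (ht : Real.tanh (K * x) = x * (K + x ^ 2 * t)) :
    D₁ 0 0 J K x (sStar K + x ^ 2 * y) * driftDenom K x = x ^ 3 * slowPoly K (x ^ 2, y, t) := by
  have hp : 0 < K := hK ▸ Real.exp_pos _
  -- The coefficient of x in D₁ at s = s*; its vanishing expresses that K is critical for J.
  have h2 : 1 - K - (2 * sStar K - 1) * K * tau K - tau K = 0 := by
    unfold tau sStar
    field_simp
    ring
  rw [D₁_mul_driftDenom hK hx, ht]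
  simp only [slowPoly]
  linear_combination x * h2 - x * tau K * (K + x ^ 2 * t) * two_mul_tau_mul hp

/-- The slope in y is the contraction rate of the fast direction, and the root -K/2 is the
coefficient of x² forced on any invariant graph. -/
theorem fastPoly_zero {K : ℝ} (hK : 0 < K) (y : ℝ) :
    fastPoly K (0, y, K) = 4 * K / (1 + K ^ 2) * (y + K / 2) := by
  simp only [fastPoly, tau, sStar]
  field_simp
  ring

/-- The arguments are the x² coefficient of the graph and the cubic Taylor coefficient of tanh(Kx).
-/
theorem slowPoly_zero {K : ℝ} (hK : 0 < K) :
    slowPoly K (0, -(K / 2), -(K ^ 3 / 3)) = K ^ 2 * (3 - K ^ 2) / (3 * (1 + K ^ 2)) := by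
  simp only [slowPoly, tau, sStar]
  field_simp
  ring

theorem tau_of_sq_eq_three {K : ℝ} (h : K ^ 2 = 3) : tau K = -(1 / 2) := by
  rw [tau, h]; norm_num

theorem sStar_of_sq_eq_three {K : ℝ} (hK : 0 < K) (h : K ^ 2 = 3) : sStar K = (3 - K) / 2 := by
  rw [sStar, div_eq_div_iff (by positivity) (by norm_num)]
  linear_combination h

/-- The next order of `fastPoly` at the tricritical point, where `s = s* - K x ^ 2 / 2 + y x ^ 4`
and `tanh (K x) = K x - K x ^ 3 + t x ^ 5`. -/
noncomputable def tricriticalFastPoly (K q y t : ℝ) : ℝ :=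
  -(3/4) + K * y + q * (-(45/4) - (15/4) * t + (3/2) * y + (21/4) * K + 3 * K * t - 2 * K * y) +
    q ^ 2 * ((9/2) - (21/4) * t - (9/2) * y - y ^ 2 + 3 * K * t + 3 * K * y) + q ^ 3 * ((9/4) +
    (9/2) * t + (3/2) * t ^ 2 - (9/2) * y - 6 * y * t + 3 * y ^ 2 - (9/4) * K - (9/2) * K * t -
    (3/4) * K * t ^ 2 + 3 * K * y + 3 * K * y * t) + q ^ 4 * ((9/2) * t + 3 * t ^ 2 + (9/2) * y
    - 6 * y ^ 2 - (3/2) * K * t - (3/2) * K * t ^ 2 - 3 * K * y) + q ^ 5 * ((3/4) * t ^ 2 + 6 *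
    y * t + (3/2) * y * t ^ 2 + 3 * y ^ 2 - (3/4) * K * t ^ 2 - 3 * K * y * t - K * y * t ^ 2 +
    2 * K * y ^ 2 * t) + q ^ 6 * ((3/2) * y * t ^ 2 - K * y * t ^ 2 - 2 * K * y ^ 2 * t) + q ^ 7
    * (y ^ 2 * t ^ 2)

/-- The next order of `slowPoly` at the tricritical point. -/
noncomputable def tricriticalSlowPoly (K q y t : ℝ) : ℝ :=
  (3/2) - (3/2) * y + (3/8) * K - (1/2) * K * t + K * y + q * (-(21/2) - (9/2) * t + (9/2) * y +
    (21/4) * K + (9/4) * K * t - (7/2) * K * y) + q ^ 2 * ((45/4) + (3/8) * t - (15/2) * y + y *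
    t - (63/8) * K + (1/2) * K * t + 7 * K * y - (1/2) * K * y * t + (1/2) * K * y ^ 2) + q ^ 3
    * ((135/8) * t + (15/4) * t ^ 2 - (17/2) * y * t + (9/8) * K - (33/4) * K * t - (9/4) * K *
    t ^ 2 - (9/2) * K * y + 4 * K * y * t - 2 * K * y ^ 2) + q ^ 4 * (-(9/4) - (27/4) * t + 3 *
    t ^ 2 + 9 * y + (27/2) * y * t + (1/2) * y ^ 2 * t + (9/8) * K + (9/4) * K * t - (9/4) * K *
    t ^ 2 - (3/2) * K * y - (9/2) * K * y * t + (9/2) * K * y ^ 2) + q ^ 5 * (-(27/8) * t -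
    (9/2) * t ^ 2 - (3/4) * t ^ 3 - (9/2) * y + (9/2) * y * t ^ 2 - (9/2) * y ^ 2 * t + (9/4) *
    K * t + (27/8) * K * t ^ 2 + (1/2) * K * t ^ 3 + (3/2) * K * y - (9/2) * K * y * t - 3 * K *
    y * t ^ 2 - (9/2) * K * y ^ 2) + q ^ 6 * (-(9/4) * t ^ 2 - (3/2) * t ^ 3 - (9/2) * y * t + 9
    * y ^ 2 * t + (9/8) * K * t ^ 2 + (3/4) * K * t ^ 3 + (9/2) * K * y * t + (3/2) * K * y * t
    ^ 2 + (3/2) * K * y ^ 2) + q ^ 7 * (-(3/8) * t ^ 3 - (9/2) * y * t ^ 2 - y * t ^ 3 - (9/2) *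
    y ^ 2 * t + (1/4) * K * t ^ 3 + (3/2) * K * y * t ^ 2 + (1/2) * K * y * t ^ 3 - (3/2) * K *
    y ^ 2 * t ^ 2) + q ^ 8 * (-(1/2) * y * t ^ 3 + (1/2) * K * y * t ^ 3 + (3/2) * K * y ^ 2 * t
    ^ 2) + q ^ 9 * (-(1/2) * y ^ 2 * t ^ 3)

theorem fastPoly_tricritical {K : ℝ} (hK : 0 < K) (h : K ^ 2 = 3) (q y t : ℝ) :
    fastPoly K (q, -(K / 2) + q * y, K + q * (-(K ^ 3 / 3) + q * t))
      = q * tricriticalFastPoly K q y t := by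
  have h3 : K ^ 3 = 3 * K := by linear_combination K * h
  simp only [fastPoly, tau_of_sq_eq_three h, sStar_of_sq_eq_three hK h, h3, tricriticalFastPoly]
  -- The two sides differ by a multiple of K² - 3; the polynomial is the explicit cofactor.
  linear_combination (1 - (3/4) * K + q * (-(1/4) + (1/2) * K ^ 2) + q ^ 2 * (-(15/4) - (3/2) * t + (3/2) * y +
      (3/2) * K - K * y - (3/4) * K ^ 2) + q ^ 3 * ((3/2) - (3/2) * t - (3/2) * y + K * t + K * y)
      + q ^ 4 * ((3/4) + (3/2) * t - (3/2) * y - 2 * y * t + y ^ 2 - (3/4) * K - (1/2) * K * t + K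
      * y + (1/4) * K ^ 2) + q ^ 5 * ((3/2) * t + (1/2) * t ^ 2 + (3/2) * y - 2 * y ^ 2 - (1/2) *
      K * t - K * y) + q ^ 6 * ((1/4) * t ^ 2 + 2 * y * t + y ^ 2)) * h

theorem slowPoly_tricritical {K : ℝ} (hK : 0 < K) (h : K ^ 2 = 3) (q y t : ℝ) :
    slowPoly K (q, -(K / 2) + q * y, -(K ^ 3 / 3) + q * t) = q * tricriticalSlowPoly K q y t := by
  have h3 : K ^ 3 = 3 * K := by linear_combination K * h
  have hP : (3 - K) / 2 - 1 / 2 - ((3 - K) / 2) ^ 2 = K - 2 := by linear_combination -h / 4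
  simp only [slowPoly, tau_of_sq_eq_three h, sStar_of_sq_eq_three hK h, h3, hP,
    tricriticalSlowPoly]
  linear_combination ((1/2) - (1/2) * K + (1/2) * K ^ 2 + q * ((1/2) - (1/2) * y + (5/8) * K - (3/4) * K ^ 2 - (1/4)
      * K ^ 3) + q ^ 2 * (-(7/2) - 2 * t + (3/2) * y + (7/4) * K + (3/2) * K * t - K * y - (1/2) *
      K ^ 2 + (1/2) * K ^ 2 * y + (5/8) * K ^ 3) + q ^ 3 * ((15/4) + (1/8) * t - (5/2) * y -
      (21/8) * K - (3/4) * K * t + (5/2) * K * y + K ^ 2 - (3/4) * K ^ 2 * t - K ^ 2 * y - (3/8) *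
      K ^ 3) + q ^ 4 * ((45/8) * t + (3/2) * t ^ 2 - 3 * y * t + (3/8) * K - (9/4) * K * t - (3/2)
      * K * y + (3/2) * K * y * t - (1/2) * K * y ^ 2 + (9/8) * K ^ 2 * t - (1/8) * K ^ 3) + q ^ 5
      * (-(3/4) - (9/4) * t + (3/4) * t ^ 2 + 3 * y + (9/2) * y * t + (3/8) * K + (3/4) * K * t -
      (3/4) * K * t ^ 2 - (1/2) * K * y - (3/2) * K * y * t + (3/2) * K * y ^ 2 - (1/4) * K ^ 2 +
      K ^ 2 * y + (1/8) * K ^ 3) + q ^ 6 * (-(9/8) * t - (3/2) * t ^ 2 - (3/2) * y + (3/2) * y * t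
      ^ 2 - (3/2) * y ^ 2 * t + (3/4) * K * t + (3/8) * K * t ^ 2 + (1/2) * K * y - (3/2) * K * y
      * t - (3/2) * K * y ^ 2 - (3/8) * K ^ 2 * t - (1/2) * K ^ 2 * y) + q ^ 7 * (-(3/4) * t ^ 2 -
      (1/4) * t ^ 3 - (3/2) * y * t + 3 * y ^ 2 * t + (3/8) * K * t ^ 2 + (3/2) * K * y * t +
      (1/2) * K * y ^ 2) + q ^ 8 * (-(1/8) * t ^ 3 - (3/2) * y * t ^ 2 - (3/2) * y ^ 2 * t)) * h

/-- The root K/4 is the x⁴ coefficient of invariant graphs at the tricritical point. -/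
theorem tricriticalFastPoly_zero {K : ℝ} (h : K ^ 2 = 3) (y t : ℝ) :
    tricriticalFastPoly K 0 y t = K * (y - K / 4) := by
  simp only [tricriticalFastPoly]
  linear_combination (1 / 4) * h

/-- Here 2K⁵/15 is the quintic Taylor coefficient of tanh(Kx). -/
theorem tricriticalSlowPoly_zero {K : ℝ} (h : K ^ 2 = 3) :
    tricriticalSlowPoly K 0 (K / 4) (2 * K ^ 5 / 15) = 9 / 20 := by
  have h5 : K ^ 5 = 9 * K := by linear_combination (K ^ 3 + 3 * K) * h
  simp only [tricriticalSlowPoly, h5]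
  linear_combination (1 / 4 - 3 / 5) * h

section

/-! ### Expansion of the drift along approximate center manifolds -/

/-- The expansions divide by powers of x and are therefore proved on punctured neighbourhoods; this
restores the origin. -/
theorem isBigO_nhds_zero_of_punctured {f g : ℝ → ℝ} (h0 : f 0 = 0) (h : f =O[𝓝[≠] 0] g) :
    f =O[𝓝 0] g := by
  obtain ⟨C, hC⟩ := h.bound
  refine IsBigO.of_bound (max C 0) ?_
  rw [eventually_nhdsWithin_iff] at hC
  filter_upwards [hC] with x hx
  rcases eq_or_ne x 0 with rfl | hne
  · rw [h0, norm_zero]; positivity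
  · exact (hx hne).trans (mul_le_mul_of_nonneg_right (le_max_left _ _) (norm_nonneg _))

theorem isBigO_of_pow_mul {f : ℝ → ℝ} {n m k : ℕ} (hk : n + m = k)
    (h : (fun x => x ^ n * f x) =O[𝓝[≠] 0] (fun x : ℝ => x ^ k)) :
    f =O[𝓝[≠] 0] (fun x : ℝ => x ^ m) := by
  subst hk
  obtain ⟨C, hC⟩ := h.bound
  refine IsBigO.of_bound C ?_
  filter_upwards [hC, self_mem_nhdsWithin] with x hx hne
  have hpos : 0 < ‖x ^ n‖ := norm_pos_iff.2 (pow_ne_zero n hne)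
  rw [norm_mul, pow_add, norm_mul] at hx
  refine le_of_mul_le_mul_left ?_ hpos
  linarith

theorem isBigO_pow_mul_one {φ : ℝ → ℝ} {l : Filter ℝ} (h : φ =O[l] (fun _ => (1 : ℝ))) (n : ℕ) :
    (fun x => x ^ n * φ x) =O[l] (fun x : ℝ => x ^ n) := by
  simpa using (isBigO_refl (fun x : ℝ => x ^ n) l).mul h

theorem isBigO_pow_of_le_punctured {m n : ℕ} (h : m ≤ n) :
    (fun x : ℝ => x ^ n) =O[𝓝[≠] 0] (fun x : ℝ => x ^ m) :=
  (isBigO_pow_of_le h).mono nhdsWithin_le_nhds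

theorem isBigO_pow_one_punctured (n : ℕ) :
    (fun x : ℝ => x ^ n) =O[𝓝[≠] 0] (fun _ => (1 : ℝ)) := by
  simpa using isBigO_pow_of_le_punctured n.zero_le

theorem eventually_abs_lt_one : ∀ᶠ x : ℝ in 𝓝 0, |x| < 1 := by
  filter_upwards [Metric.ball_mem_nhds (0 : ℝ) one_pos] with x hx
  simpa using hx

theorem driftDenom_zero (K : ℝ) : driftDenom K 0 = 1 := by simp [driftDenom]

theorem continuous_driftDenom (K : ℝ) : Continuous (driftDenom K) := by
  have := (contDiff_tanh (n := 0)).continuous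
  unfold driftDenom
  fun_prop

theorem driftDenom_sub_one_isBigO (K : ℝ) :
    (fun x => driftDenom K x - 1) =O[𝓝 0] (fun x : ℝ => x ^ 2) := by
  have h1 : (fun x => Real.tanh (K * x) ^ 2) =O[𝓝 0] (fun x : ℝ => x ^ 2) := by
    have := (tanh_isBigO.comp_tendsto (tendsto_const_mul_zero K)).pow 2
    exact this.trans (isBigO_const_mul_pow K 2)
  have h2 : (fun x : ℝ => -(tau K ^ 2 * (1 - x ^ 2))) =O[𝓝 0] (fun _ => (1 : ℝ)) :=
    (by fun_prop : ContinuousAt (fun x : ℝ => -(tau K ^ 2 * (1 - x ^ 2))) 0).isBigO_one ℝ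
  have h3 := (h1.mul h2).sub (by simpa using isBigO_refl (fun x : ℝ => x ^ 2) (𝓝 0))
  refine (h3.congr_left fun x => ?_).congr_right fun x => mul_one _
  simp only [driftDenom]
  ring

theorem isBigO_of_mul_driftDenom {K : ℝ} {f g : ℝ → ℝ}
    (h : (fun x => f x * driftDenom K x) =O[𝓝[≠] 0] g) : f =O[𝓝[≠] 0] g := by
  have hc : ContinuousAt (fun x => (driftDenom K x)⁻¹) 0 :=
    (continuous_driftDenom K).continuousAt.inv₀ (by simp [driftDenom_zero])
  have h1 := h.mul ((hc.isBigO_one ℝ).mono nhdsWithin_le_nhds)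
  have hne : ∀ᶠ x in 𝓝[≠] (0 : ℝ), driftDenom K x ≠ 0 :=
    nhdsWithin_le_nhds ((continuous_driftDenom K).continuousAt.eventually_ne
      (by simp [driftDenom_zero]))
  refine (h1.congr' ?_ (Eventually.of_forall fun x => mul_one _))
  filter_upwards [hne] with x hx
  rw [mul_assoc, mul_inv_cancel₀ hx, mul_one]

theorem exists_tanh_eq_order_two (K : ℝ) : ∃ t : ℝ → ℝ, t =O[𝓝[≠] 0] (fun _ => (1 : ℝ)) ∧
    ∀ᶠ x in 𝓝[≠] 0, Real.tanh (K * x) = x * (K + x ^ 2 * t x) := by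
  have h := (tanh_sub_isBigO_three.comp_tendsto (tendsto_const_mul_zero K)).trans
    (isBigO_const_mul_pow K 3)
  obtain ⟨t, ht, he⟩ := IsBigO.exists_eq_mul_bounded (h.mono nhdsWithin_le_nhds)
  refine ⟨t, ht, he.mono fun x hx => ?_⟩
  simp only [Function.comp_apply] at hx
  linear_combination hx

theorem exists_tanh_eq_order_four (K : ℝ) : ∃ t : ℝ → ℝ, t =O[𝓝[≠] 0] (fun _ => (1 : ℝ)) ∧
    ∀ᶠ x in 𝓝[≠] 0, Real.tanh (K * x) = x * (K + x ^ 2 * (-(K ^ 3 / 3) + x ^ 2 * t x)) := by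
  have h := (tanh_sub_isBigO_five.comp_tendsto (tendsto_const_mul_zero K)).trans
    (isBigO_const_mul_pow K 5)
  obtain ⟨t, ht, he⟩ := IsBigO.exists_eq_mul_bounded (h.mono nhdsWithin_le_nhds)
  refine ⟨t, ht, he.mono fun x hx => ?_⟩
  simp only [Function.comp_apply] at hx
  linear_combination hx

theorem exists_tanh_eq_order_six (K : ℝ) : ∃ t : ℝ → ℝ, t =O[𝓝[≠] 0] (fun _ => (1 : ℝ)) ∧
    ∀ᶠ x in 𝓝[≠] 0, Real.tanh (K * x)
      = x * (K + x ^ 2 * (-(K ^ 3 / 3) + x ^ 2 * (2 * K ^ 5 / 15 + x ^ 2 * t x))) := by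
  have h := (tanh_sub_isBigO_seven.comp_tendsto (tendsto_const_mul_zero K)).trans
    (isBigO_const_mul_pow K 7)
  obtain ⟨t, ht, he⟩ := IsBigO.exists_eq_mul_bounded (h.mono nhdsWithin_le_nhds)
  refine ⟨t, ht, he.mono fun x hx => ?_⟩
  simp only [Function.comp_apply] at hx
  linear_combination hx

variable {J K : ℝ} {η p : ℝ → ℝ}

theorem D₁_isBigO_three (hK : K = Real.exp (-2 * J))
    (hη : η =O[𝓝[≠] 0] (fun x : ℝ => x ^ 2)) :
    (fun x => D₁ 0 0 J K x (sStar K + η x)) =O[𝓝[≠] 0] (fun x : ℝ => x ^ 3) := by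
  obtain ⟨y, hy, hyη⟩ := IsBigO.exists_eq_mul_bounded hη
  obtain ⟨t, ht, hte⟩ := exists_tanh_eq_order_two K
  refine isBigO_of_mul_driftDenom (K := K) ?_
  have hb := isBigO_one_of_continuous (contDiff_slowPoly K).continuous
    ((isBigO_pow_one_punctured 2).prod_left (hy.prod_left ht))
  refine (isBigO_pow_mul_one hb 3).congr' ?_ EventuallyEq.rfl
  filter_upwards [hyη, hte, nhdsWithin_le_nhds eventually_abs_lt_one] with x h1 h2 h3
  rw [h1, mul_comm (y x), D₁_blowup hK h3 h2]

/-- Leading order of a function whose graph is invariant up to order four. -/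
theorem approxManifold_expansion (hK : K = Real.exp (-2 * J))
    (hη : η =O[𝓝[≠] 0] (fun x : ℝ => x ^ 2)) (hp : p =O[𝓝[≠] 0] (fun x : ℝ => x))
    (hres : (fun x => D₂ 0 0 J K x (sStar K + η x) - p x * D₁ 0 0 J K x (sStar K + η x))
      =O[𝓝[≠] 0] (fun x : ℝ => x ^ 4)) :
    (fun x => η x - -(K / 2) * x ^ 2) =O[𝓝[≠] 0] (fun x : ℝ => x ^ 4) ∧
    (fun x => D₁ 0 0 J K x (sStar K + η x)
      - K ^ 2 * (3 - K ^ 2) / (3 * (1 + K ^ 2)) * x ^ 3) =O[𝓝[≠] 0] (fun x : ℝ => x ^ 5) := by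
  have hpos : 0 < K := hK ▸ Real.exp_pos _
  have hx1 := nhdsWithin_le_nhds (s := {(0 : ℝ)}ᶜ) eventually_abs_lt_one
  -- Since p is O(x) and D₁ is O(x³), the transport term pD₁ is itself O(x⁴): no finer knowledge of
  -- the slope p is needed.
  have hD₂ : (fun x => D₂ 0 0 J K x (sStar K + η x)) =O[𝓝[≠] 0] (fun x : ℝ => x ^ 4) := by
    have h1 := (hp.mul (D₁_isBigO_three hK hη)).congr_right (fun x => by ring :
      ∀ x : ℝ, x * x ^ 3 = x ^ 4)
    exact (hres.add h1).congr_left fun x => by ring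
  obtain ⟨y, hy, hyη⟩ := IsBigO.exists_eq_mul_bounded hη
  obtain ⟨t, ht, hte⟩ := exists_tanh_eq_order_two K
  have hq := isBigO_pow_one_punctured 2
  have htan : (fun x => K + x ^ 2 * t x) =O[𝓝[≠] 0] (fun _ => (1 : ℝ)) := by
    refine (isBigO_const_const _ one_ne_zero _).add ?_
    simpa using hq.mul ht
  have hfast : (fun x => fastPoly K (x ^ 2, y x, K + x ^ 2 * t x))
      =O[𝓝[≠] 0] (fun x : ℝ => x ^ 2) := by
    refine isBigO_of_pow_mul (n := 2) (k := 4) rfl ?_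
    have hΔ := ((continuous_driftDenom K).continuousAt.isBigO_one ℝ).mono
      (nhdsWithin_le_nhds (a := (0 : ℝ)) (s := {0}ᶜ))
    refine (hD₂.mul hΔ).congr' ?_ (Eventually.of_forall fun x => mul_one _)
    filter_upwards [hyη, hte, hx1] with x h1 h2 h3
    rw [h1, mul_comm (y x), D₂_blowup hK h3 h2]
  -- Replacing the arguments of `fastPoly` by their values at x = 0, with y kept, costs O(x²); the
  -- affine equation left then yields y = -K/2 + O(x²).
  have hlip := isBigO_sub_of_contDiff (contDiff_fastPoly K) (hq.prod_left (hy.prod_left htan))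
    ((isBigO_const_const (0 : ℝ) one_ne_zero _).prod_left
      (hy.prod_left (isBigO_const_const K one_ne_zero _)))
  have hlip2 : (fun x => ((x ^ 2, y x, K + x ^ 2 * t x) : ℝ × ℝ × ℝ) - (0, y x, K))
      =O[𝓝[≠] 0] (fun x : ℝ => x ^ 2) := by
    simp only [Prod.mk_sub_mk, sub_zero, sub_self, add_sub_cancel_left]
    exact (isBigO_refl _ _).prod_left ((isBigO_zero _ _).prod_left (isBigO_pow_mul_one ht 2))
  have hy1 : (fun x => y x + K / 2) =O[𝓝[≠] 0] (fun x : ℝ => x ^ 2) := by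
    have h1 := hfast.sub (hlip.trans hlip2)
    have h2 : (fun x => (4 * K / (1 + K ^ 2))⁻¹ * (4 * K / (1 + K ^ 2) * (y x + K / 2)))
        =O[𝓝[≠] 0] (fun x : ℝ => x ^ 2) := by
      refine IsBigO.const_mul_left (h1.congr_left fun x => ?_) _
      rw [← fastPoly_zero hpos]; ring
    have hc : 4 * K / (1 + K ^ 2) ≠ 0 := by positivity
    exact h2.congr_left fun x => inv_mul_cancel_left₀ hc _
  have hη4 : (fun x => η x - -(K / 2) * x ^ 2) =O[𝓝[≠] 0] (fun x : ℝ => x ^ 4) := by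
    refine (hy1.mul (isBigO_refl (fun x : ℝ => x ^ 2) _)).congr' ?_
      (Eventually.of_forall fun x => by ring)
    filter_upwards [hyη] with x hx
    rw [hx]; ring
  refine ⟨hη4, ?_⟩
  obtain ⟨t', ht', hte'⟩ := exists_tanh_eq_order_four K
  have hq' : (fun x => x ^ 2 * t' x) =O[𝓝[≠] 0] (fun x : ℝ => x ^ 2) := isBigO_pow_mul_one ht' 2
  have htb : (fun x => -(K ^ 3 / 3) + x ^ 2 * t' x) =O[𝓝[≠] 0] (fun _ => (1 : ℝ)) :=
    (isBigO_const_const _ one_ne_zero _).add (hq'.trans hq)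
  have hlip' := isBigO_sub_of_contDiff (contDiff_slowPoly K) (hq.prod_left (hy.prod_left htb))
    ((isBigO_const_const (0 : ℝ) one_ne_zero _).prod_left
      ((isBigO_const_const (-(K / 2)) one_ne_zero _).prod_left
        (isBigO_const_const (-(K ^ 3 / 3)) one_ne_zero _)))
  have hlip2' : (fun x => ((x ^ 2, y x, -(K ^ 3 / 3) + x ^ 2 * t' x) : ℝ × ℝ × ℝ)
      - (0, -(K / 2), -(K ^ 3 / 3))) =O[𝓝[≠] 0] (fun x : ℝ => x ^ 2) := by
    simp only [Prod.mk_sub_mk, sub_zero, sub_neg_eq_add]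
    exact (isBigO_refl _ _).prod_left (hy1.prod_left (hq'.congr_left fun x => by ring))
  have h5 := (isBigO_refl (fun x : ℝ => x ^ 3) (𝓝[≠] 0)).mul (hlip'.trans hlip2')
  -- Correction for the factor `driftDenom`, which is 1 only up to O(x²).
  have h6 := ((isBigO_refl (fun x : ℝ => x ^ 3) (𝓝[≠] 0)).mul
    ((driftDenom_sub_one_isBigO K).mono nhdsWithin_le_nhds)).const_mul_left
      (K ^ 2 * (3 - K ^ 2) / (3 * (1 + K ^ 2)))
  refine isBigO_of_mul_driftDenom (K := K) ((h5.sub h6).congr' ?_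
    (Eventually.of_forall fun x => by ring))
  filter_upwards [hyη, hte', hx1] with x h1 h2 h3
  have h4 : D₁ 0 0 J K x (sStar K + η x) * driftDenom K x
      = x ^ 3 * slowPoly K (x ^ 2, y x, -(K ^ 3 / 3) + x ^ 2 * t' x) := by
    rw [h1, mul_comm (y x), D₁_blowup hK h3 h2]
  rw [sub_mul, h4, slowPoly_zero hpos]
  ring

/-- Leading order, at the tricritical point, of a function whose graph is invariant up to order
six. -/
theorem approxManifold_expansion_tricritical (hK : K = Real.exp (-2 * J)) (h3 : K ^ 2 = 3)
    (hη : η =O[𝓝[≠] 0] (fun x : ℝ => x ^ 2)) (hp : p =O[𝓝[≠] 0] (fun x : ℝ => x))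
    (hres : (fun x => D₂ 0 0 J K x (sStar K + η x) - p x * D₁ 0 0 J K x (sStar K + η x))
      =O[𝓝[≠] 0] (fun x : ℝ => x ^ 6)) :
    (fun x => D₁ 0 0 J K x (sStar K + η x) - 9 / 20 * x ^ 5)
      =O[𝓝[≠] 0] (fun x : ℝ => x ^ 7) := by
  have hpos : 0 < K := hK ▸ Real.exp_pos _
  have hx1 := nhdsWithin_le_nhds (s := {(0 : ℝ)}ᶜ) eventually_abs_lt_one
  obtain ⟨hη4, hD₁⟩ := approxManifold_expansion hK hη hp
    (hres.trans (isBigO_pow_of_le_punctured (by norm_num)))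
  -- With the cubic coefficient gone, the first pass gives D₁ = O(x⁵), which improves pD₁ to O(x⁶)
  -- and allows a second pass.
  simp only [h3, sub_self, mul_zero, zero_div, zero_mul, sub_zero] at hD₁
  have hD₂ : (fun x => D₂ 0 0 J K x (sStar K + η x)) =O[𝓝[≠] 0] (fun x : ℝ => x ^ 6) := by
    have h1 := (hp.mul hD₁).congr_right (fun x => by ring : ∀ x : ℝ, x * x ^ 5 = x ^ 6)
    exact (hres.add h1).congr_left fun x => by ring
  obtain ⟨y, hy, hyη⟩ := IsBigO.exists_eq_mul_bounded hη4
  have hη' : ∀ᶠ x in 𝓝[≠] (0 : ℝ), η x = x ^ 2 * (-(K / 2) + x ^ 2 * y x) :=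
    hyη.mono fun x hx => by linear_combination hx
  obtain ⟨t, ht, hte⟩ := exists_tanh_eq_order_six K
  have hq := isBigO_pow_one_punctured 2
  have hqt : (fun x => x ^ 2 * t x) =O[𝓝[≠] 0] (fun x : ℝ => x ^ 2) := isBigO_pow_mul_one ht 2
  have htb : (fun x => 2 * K ^ 5 / 15 + x ^ 2 * t x) =O[𝓝[≠] 0] (fun _ => (1 : ℝ)) :=
    (isBigO_const_const _ one_ne_zero _).add (hqt.trans hq)
  have hcf : ContDiff ℝ 1 (fun v : ℝ × ℝ × ℝ => tricriticalFastPoly K v.1 v.2.1 v.2.2) := by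
    unfold tricriticalFastPoly; fun_prop
  have hcs : ContDiff ℝ 1 (fun v : ℝ × ℝ × ℝ => tricriticalSlowPoly K v.1 v.2.1 v.2.2) := by
    unfold tricriticalSlowPoly; fun_prop
  have hfast : (fun x => tricriticalFastPoly K (x ^ 2) (y x) (2 * K ^ 5 / 15 + x ^ 2 * t x))
      =O[𝓝[≠] 0] (fun x : ℝ => x ^ 2) := by
    refine isBigO_of_pow_mul (n := 4) (k := 6) rfl ?_
    have hΔ := ((continuous_driftDenom K).continuousAt.isBigO_one ℝ).mono
      (nhdsWithin_le_nhds (a := (0 : ℝ)) (s := {0}ᶜ))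
    refine (hD₂.mul hΔ).congr' ?_ (Eventually.of_forall fun x => mul_one _)
    filter_upwards [hη', hte, hx1] with x h1 h2 h4
    rw [h1, D₂_blowup hK h4 h2, fastPoly_tricritical hpos h3]
    ring
  have hlip := isBigO_sub_of_contDiff hcf (hq.prod_left (hy.prod_left htb))
    ((isBigO_const_const (0 : ℝ) one_ne_zero _).prod_left (hy.prod_left htb))
  have hlip2 : (fun x => ((x ^ 2, y x, 2 * K ^ 5 / 15 + x ^ 2 * t x) : ℝ × ℝ × ℝ)
      - (0, y x, 2 * K ^ 5 / 15 + x ^ 2 * t x)) =O[𝓝[≠] 0] (fun x : ℝ => x ^ 2) := by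
    simp only [Prod.mk_sub_mk, sub_zero, sub_self]
    exact (isBigO_refl _ _).prod_left ((isBigO_zero _ _).prod_left (isBigO_zero _ _))
  have hy1 : (fun x => y x - K / 4) =O[𝓝[≠] 0] (fun x : ℝ => x ^ 2) := by
    have h2 := (hfast.sub (hlip.trans hlip2)).const_mul_left K⁻¹
    refine h2.congr_left fun x => ?_
    simp only [tricriticalFastPoly_zero h3]
    rw [sub_sub_cancel, inv_mul_cancel_left₀ hpos.ne']
  have hlip' := isBigO_sub_of_contDiff hcs (hq.prod_left (hy.prod_left htb))
    ((isBigO_const_const (0 : ℝ) one_ne_zero _).prod_left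
      ((isBigO_const_const (K / 4) one_ne_zero _).prod_left
        (isBigO_const_const (2 * K ^ 5 / 15) one_ne_zero _)))
  have hlip2' : (fun x => ((x ^ 2, y x, 2 * K ^ 5 / 15 + x ^ 2 * t x) : ℝ × ℝ × ℝ)
      - (0, K / 4, 2 * K ^ 5 / 15)) =O[𝓝[≠] 0] (fun x : ℝ => x ^ 2) := by
    simp only [Prod.mk_sub_mk, sub_zero, add_sub_cancel_left]
    exact (isBigO_refl _ _).prod_left (hy1.prod_left hqt)
  have h5 := (isBigO_refl (fun x : ℝ => x ^ 5) (𝓝[≠] 0)).mul (hlip'.trans hlip2')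
  have h6 := ((isBigO_refl (fun x : ℝ => x ^ 5) (𝓝[≠] 0)).mul
    ((driftDenom_sub_one_isBigO K).mono nhdsWithin_le_nhds)).const_mul_left (9 / 20)
  refine isBigO_of_mul_driftDenom (K := K) ((h5.sub h6).congr' ?_
    (Eventually.of_forall fun x => by ring))
  filter_upwards [hη', hte, hx1] with x h1 h2 h4
  have h7 : D₁ 0 0 J K x (sStar K + η x) * driftDenom K x
      = x ^ 5 * tricriticalSlowPoly K (x ^ 2) (y x) (2 * K ^ 5 / 15 + x ^ 2 * t x) := by
    rw [h1, D₁_blowup hK h4 h2, slowPoly_tricritical hpos h3]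
    ring
  rw [sub_mul, h7]
  simp only [tricriticalSlowPoly_zero h3]
  ring

end

section

variable {J K : ℝ} {η : ℝ → ℝ}

theorem drift_apply (J K x s : ℝ) :
    drift J K (x, s) = (-D₁ 0 0 J K x s, -D₂ 0 0 J K x s) := rfl

theorem D₁_zero_left (J K s : ℝ) : D₁ 0 0 J K 0 s = 0 := by
  simp [D₁, c₁, c₂, c₃]
  ring

/-! ### Expansion of center manifolds -/

theorem isBigO_id_of_contDiffAt {p : ℝ → ℝ} (h : DifferentiableAt ℝ p 0) (h0 : p 0 = 0) :
    p =O[𝓝 0] (fun x : ℝ => x) := by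
  simpa [h0] using h.isBigO_sub

theorem IsCenterManifold.deriv_isBigO (h : IsCenterManifold J K η) :
    deriv η =O[𝓝 0] (fun x : ℝ => x) := by
  obtain ⟨h1, -, h3, -⟩ := h
  refine isBigO_id_of_contDiffAt ?_ h3
  have h4 : ContDiffAt ℝ 1 (fderiv ℝ η) 0 := h1.fderiv_right (m := 1) (by norm_num)
  exact (h4.differentiableAt (by norm_num)).clm_apply (differentiableAt_const 1)

theorem IsCenterManifold.isBigO_sq (h : IsCenterManifold J K η) :
    η =O[𝓝 0] (fun x : ℝ => x ^ 2) := by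
  refine isBigO_pow_succ_of_hasDerivAt (f' := deriv η) ?_ h.2.1 (by simpa using h.deriv_isBigO)
  have := (h.1.of_le (by norm_num : (1 : WithTop ℕ∞) ≤ 2)).eventually (by simp)
  exact this.mono fun x hx => (hx.differentiableAt (by norm_num)).hasDerivAt

/-- The residual vanishes identically near 0, hence it is O(xⁿ) for whichever n an expansion
requires. -/
theorem IsCenterManifold.residual (h : IsCenterManifold J K η) (n : ℕ) :
    (fun x => D₂ 0 0 J K x (sStar K + η x) - deriv η x * D₁ 0 0 J K x (sStar K + η x))
      =O[𝓝[≠] 0] (fun x : ℝ => x ^ n) := by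
  refine (isBigO_zero _ _).congr' ?_ EventuallyEq.rfl
  filter_upwards [nhdsWithin_le_nhds h.2.2.2] with x hx
  simp only [drift_apply] at hx
  linarith

theorem IsCenterManifold.expansion (hK : K = Real.exp (-2 * J)) (h : IsCenterManifold J K η) :
    (fun x => η x - -(K / 2) * x ^ 2) =O[𝓝 0] (fun x : ℝ => x ^ 4) ∧
    (fun x => reducedDrift J K η x - K ^ 2 * (K ^ 2 - 3) / (3 * (1 + K ^ 2)) * x ^ 3)
      =O[𝓝 0] (fun x : ℝ => x ^ 5) := by
  obtain ⟨h1, h2⟩ := approxManifold_expansion hK (h.isBigO_sq.mono nhdsWithin_le_nhds)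
    (h.deriv_isBigO.mono nhdsWithin_le_nhds) (h.residual 4)
  refine ⟨isBigO_nhds_zero_of_punctured (by simp [h.2.1]) h1,
    isBigO_nhds_zero_of_punctured (by simp [reducedDrift, drift_apply, D₁_zero_left]) ?_⟩
  refine h2.neg_left.congr_left fun x => ?_
  simp only [reducedDrift, drift_apply]
  ring

theorem IsCenterManifold.expansion_tricritical (hK : K = Real.exp (-2 * J)) (h3 : K ^ 2 = 3)
    (h : IsCenterManifold J K η) :
    (fun x => reducedDrift J K η x - -(9 / 20) * x ^ 5) =O[𝓝 0] (fun x : ℝ => x ^ 7) := by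
  have h2 := approxManifold_expansion_tricritical hK h3 (h.isBigO_sq.mono nhdsWithin_le_nhds)
    (h.deriv_isBigO.mono nhdsWithin_le_nhds) (h.residual 6)
  refine isBigO_nhds_zero_of_punctured (by simp [reducedDrift, drift_apply, D₁_zero_left]) ?_
  refine h2.neg_left.congr_left fun x => ?_
  simp only [reducedDrift, drift_apply]
  ring

/-! ### Smoothness of the drift and its linearisation -/

theorem sq_sub_one_ne_zero {x : ℝ} (hx : |x| < 1) : x ^ 2 - 1 ≠ 0 := by
  have : x ^ 2 < 1 := (sq_lt_one_iff_abs_lt_one x).2 hx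
  linarith

/-- The part of the drift coefficients that is nonlinear in the density of defects. -/
noncomputable def defectTerm (x s : ℝ) : ℝ := s + s ^ 2 / (x ^ 2 - 1) - 1 / 2

/-- The coefficient of `defectTerm` in `D₁`. -/
noncomputable def slowCoeff (J K x : ℝ) : ℝ :=
  Real.tanh (K * x - 2 * J) + Real.tanh (K * x + 2 * J) - 2 * Real.tanh (K * x)

/-- The coefficient of `defectTerm` in `D₂`. -/
noncomputable def fastCoeff (J K x : ℝ) : ℝ :=
  Real.tanh (K * x - 2 * J) - Real.tanh (K * x + 2 * J)

/-- D₁ and D₂ depend on s only through an affine term and the quadratic `defectTerm`, so their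
increments in s are given by exact formulas instead of Taylor estimates. -/
theorem D₁_eq (J K x s : ℝ) : D₁ 0 0 J K x s
    = x - Real.tanh (K * x) + x / 2 * fastCoeff J K x + defectTerm x s * slowCoeff J K x := by
  simp only [D₁, c₁, c₂, c₃, zero_add, mul_zero, zero_mul, add_zero, slowCoeff, fastCoeff,
    defectTerm]
  ring

theorem D₂_eq (J K x s : ℝ) : D₂ 0 0 J K x s
    = 2 * s - 1 + x / 2 * (Real.tanh (K * x - 2 * J) + Real.tanh (K * x + 2 * J))
      + defectTerm x s * fastCoeff J K x := by
  simp only [D₂, c₂, c₃, zero_add, mul_zero, zero_mul, add_zero, fastCoeff, defectTerm]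
  ring

theorem analyticAt_tanh_affine (K c x : ℝ) : AnalyticAt ℝ (fun x => Real.tanh (K * x + c)) x :=
  (analyticAt_tanh _).fun_comp (by fun_prop)

theorem analyticAt_slowCoeff (J K x : ℝ) : AnalyticAt ℝ (slowCoeff J K) x := by
  have h1 := analyticAt_tanh_affine K 0 x
  have h2 := analyticAt_tanh_affine K (-(2 * J)) x
  have h3 := analyticAt_tanh_affine K (2 * J) x
  simp only [add_zero, ← sub_eq_add_neg] at h1 h2 h3
  exact (h2.fun_add h3).fun_sub (analyticAt_const.fun_mul h1)

theorem analyticAt_fastCoeff (J K x : ℝ) : AnalyticAt ℝ (fastCoeff J K) x := by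
  have h2 := analyticAt_tanh_affine K (-(2 * J)) x
  have h3 := analyticAt_tanh_affine K (2 * J) x
  simp only [← sub_eq_add_neg] at h2 h3
  exact h2.fun_sub h3

theorem contDiffAt_defectTerm {n : WithTop ℕ∞} {q : ℝ × ℝ} (hq : |q.1| < 1) :
    ContDiffAt ℝ n (fun q : ℝ × ℝ => defectTerm q.1 q.2) q := by
  have h0 := sq_sub_one_ne_zero hq
  unfold defectTerm
  fun_prop (disch := exact h0)

theorem contDiffAt_D₁ {n : WithTop ℕ∞} (J K : ℝ) {q : ℝ × ℝ} (hq : |q.1| < 1) :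
    ContDiffAt ℝ n (fun q : ℝ × ℝ => D₁ 0 0 J K q.1 q.2) q := by
  have h1 : ContDiffAt ℝ n (fun q : ℝ × ℝ => slowCoeff J K q.1) q :=
    (analyticAt_slowCoeff J K q.1).contDiffAt.comp q contDiffAt_fst
  have h2 : ContDiffAt ℝ n (fun q : ℝ × ℝ => fastCoeff J K q.1) q :=
    (analyticAt_fastCoeff J K q.1).contDiffAt.comp q contDiffAt_fst
  have h3 : ContDiffAt ℝ n (fun q : ℝ × ℝ => Real.tanh (K * q.1)) q :=
    contDiff_tanh.contDiffAt.comp q (by fun_prop)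
  have h4 := contDiffAt_defectTerm (n := n) hq
  simp only [D₁_eq]
  fun_prop

theorem contDiffAt_D₂ {n : WithTop ℕ∞} (J K : ℝ) {q : ℝ × ℝ} (hq : |q.1| < 1) :
    ContDiffAt ℝ n (fun q : ℝ × ℝ => D₂ 0 0 J K q.1 q.2) q := by
  have h2 : ContDiffAt ℝ n (fun q : ℝ × ℝ => fastCoeff J K q.1) q :=
    (analyticAt_fastCoeff J K q.1).contDiffAt.comp q contDiffAt_fst
  have h3 : ContDiffAt ℝ n (fun q : ℝ × ℝ => Real.tanh (K * q.1 - 2 * J)) q :=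
    contDiff_tanh.contDiffAt.comp q (by fun_prop)
  have h5 : ContDiffAt ℝ n (fun q : ℝ × ℝ => Real.tanh (K * q.1 + 2 * J)) q :=
    contDiff_tanh.contDiffAt.comp q (by fun_prop)
  have h4 := contDiffAt_defectTerm (n := n) hq
  simp only [D₂_eq]
  fun_prop

theorem D₂_zero_left (hK : K = Real.exp (-2 * J)) (s : ℝ) :
    D₂ 0 0 J K 0 s = 2 * s - 1 - 2 * tau K * (s - 1 / 2 - s ^ 2) := by
  have h := D₂_mul_driftDenom (x := 0) (s := s) hK (by simp)
  rw [driftDenom_zero] at h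
  simpa using h

theorem D₂_fixedPoint (hK : K = Real.exp (-2 * J)) : D₂ 0 0 J K 0 (sStar K) = 0 := by
  have hpos : 0 < K := hK ▸ Real.exp_pos _
  rw [D₂_zero_left hK]
  linarith [two_mul_tau_mul hpos]

theorem D₂_isBigO_sq (hK : K = Real.exp (-2 * J)) :
    (fun x => D₂ 0 0 J K x (sStar K)) =O[𝓝 0] (fun x : ℝ => x ^ 2) := by
  refine isBigO_nhds_zero_of_punctured (D₂_fixedPoint hK) ?_
  obtain ⟨t, ht, hte⟩ := exists_tanh_eq_order_two K
  have hq := isBigO_pow_one_punctured 2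
  have htan : (fun x => K + x ^ 2 * t x) =O[𝓝[≠] 0] (fun _ => (1 : ℝ)) := by
    refine (isBigO_const_const _ one_ne_zero _).add ?_
    simpa using hq.mul ht
  refine isBigO_of_mul_driftDenom (K := K) ?_
  have hb := isBigO_one_of_continuous (contDiff_fastPoly K).continuous
    (hq.prod_left ((isBigO_const_const (0 : ℝ) one_ne_zero _).prod_left htan))
  refine (isBigO_pow_mul_one hb 2).congr' ?_ EventuallyEq.rfl
  filter_upwards [hte, nhdsWithin_le_nhds eventually_abs_lt_one] with x h2 h3
  rw [← D₂_blowup hK h3 h2]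
  simp

theorem hasDerivAt_zero_of_isBigO {f : ℝ → ℝ} {n : ℕ} (hn : 2 ≤ n)
    (h : f =O[𝓝 0] (fun x : ℝ => x ^ n)) : HasDerivAt f 0 0 := by
  have h0 : f 0 = 0 := by
    have := h.eq_zero_imp.self_of_nhds
    exact this (by simp; lia)
  rw [hasDerivAt_iff_isLittleO]
  simp only [sub_zero, smul_zero, h0]
  have h1 : (fun x : ℝ => x ^ n) =o[𝓝 0] (fun x : ℝ => x ^ 1) := isLittleO_pow_pow (by lia)
  simpa using h.trans_isLittleO h1

theorem hasFDerivAt_of_partials {f : ℝ × ℝ → ℝ} {x s a b : ℝ} (h : DifferentiableAt ℝ f (x, s))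
    (hx : HasDerivAt (fun x => f (x, s)) a x) (hs : HasDerivAt (fun s => f (x, s)) b s) :
    HasFDerivAt f (a • ContinuousLinearMap.fst ℝ ℝ ℝ + b • ContinuousLinearMap.snd ℝ ℝ ℝ)
      (x, s) := by
  have hf := h.hasFDerivAt
  have h1 : fderiv ℝ f (x, s) (1, 0) = a :=
    (hf.comp_hasDerivAt x ((hasDerivAt_id x).prodMk (hasDerivAt_const x s))).unique hx
  have h2 : fderiv ℝ f (x, s) (0, 1) = b :=
    (hf.comp_hasDerivAt s ((hasDerivAt_const s x).prodMk (hasDerivAt_id s))).unique hs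
  convert hf using 1
  ext <;> simp [h1, h2]

theorem drift_fixedPoint (hK : K = Real.exp (-2 * J)) : drift J K (0, sStar K) = (0, 0) := by
  rw [drift_apply, D₁_zero_left, D₂_fixedPoint hK]
  simp

theorem hasFDerivAt_drift (hK : K = Real.exp (-2 * J)) :
    HasFDerivAt (drift J K) ((0 : ℝ × ℝ →L[ℝ] ℝ).prod
      ((-(4 * K / (1 + K ^ 2))) • ContinuousLinearMap.snd ℝ ℝ ℝ)) (0, sStar K) := by
  have hpos : 0 < K := hK ▸ Real.exp_pos _
  have h1 := hasFDerivAt_of_partials (f := fun q => D₁ 0 0 J K q.1 q.2) (x := 0) (s := sStar K)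
    (a := 0) (b := 0) ((contDiffAt_D₁ (n := 1) J K (by simp)).differentiableAt (by norm_num))
    (hasDerivAt_zero_of_isBigO (n := 3) (by norm_num) (isBigO_nhds_zero_of_punctured
      (D₁_zero_left ..) (by simpa using D₁_isBigO_three (η := fun _ => 0) hK (isBigO_zero _ _))))
    (by simpa only [D₁_zero_left] using hasDerivAt_const (sStar K) (0 : ℝ))
  have h2 := hasFDerivAt_of_partials (f := fun q => D₂ 0 0 J K q.1 q.2) (x := 0) (s := sStar K)
    (a := 0) (b := 4 * K / (1 + K ^ 2))
    ((contDiffAt_D₂ (n := 1) J K (by simp)).differentiableAt (by norm_num))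
    (hasDerivAt_zero_of_isBigO (n := 2) le_rfl (D₂_isBigO_sq hK)) (by
      simp only [D₂_zero_left hK]
      refine ((((hasDerivAt_id' (sStar K)).const_mul 2).sub_const 1).sub
        ((((hasDerivAt_id' (sStar K)).sub_const (1 / 2)).sub
          (hasDerivAt_pow 2 (sStar K))).const_mul (2 * tau K))).congr_deriv ?_
      simp only [Nat.cast_ofNat, Nat.add_one_sub_one, pow_one]
      unfold tau sStar
      field_simp
      ring)
  have h3 : HasFDerivAt (fun q : ℝ × ℝ => (-D₁ 0 0 J K q.1 q.2, -D₂ 0 0 J K q.1 q.2)) _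
    (0, sStar K) := h1.fun_neg.prodMk h2.fun_neg
  exact h3.congr_fderiv (by ext <;> simp)

end

section

open Polynomial

variable {J K : ℝ}

/-! ### Polynomial approximations of the center manifolds -/

theorem exists_eventuallyEq_pow_mul {f : ℝ → ℝ} (hf : AnalyticAt ℝ f 0) {n : ℕ}
    (h : f =O[𝓝 0] (fun x : ℝ => x ^ n)) :
    ∃ g : ℝ → ℝ, AnalyticAt ℝ g 0 ∧ ∀ᶠ x in 𝓝 0, f x = x ^ n * g x := by
  by_cases htop : ∀ᶠ x in 𝓝 (0 : ℝ), f x = 0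
  · exact ⟨fun _ => 0, analyticAt_const, htop.mono fun x hx => by simp [hx]⟩
  obtain ⟨m, g, hg, hg0, hfg⟩ := hf.exists_eventuallyEq_pow_smul_nonzero_iff.2 htop
  simp only [sub_zero, smul_eq_mul] at hfg
  have hmn : n ≤ m := by
    by_contra! hlt
    have h1 : (fun x => x ^ m * g x) =O[𝓝[≠] 0] (fun x : ℝ => x ^ n) :=
      (h.mono nhdsWithin_le_nhds).congr' (nhdsWithin_le_nhds hfg) EventuallyEq.rfl
    have h2 := isBigO_of_pow_mul (m := n - m) (by lia) h1
    have h3 : Tendsto (fun x : ℝ => x ^ (n - m)) (𝓝[≠] 0) (𝓝 0) :=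
      (Continuous.tendsto' (by fun_prop) 0 0 (by simp; lia)).mono_left nhdsWithin_le_nhds
    exact hg0 (tendsto_nhds_unique (hg.continuousAt.tendsto.mono_left nhdsWithin_le_nhds)
      (h2.trans_tendsto h3))
  refine ⟨fun x => x ^ (m - n) * g x, (analyticAt_id.fun_pow _).fun_mul hg, ?_⟩
  filter_upwards [hfg] with x hx
  rw [hx, ← mul_assoc, ← pow_add, Nat.add_sub_cancel' hmn]

theorem exists_sub_mul_pow_isBigO {f : ℝ → ℝ} (hf : AnalyticAt ℝ f 0) {n : ℕ}
    (h : f =O[𝓝 0] (fun x : ℝ => x ^ n)) :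
    ∃ r : ℝ, (fun x => f x - r * x ^ n) =O[𝓝 0] (fun x : ℝ => x ^ (n + 1)) := by
  obtain ⟨g, hg, hfg⟩ := exists_eventuallyEq_pow_mul hf h
  refine ⟨g 0, ?_⟩
  have h1 : (fun x => g x - g 0) =O[𝓝 0] (fun x : ℝ => x) := by
    simpa using hg.differentiableAt.isBigO_sub
  refine ((isBigO_refl (fun x : ℝ => x ^ n) _).mul h1).congr' ?_
    (Eventually.of_forall fun x => (pow_succ x n).symm)
  filter_upwards [hfg] with x hx
  rw [hx]; ring

/-- Analyticity permits differentiating an order bound: f is x^{n+1} times an analytic function. -/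
theorem deriv_isBigO_of_analyticAt {f : ℝ → ℝ} (hf : AnalyticAt ℝ f 0) {n : ℕ}
    (h : f =O[𝓝 0] (fun x : ℝ => x ^ (n + 1))) :
    deriv f =O[𝓝 0] (fun x : ℝ => x ^ n) := by
  obtain ⟨g, hg, hfg⟩ := exists_eventuallyEq_pow_mul hf h
  have h1 : ∀ᶠ x in 𝓝 0, deriv f x = x ^ n * ((n + 1) * g x + x * deriv g x) := by
    filter_upwards [hfg.eventually_nhds, hg.eventually_analyticAt] with x hx hgx
    have h2 : HasDerivAt (fun x => x ^ (n + 1) * g x) _ x :=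
      (hasDerivAt_pow (n + 1) x).mul hgx.differentiableAt.hasDerivAt
    rw [EventuallyEq.deriv_eq hx, h2.deriv]
    push_cast
    ring
  have hc : ContinuousAt (fun x => (n + 1) * g x + x * deriv g x) 0 :=
    (continuousAt_const.mul hg.continuousAt).add (continuousAt_id.mul hg.deriv.continuousAt)
  refine ((isBigO_refl (fun x : ℝ => x ^ n) _).mul (hc.isBigO_one ℝ)).congr' ?_
    (Eventually.of_forall fun x => mul_one _)
  exact h1.mono fun x hx => hx.symm

theorem analyticAt_eval (p : ℝ[X]) (x : ℝ) : AnalyticAt ℝ (fun x => p.eval x) x := by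
  simpa using AnalyticAt.aeval_polynomial (analyticAt_id (𝕜 := ℝ) (z := x)) p

theorem isBigO_eval_of_dvd {p : ℝ[X]} {n : ℕ} (h : X ^ n ∣ p) :
    (fun x => p.eval x) =O[𝓝 0] (fun x : ℝ => x ^ n) := by
  obtain ⟨q, rfl⟩ := h
  have := (isBigO_refl (fun x : ℝ => x ^ n) (𝓝 0)).mul
    ((analyticAt_eval q 0).continuousAt.isBigO_one ℝ)
  simpa using this

theorem isBigO_eval_derivative_of_dvd {p : ℝ[X]} (h : X ^ 2 ∣ p) :
    (fun x => p.derivative.eval x) =O[𝓝 0] (fun x : ℝ => x) := by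
  have := deriv_isBigO_of_analyticAt (n := 1) (analyticAt_eval p 0) (isBigO_eval_of_dvd h)
  have hd : deriv (fun x => p.eval x) = fun x => p.derivative.eval x := funext fun x => p.deriv
  simpa [hd] using this

/-- The defect in the invariance of the graph of `sStar K + p`. -/
noncomputable def invarianceDefect (J K : ℝ) (p : ℝ[X]) (x : ℝ) : ℝ :=
  D₂ 0 0 J K x (sStar K + p.eval x) - p.derivative.eval x * D₁ 0 0 J K x (sStar K + p.eval x)

/-- The contraction rate towards the graph through `(x, s)` of slope `d`, at distance `w`. -/
noncomputable def fastRate (J K x s w d : ℝ) : ℝ :=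
  2 + (1 + (2 * s + w) / (x ^ 2 - 1)) * (fastCoeff J K x - d * slowCoeff J K x)

theorem defectTerm_add (x s w : ℝ) :
    defectTerm x (s + w) = defectTerm x s + w * (1 + (2 * s + w) / (x ^ 2 - 1)) := by
  simp only [defectTerm]; ring

theorem D₁_add (J K x s w : ℝ) : D₁ 0 0 J K x (s + w)
    = D₁ 0 0 J K x s + w * ((1 + (2 * s + w) / (x ^ 2 - 1)) * slowCoeff J K x) := by
  rw [D₁_eq, D₁_eq, defectTerm_add]; ring

theorem D₂_sub_mul_D₁_add (J K x s w d : ℝ) :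
    D₂ 0 0 J K x (s + w) - d * D₁ 0 0 J K x (s + w)
      = D₂ 0 0 J K x s - d * D₁ 0 0 J K x s + w * fastRate J K x s w d := by
  rw [D₁_eq, D₁_eq, D₂_eq, D₂_eq, defectTerm_add, fastRate]; ring

theorem slowCoeff_zero (J K : ℝ) : slowCoeff J K 0 = 0 := by
  simp [slowCoeff]

theorem fastRate_zero (hK : K = Real.exp (-2 * J)) (d : ℝ) :
    fastRate J K 0 (sStar K) 0 d = 4 * K / (1 + K ^ 2) := by
  have hpos : 0 < K := hK ▸ Real.exp_pos _
  have : fastCoeff J K 0 = -2 * tau K := by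
    simp [fastCoeff, tanh_two_mul_eq_tau hK]; ring
  rw [fastRate, slowCoeff_zero, this]
  unfold tau sStar
  field_simp
  ring

theorem analyticAt_sq_sub_one_inv : AnalyticAt ℝ (fun x : ℝ => (x ^ 2 - 1)⁻¹) 0 :=
  ((analyticAt_id.fun_pow 2).fun_sub analyticAt_const).fun_inv (by simp)

theorem analyticAt_invarianceDefect (J K : ℝ) (p : ℝ[X]) :
    AnalyticAt ℝ (invarianceDefect J K p) 0 := by
  have h1 := analyticAt_slowCoeff J K 0
  have h2 := analyticAt_fastCoeff J K 0
  have h3 := analyticAt_eval p 0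
  have h4 := analyticAt_eval (derivative p) 0
  have h5 := analyticAt_tanh_affine K 0 0
  have h6 := analyticAt_tanh_affine K (-(2 * J)) 0
  have h7 := analyticAt_tanh_affine K (2 * J) 0
  have h8 := analyticAt_sq_sub_one_inv
  simp only [add_zero, ← sub_eq_add_neg] at h5 h6 h7
  have h9 : AnalyticAt ℝ (fun x => defectTerm x (sStar K + p.eval x)) 0 := by
    unfold defectTerm
    simp only [div_eq_mul_inv]
    fun_prop
  unfold invarianceDefect
  simp only [D₁_eq, D₂_eq]
  fun_prop

/-- Adding βx^{n+2} to p changes the defect by βγx^{n+2} up to higher order: γ ≠ 0 is the fast rate,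
and the change of p' is multiplied by the small D₁. Thus each coefficient of the defect can be
removed in turn. -/
theorem exists_polynomial_invarianceDefect_isBigO (hK : K = Real.exp (-2 * J)) (n : ℕ) :
    ∃ p : ℝ[X], X ^ 2 ∣ p ∧ invarianceDefect J K p =O[𝓝 0] (fun x : ℝ => x ^ (n + 2)) := by
  have hpos : 0 < K := hK ▸ Real.exp_pos _
  induction n with
  | zero =>
    refine ⟨0, dvd_zero _, ?_⟩
    unfold invarianceDefect
    simpa using D₂_isBigO_sq hK
  | succ n ih =>
    obtain ⟨p, hp2, hp⟩ := ih
    obtain ⟨r, hr⟩ := exists_sub_mul_pow_isBigO (analyticAt_invarianceDefect J K p) hp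
    set γ := 4 * K / (1 + K ^ 2) with hγ
    have hγ0 : γ ≠ 0 := by positivity
    -- Chosen to cancel the leading coefficient r of the current defect.
    set β := -(r / γ)
    set P := p + C β * X ^ (n + 2) with hP
    have hev : ∀ x, P.eval x = p.eval x + β * x ^ (n + 2) := fun x => by simp [hP]
    have hdev : ∀ x, P.derivative.eval x
        = p.derivative.eval x + β * ((n + 2) * x ^ (n + 1)) := fun x => by
      simp only [hP, derivative_add, derivative_C_mul_X_pow, eval_add, eval_mul, eval_C,
        eval_pow, eval_X]
      push_cast
      ring
    refine ⟨P, dvd_add hp2 (Dvd.dvd.mul_left (pow_dvd_pow X (by lia)) _), ?_⟩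
    have hrate : (fun x => fastRate J K x (sStar K + p.eval x) (β * x ^ (n + 2))
        (P.derivative.eval x) - γ) =O[𝓝 0] (fun x : ℝ => x) := by
      have h1 := analyticAt_slowCoeff J K 0
      have h2 := analyticAt_fastCoeff J K 0
      have h3 := analyticAt_eval p 0
      have h4 := analyticAt_eval (derivative P) 0
      have h8 := analyticAt_sq_sub_one_inv
      have h : AnalyticAt ℝ (fun x => fastRate J K x (sStar K + p.eval x) (β * x ^ (n + 2))
          (P.derivative.eval x)) 0 := by
        unfold fastRate
        simp only [div_eq_mul_inv]
        fun_prop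
      have h0 : p.eval 0 = 0 := by
        obtain ⟨q, rfl⟩ := hp2; simp
      simpa [h0, fastRate_zero hK] using h.differentiableAt.isBigO_sub
    have hD₁ : (fun x => D₁ 0 0 J K x (sStar K + p.eval x)) =O[𝓝 0] (fun x : ℝ => x ^ 2) :=
      (isBigO_nhds_zero_of_punctured (by simp [D₁_zero_left]) (D₁_isBigO_three hK
        ((isBigO_eval_of_dvd hp2).mono nhdsWithin_le_nhds))).trans (isBigO_pow_of_le (by norm_num))
    have e1 := ((isBigO_refl (fun x : ℝ => x ^ (n + 2)) (𝓝 0)).mul hrate).const_mul_left β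
    have e2 := ((isBigO_refl (fun x : ℝ => x ^ (n + 1)) (𝓝 0)).mul hD₁).const_mul_left
      (β * (n + 2))
    have e1' := e1.congr_right (fun x => by ring : ∀ x : ℝ, x ^ (n + 2) * x = x ^ (n + 1 + 2))
    have e2' := e2.congr_right (fun x => by ring :
      ∀ x : ℝ, x ^ (n + 1) * x ^ 2 = x ^ (n + 1 + 2))
    have e3 := (hr.add e1').sub e2'
    refine e3.congr_left fun x => ?_
    have h1 := D₂_sub_mul_D₁_add J K x (sStar K + p.eval x) (β * x ^ (n + 2))
      (P.derivative.eval x)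
    have h2 : β * γ = -r := by simp only [β]; field_simp
    simp only [invarianceDefect]
    rw [hev, ← add_assoc, h1]
    linear_combination D₁ 0 0 J K x (sStar K + p.eval x) * hdev x - x ^ (n + 2) * h2

end

section

open Polynomial

variable {J K : ℝ} {p : ℝ[X]} {k N : ℕ} {a : ℝ}

/-! ### Normal form of the dynamics near the fixed point -/

/-- Minus the logarithmic derivative of the magnetization, in the coordinates `x = m` and
`w = s - sStar K - p m`. -/
noncomputable def slowField (J K : ℝ) (p : ℝ[X]) (x w : ℝ) : ℝ :=
  D₁ 0 0 J K x (sStar K + p.eval x + w) / x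

/-- Minus the derivative of `w = s - sStar K - p m`. -/
noncomputable def fastField (J K : ℝ) (p : ℝ[X]) (x w : ℝ) : ℝ :=
  D₂ 0 0 J K x (sStar K + p.eval x + w)
    - p.derivative.eval x * D₁ 0 0 J K x (sStar K + p.eval x + w)

/-- At x = 0 the quotient takes the default value 0, which is harmless because D₁ vanishes there. -/
theorem mul_slowField (J K : ℝ) (p : ℝ[X]) (x w : ℝ) :
    x * slowField J K p x w = D₁ 0 0 J K x (sStar K + p.eval x + w) := by
  rcases eq_or_ne x 0 with rfl | hx
  · rw [D₁_zero_left, zero_mul]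
  · rw [slowField, mul_div_cancel₀ _ hx]

theorem eval_zero_of_sq_dvd (hp : X ^ 2 ∣ p) : p.eval 0 = 0 := by
  obtain ⟨q, rfl⟩ := hp; simp

theorem contDiffAt_eval_fst (p : ℝ[X]) (q : ℝ × ℝ) {n : WithTop ℕ∞} :
    ContDiffAt ℝ n (fun q : ℝ × ℝ => p.eval q.1) q :=
  (analyticAt_eval p q.1).contDiffAt.comp q contDiffAt_fst

theorem fastRate_sub_isBigO (hK : K = Real.exp (-2 * J)) (hp : X ^ 2 ∣ p) :
    (fun q : ℝ × ℝ => fastRate J K q.1 (sStar K + p.eval q.1) q.2 (p.derivative.eval q.1)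
      - 4 * K / (1 + K ^ 2)) =O[𝓝 0] (fun q : ℝ × ℝ => q) := by
  have h1 : ContDiffAt ℝ 1 (fun q : ℝ × ℝ => slowCoeff J K q.1) 0 :=
    (analyticAt_slowCoeff J K 0).contDiffAt.comp (0 : ℝ × ℝ) contDiffAt_fst
  have h2 : ContDiffAt ℝ 1 (fun q : ℝ × ℝ => fastCoeff J K q.1) 0 :=
    (analyticAt_fastCoeff J K 0).contDiffAt.comp (0 : ℝ × ℝ) contDiffAt_fst
  have h3 := contDiffAt_eval_fst p 0 (n := 1)
  have h4 := contDiffAt_eval_fst p.derivative 0 (n := 1)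
  have h : ContDiffAt ℝ 1 (fun q : ℝ × ℝ => fastRate J K q.1 (sStar K + p.eval q.1) q.2
      (p.derivative.eval q.1)) 0 := by
    unfold fastRate
    fun_prop (disch := simp)
  simpa [eval_zero_of_sq_dvd hp, fastRate_zero hK] using
    (h.differentiableAt (by norm_num)).isBigO_sub

/-- Oddness of tanh makes `slowCoeff` vanish at 0; this factor x is what keeps the effect of w on F
bounded after division by x. -/
theorem slow_increment_isBigO (J K : ℝ) (p : ℝ[X]) :
    (fun q : ℝ × ℝ => (1 + (2 * (sStar K + p.eval q.1) + q.2) / (q.1 ^ 2 - 1))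
      * slowCoeff J K q.1) =O[𝓝 0] (fun q : ℝ × ℝ => q.1) := by
  have h1 : slowCoeff J K =O[𝓝 0] (fun x : ℝ => x) :=
    isBigO_id_of_contDiffAt (analyticAt_slowCoeff J K 0).differentiableAt (slowCoeff_zero J K)
  have h2 := h1.comp_tendsto (continuous_fst.tendsto' (0 : ℝ × ℝ) 0 rfl)
  have h3 := contDiffAt_eval_fst p 0 (n := 1)
  have h4 : ContDiffAt ℝ 1 (fun q : ℝ × ℝ =>
      1 + (2 * (sStar K + p.eval q.1) + q.2) / (q.1 ^ 2 - 1)) 0 := by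
    fun_prop (disch := simp)
  have h5 := (h4.continuousAt.isBigO_one ℝ).mul h2
  simpa using h5

theorem exists_slowFast (hK : K = Real.exp (-2 * J)) (hp : X ^ 2 ∣ p) (hk : 1 ≤ k)
    (hN : 2 * k + 2 ≤ N) (ha : 0 < a) (hdef : invarianceDefect J K p =O[𝓝 0] (fun x : ℝ => x ^ N))
    (hslow : (fun x => D₁ 0 0 J K x (sStar K + p.eval x) - a * x ^ (2 * k + 1))
      =O[𝓝 0] (fun x : ℝ => x ^ (2 * k + 3))) :
    ∃ C ρ, SlowFast k N a (4 * K / (1 + K ^ 2)) C ρ (slowField J K p) (fastField J K p) := by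
  have hpos : 0 < K := hK ▸ Real.exp_pos _
  have hfst : Tendsto (fun q : ℝ × ℝ => q.1) (𝓝 0) (𝓝 0) := continuous_fst.tendsto' _ _ rfl
  obtain ⟨C₁, hC₁, h1⟩ := (hdef.comp_tendsto hfst).exists_pos
  obtain ⟨C₂, hC₂, h2⟩ := (fastRate_sub_isBigO hK hp).exists_pos
  obtain ⟨C₃, hC₃, h3⟩ := (hslow.comp_tendsto hfst).exists_pos
  obtain ⟨C₄, hC₄, h4⟩ := (slow_increment_isBigO J K p).exists_pos
  obtain ⟨ε, hε, hb⟩ := Metric.eventually_nhds_iff_ball.1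
    ((h1.bound.and h2.bound).and (h3.bound.and h4.bound))
  have hbox : ∀ x w : ℝ, |x| ≤ ε / 2 → |w| ≤ ε / 2 → (x, w) ∈ Metric.ball (0 : ℝ × ℝ) ε := by
    intro x w hx hw
    rw [mem_ball_zero_iff, Prod.norm_mk, max_lt_iff, Real.norm_eq_abs, Real.norm_eq_abs]
    exact ⟨by linarith, by linarith⟩
  refine ⟨C₁ + C₂ + C₃ + C₄, ε / 2, hk, hN, ha, by positivity, by positivity, half_pos hε, ?_, ?_⟩
  · intro x w hx hw
    obtain ⟨-, b3, b4⟩ := hb (x, w) (hbox x w hx hw)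
    simp only [Function.comp_apply, Real.norm_eq_abs] at b3 b4
    rcases eq_or_ne x 0 with rfl | hx0
    · have h0 : (0 : ℝ) ^ (2 * k) = 0 := zero_pow (by lia)
      simp only [slowField, div_zero, h0, mul_zero, sub_zero, abs_zero]
      positivity
    · have hx' : 0 < |x| := abs_pos.2 hx0
      have e1 : x * (slowField J K p x w - a * x ^ (2 * k))
          = (D₁ 0 0 J K x (sStar K + p.eval x) - a * x ^ (2 * k + 1))
            + w * ((1 + (2 * (sStar K + p.eval x) + w) / (x ^ 2 - 1)) * slowCoeff J K x) := by
        rw [mul_sub, mul_slowField, D₁_add]; ring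
      have e2 : |x| * |slowField J K p x w - a * x ^ (2 * k)|
          ≤ |x| * ((C₁ + C₂ + C₃ + C₄) * (|w| + |x| ^ (2 * k + 2))) := by
        rw [← abs_mul, e1]
        refine (abs_add_le _ _).trans ?_
        rw [abs_mul w]
        have b4' := mul_le_mul_of_nonneg_left b4 (abs_nonneg w)
        have hz : 0 ≤ |x| ^ (2 * k + 2) := by positivity
        have e3 : |x ^ (2 * k + 3)| = |x| * |x| ^ (2 * k + 2) := by rw [abs_pow]; ring
        rw [e3] at b3
        have g1 : 0 ≤ |x| * |w| := by positivity
        have g2 : 0 ≤ |x| * |x| ^ (2 * k + 2) := by positivity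
        nlinarith [mul_nonneg (by positivity : 0 ≤ C₁ + C₂ + C₃) g1,
          mul_nonneg (by positivity : 0 ≤ C₁ + C₂ + C₄) g2]
      exact le_of_mul_le_mul_left e2 hx'
  · intro x w hx hw
    obtain ⟨⟨b1, b2⟩, -⟩ := hb (x, w) (hbox x w hx hw)
    simp only [Function.comp_apply, Real.norm_eq_abs, Prod.norm_mk] at b1 b2
    have e1 : fastField J K p x w - 4 * K / (1 + K ^ 2) * w = invarianceDefect J K p x
        + w * (fastRate J K x (sStar K + p.eval x) w (p.derivative.eval x)
          - 4 * K / (1 + K ^ 2)) := by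
      rw [fastField, D₂_sub_mul_D₁_add, invarianceDefect]; ring
    rw [e1]
    refine (abs_add_le _ _).trans ?_
    rw [abs_mul w]
    have hmax : max |x| |w| ≤ |x| + |w| :=
      max_le (by linarith [abs_nonneg w]) (by linarith [abs_nonneg x])
    have b2' := mul_le_mul_of_nonneg_left
      (b2.trans (mul_le_mul_of_nonneg_left hmax hC₂.le)) (abs_nonneg w)
    rw [abs_pow] at b1
    have g1 : 0 ≤ |w| * (|x| + |w|) := by positivity
    have g2 : 0 ≤ |x| ^ N := by positivity
    nlinarith [mul_nonneg (by positivity : 0 ≤ C₁ + C₃ + C₄) g1,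
      mul_nonneg (by positivity : 0 ≤ C₂ + C₃ + C₄) g2]

/-! ### Trajectories in the coordinates of the normal form -/

/-- The equation is demanded only while the curve is in the box, so that both true trajectories and
solutions of a modified field qualify. -/
theorem isSolutionInBox_of_curve {Y : ℝ → ℝ × ℝ} {r : ℝ} (hc : ContinuousOn Y (Set.Ici 0))
    (hd : ∀ t, 0 < t → |(Y t).1| ≤ r → |(Y t).2 - sStar K - p.eval (Y t).1| ≤ r →
      HasDerivAt Y (drift J K (Y t)) t) :
    IsSolutionInBox (slowField J K p) (fastField J K p) r (fun t => (Y t).1)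
      (fun t => (Y t).2 - sStar K - p.eval (Y t).1) := by
  have hc1 : ContinuousOn (fun t => (Y t).1) (Set.Ici 0) := continuous_fst.comp_continuousOn hc
  have hc2 : ContinuousOn (fun t => (Y t).2) (Set.Ici 0) := continuous_snd.comp_continuousOn hc
  refine ⟨hc1, (hc2.sub continuousOn_const).sub (p.continuous.comp_continuousOn hc1), ?_⟩
  intro t ht hx hw
  have h := hd t ht hx hw
  have hs : sStar K + p.eval (Y t).1 + ((Y t).2 - sStar K - p.eval (Y t).1) = (Y t).2 := by ring
  have h1 : HasDerivAt (fun t => (Y t).1) (-D₁ 0 0 J K (Y t).1 (Y t).2) t :=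
    (hasFDerivAt_fst (𝕜 := ℝ) (p := Y t)).comp_hasDerivAt t h
  have h2 : HasDerivAt (fun t => (Y t).2) (-D₂ 0 0 J K (Y t).1 (Y t).2) t :=
    (hasFDerivAt_snd (𝕜 := ℝ) (p := Y t)).comp_hasDerivAt t h
  constructor
  · rw [mul_slowField, hs]; exact h1
  · refine ((h2.sub_const (sStar K)).sub ((p.hasDerivAt (Y t).1).comp t h1)).congr_deriv ?_
    rw [fastField, hs]; ring

theorem lipschitzWith_clamp (c ρ : ℝ) :
    LipschitzWith 1 (fun y : ℝ => max (c - ρ) (min (c + ρ) y)) :=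
  (LipschitzWith.id.const_min _).const_max _

theorem abs_clamp_sub_le {c ρ : ℝ} (hρ : 0 ≤ ρ) (y : ℝ) :
    |max (c - ρ) (min (c + ρ) y) - c| ≤ ρ := by
  rw [abs_le]
  constructor
  · linarith [le_max_left (c - ρ) (min (c + ρ) y)]
  · have := max_le (by linarith : c - ρ ≤ c + ρ) (min_le_left (c + ρ) y)
    linarith

theorem clamp_eq_self {c ρ y : ℝ} (h : |y - c| ≤ ρ) : max (c - ρ) (min (c + ρ) y) = y := by
  obtain ⟨h1, h2⟩ := abs_le.1 h
  rw [min_eq_right (by linarith), max_eq_right (by linarith)]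

/-- Curves that exist for all times and solve the dynamics as long as they stay near the fixed
point. -/
theorem exists_curve (J K : ℝ) : ∃ ρ > 0, ∀ q : ℝ × ℝ, ∃ Y : ℝ → ℝ × ℝ, Y 0 = q ∧
    ContinuousOn Y (Set.Ici 0) ∧ ∀ t, 0 ≤ t → |(Y t).1| ≤ ρ → |(Y t).2 - sStar K| ≤ ρ →
      HasDerivWithinAt Y (drift J K (Y t)) (Set.Ici 0) t := by
  have hd : ContDiffAt ℝ 1 (drift J K) (0, sStar K) :=
    (contDiffAt_D₁ J K (by simp)).neg.prodMk (contDiffAt_D₂ J K (by simp)).neg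
  obtain ⟨L, u, hu, hL⟩ := hd.exists_lipschitzOnWith
  obtain ⟨ρ, hρ, hball⟩ := Metric.nhds_basis_closedBall.mem_iff.1 hu
  -- Clamping both coordinates makes the field globally Lipschitz and bounded without changing it
  -- near the fixed point.
  set cl : ℝ × ℝ → ℝ × ℝ := fun q =>
    (max (0 - ρ) (min (0 + ρ) q.1), max (sStar K - ρ) (min (sStar K + ρ) q.2)) with hcl
  have hclL : LipschitzWith 1 cl := by
    have := ((lipschitzWith_clamp 0 ρ).comp LipschitzWith.prod_fst).prodMk
      ((lipschitzWith_clamp (sStar K) ρ).comp (LipschitzWith.prod_snd (α := ℝ) (β := ℝ)))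
    rwa [mul_one, max_self] at this
  have hmem : ∀ q, cl q ∈ Metric.closedBall ((0, sStar K) : ℝ × ℝ) ρ := by
    intro q
    rw [Metric.mem_closedBall, Prod.dist_eq, max_le_iff, Real.dist_eq, Real.dist_eq]
    exact ⟨abs_clamp_sub_le hρ.le _, abs_clamp_sub_le hρ.le _⟩
  have hf : LipschitzWith L (fun q => drift J K (cl q)) := by
    have := (hL.mono hball).comp (hclL.lipschitzOnWith (s := Set.univ)) (fun q _ => hmem q)
    rw [mul_one, lipschitzOnWith_univ] at this
    exact this
  have hbd : ∀ q, ‖drift J K (cl q)‖ ≤ (‖drift J K (0, sStar K)‖₊ + L * ρ.toNNReal : NNReal) := by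
    intro q
    have h1 := (hL.mono hball).norm_sub_le (hmem q) (Metric.mem_closedBall_self hρ.le)
    have h2 : ‖cl q - (0, sStar K)‖ ≤ ρ := by simpa [dist_eq_norm] using hmem q
    have h3 := norm_le_norm_add_norm_sub' (drift J K (cl q)) (drift J K (0, sStar K))
    push_cast
    rw [Real.coe_toNNReal _ hρ.le]
    have h4 := mul_le_mul_of_nonneg_left h2 L.coe_nonneg
    linarith
  refine ⟨ρ, hρ, fun q => ?_⟩
  obtain ⟨Y, hY0, hY⟩ := exists_hasDerivWithinAt_Ici_of_lipschitzWith hf hbd q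
  refine ⟨Y, hY0, fun t ht => (hY t ht).continuousWithinAt, fun t ht h1 h2 => ?_⟩
  have hself : cl (Y t) = Y t :=
    Prod.ext (clamp_eq_self (by simpa using h1)) (clamp_eq_self h2)
  simpa only [hself] using hY t ht

theorem eventually_lyapunov_lt (hp : X ^ 2 ∣ p) {k : ℕ} {R : ℝ} (hR : 0 < R) :
    ∃ r₀ > 0, ∀ m₀ s₀ : ℝ, |m₀| < r₀ → |s₀ - sStar K| < r₀ →
      (s₀ - sStar K - p.eval m₀) ^ 2 + m₀ ^ (2 * k + 2) < R := by
  have hc : Continuous (fun q : ℝ × ℝ => (q.2 - sStar K - p.eval q.1) ^ 2 + q.1 ^ (2 * k + 2)) := by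
    have := p.continuous.comp (continuous_fst (X := ℝ) (Y := ℝ))
    fun_prop
  have hlim := hc.tendsto' ((0, sStar K) : ℝ × ℝ) 0 (by simp [eval_zero_of_sq_dvd hp])
  obtain ⟨r₀, hr₀, h⟩ := Metric.eventually_nhds_iff_ball.1 (hlim.eventually (gt_mem_nhds hR))
  refine ⟨r₀, hr₀, fun m₀ s₀ hm hs => h (m₀, s₀) ?_⟩
  rw [Metric.mem_ball, Prod.dist_eq, max_lt_iff, Real.dist_eq, Real.dist_eq, sub_zero]
  exact ⟨hm, hs⟩

/-- Box radii for which the solutions starting in a smaller box stay near the fixed point. -/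
theorem exists_box_radius (hp : X ^ 2 ∣ p) {c C ρ ρ₀ : ℝ} {F G : ℝ → ℝ → ℝ}
    (H : SlowFast k N a c C ρ F G) (hρ₀ : 0 < ρ₀) :
    ∃ r, IsSmallRadius k a c C ρ r ∧ ∀ x s : ℝ, |x| ≤ r → |s - sStar K - p.eval x| ≤ r →
      |x| ≤ ρ₀ ∧ |s - sStar K| ≤ ρ₀ := by
  have hlim : Tendsto (fun x => p.eval x) (𝓝 0) (𝓝 0) :=
    p.continuous.tendsto' 0 0 (eval_zero_of_sq_dvd hp)
  obtain ⟨ε, hε, hb⟩ := Metric.eventually_nhds_iff_ball.1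
    (hlim.eventually (Metric.ball_mem_nhds 0 (half_pos hρ₀)))
  have e1 : ∀ᶠ r in 𝓝[>] (0 : ℝ), r ∈ Set.Ioo 0 ε := Ioo_mem_nhdsGT hε
  have e2 : ∀ᶠ r in 𝓝[>] (0 : ℝ), r ∈ Set.Ioo 0 (ρ₀ / 2) := Ioo_mem_nhdsGT (half_pos hρ₀)
  obtain ⟨r, hr, hr1, hr2⟩ := (H.eventually_isSmallRadius.and (e1.and e2)).exists
  refine ⟨r, hr, fun x s hx hs => ⟨by linarith [hr2.2], ?_⟩⟩
  have h1 : |p.eval x| < ρ₀ / 2 := by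
    simpa using hb x (by simpa using hx.trans_lt hr1.2)
  calc |s - sStar K| = |(s - sStar K - p.eval x) + p.eval x| := by ring_nf
    _ ≤ _ := (abs_add_le _ _).trans (by linarith [hr2.2])

/-- The Lyapunov function keeps the solution of the clamped system where the clamping is inactive,
so it is a true trajectory. The asymptotics are proved for every trajectory, without appeal to
uniqueness. -/
theorem relaxesAs_of_normalForm (hK : K = Real.exp (-2 * J)) (hp : X ^ 2 ∣ p) (hk : 1 ≤ k)
    (ha : 0 < a) (hdef : invarianceDefect J K p =O[𝓝 0] (fun x : ℝ => x ^ (2 * k + 2)))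
    (hslow : (fun x => D₁ 0 0 J K x (sStar K + p.eval x) - a * x ^ (2 * k + 1))
      =O[𝓝 0] (fun x : ℝ => x ^ (2 * k + 3))) :
    RelaxesAs J K (1 / (2 * k)) ((1 / (2 * k * a)) ^ (1 / (2 * k) : ℝ)) := by
  obtain ⟨C, ρ, H⟩ := exists_slowFast hK hp hk le_rfl ha hdef hslow
  obtain ⟨ρ₀, hρ₀, hcurve⟩ := exists_curve J K
  obtain ⟨r, hr, hbox⟩ := exists_box_radius (K := K) hp H hρ₀
  obtain ⟨r₀, hr₀, hinit⟩ := eventually_lyapunov_lt (K := K) hp (k := k) (pow_pos hr.1 (2 * k + 2))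
  refine ⟨r₀, hr₀, fun m₀ s₀ hm0 hm hs => ⟨?_, ?_⟩⟩
  · obtain ⟨Y, hY0, hYc, hYd⟩ := hcurve (m₀, s₀)
    have S : IsSolutionInBox (slowField J K p) (fastField J K p) r (fun t => (Y t).1)
        (fun t => (Y t).2 - sStar K - p.eval (Y t).1) := by
      refine isSolutionInBox_of_curve hYc fun t ht hx hw => ?_
      obtain ⟨h1, h2⟩ := hbox _ _ hx hw
      exact (hYd t ht.le h1 h2).hasDerivAt (Ici_mem_nhds ht)
    refine ⟨Y, fun t ht => ?_, hY0⟩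
    obtain ⟨hx, hw⟩ := S.abs_le_radius H hr (by simpa [hY0] using hinit m₀ s₀ hm hs) ht
    obtain ⟨h1, h2⟩ := hbox _ _ hx hw
    exact hYd t ht h1 h2
  · intro Y hY hY0
    have S : IsSolutionInBox (slowField J K p) (fastField J K p) r (fun t => (Y t).1)
        (fun t => (Y t).2 - sStar K - p.eval (Y t).1) :=
      isSolutionInBox_of_curve (fun t ht => (hY t ht).continuousWithinAt)
        fun t ht _ _ => (hY t ht.le).hasDerivAt (Ici_mem_nhds ht)
    have h0 := hinit m₀ s₀ hm hs
    have h0' : ((Y 0).2 - sStar K - p.eval (Y 0).1) ^ 2 + (Y 0).1 ^ (2 * k + 2)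
        < r ^ (2 * k + 2) := by simpa [hY0] using h0
    have hx0 : (Y 0).1 ≠ 0 := by simpa [hY0] using hm0
    obtain ⟨hx, hw⟩ := S.tendsto_zero H hr h0' hx0
    refine ⟨?_, by simpa [hY0] using S.tendsto_mul_rpow H hr h0' hx0⟩
    refine Tendsto.prodMk_nhds hx ?_
    have h1 := (hw.add_const (sStar K)).add
      ((p.continuous.tendsto' 0 0 (eval_zero_of_sq_dvd hp)).comp hx)
    simp only [zero_add, add_zero] at h1
    refine h1.congr fun t => ?_
    simp only [Function.comp_apply]
    ring

end

section

open Polynomial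

variable {J K : ℝ} {p : ℝ[X]} {k N : ℕ} {a : ℝ}

/-! ### Normal forms on the critical line -/

theorem slow_expansion_critical (hK : K = Real.exp (-2 * J)) (hp : X ^ 2 ∣ p)
    (hdef : invarianceDefect J K p =O[𝓝 0] (fun x : ℝ => x ^ 4)) :
    (fun x => D₁ 0 0 J K x (sStar K + p.eval x)
      - K ^ 2 * (3 - K ^ 2) / (3 * (1 + K ^ 2)) * x ^ 3) =O[𝓝 0] (fun x : ℝ => x ^ 5) :=
  isBigO_nhds_zero_of_punctured (by simp [D₁_zero_left])
    (approxManifold_expansion hK ((isBigO_eval_of_dvd hp).mono nhdsWithin_le_nhds)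
      ((isBigO_eval_derivative_of_dvd hp).mono nhdsWithin_le_nhds)
      (hdef.mono nhdsWithin_le_nhds)).2

theorem slow_expansion_tricritical (hK : K = Real.exp (-2 * J)) (h3 : K ^ 2 = 3) (hp : X ^ 2 ∣ p)
    (hdef : invarianceDefect J K p =O[𝓝 0] (fun x : ℝ => x ^ 6)) :
    (fun x => D₁ 0 0 J K x (sStar K + p.eval x) - 9 / 20 * x ^ 5) =O[𝓝 0] (fun x : ℝ => x ^ 7) :=
  isBigO_nhds_zero_of_punctured (by simp [D₁_zero_left])
    (approxManifold_expansion_tricritical hK h3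
      ((isBigO_eval_of_dvd hp).mono nhdsWithin_le_nhds)
      ((isBigO_eval_derivative_of_dvd hp).mono nhdsWithin_le_nhds)
      (hdef.mono nhdsWithin_le_nhds))

/-- On the critical line, up to its end point, the slow variable is damped at a finite order. -/
theorem exists_slow_expansion (hK : K = Real.exp (-2 * J)) (h3 : K ^ 2 ≤ 3) :
    ∃ (k : ℕ) (a : ℝ), 1 ≤ k ∧ 0 < a ∧ ∀ p : ℝ[X], X ^ 2 ∣ p →
      invarianceDefect J K p =O[𝓝 0] (fun x : ℝ => x ^ (2 * k + 2)) →
      (fun x => D₁ 0 0 J K x (sStar K + p.eval x) - a * x ^ (2 * k + 1))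
        =O[𝓝 0] (fun x : ℝ => x ^ (2 * k + 3)) := by
  have hpos : 0 < K := hK ▸ Real.exp_pos _
  rcases h3.lt_or_eq with h | h
  · have : 0 < 3 - K ^ 2 := by linarith
    exact ⟨1, K ^ 2 * (3 - K ^ 2) / (3 * (1 + K ^ 2)), le_rfl, by positivity,
      fun p hp hdef => slow_expansion_critical hK hp hdef⟩
  · exact ⟨2, 9 / 20, by norm_num, by norm_num,
      fun p hp hdef => slow_expansion_tricritical hK h hp hdef⟩

/-! ### The orbit of a trajectory as a graph over the magnetization -/

/-- The inverse of a decreasing curve tending to zero. -/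
theorem exists_inverse_of_strictAntiOn {x : ℝ → ℝ} {T : ℝ} (hc : ContinuousOn x (Set.Ici T))
    (hanti : StrictAntiOn x (Set.Ici T)) (hlim : Tendsto x atTop (𝓝 0)) :
    ∃ θ : ℝ → ℝ, (∀ y ∈ Set.Ioo 0 (x T), T < θ y ∧ x (θ y) = y ∧ ContinuousAt θ y) ∧
      Tendsto θ (𝓝[>] 0) atTop := by
  have hpos : ∀ t, T ≤ t → 0 < x t := by
    intro t ht
    have h1 : x (t + 1) < x t := hanti ht (by simp only [Set.mem_Ici]; linarith) (by linarith)
    have h2 : 0 ≤ x (t + 1) := by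
      refine le_of_tendsto hlim ?_
      filter_upwards [eventually_ge_atTop (t + 1)] with s hs
      exact hanti.antitoneOn (by simp only [Set.mem_Ici]; linarith)
        (by simp only [Set.mem_Ici]; linarith) hs
    linarith
  have hex : ∀ y, ∃ t, y ∈ Set.Ioo 0 (x T) → T < t ∧ x t = y := by
    intro y
    by_cases hy : y ∈ Set.Ioo 0 (x T)
    · obtain ⟨M, hM, hMT⟩ := ((hlim.eventually (gt_mem_nhds hy.1)).and
        (eventually_ge_atTop T)).exists
      obtain ⟨t, ht, hxt⟩ := intermediate_value_Icc' hMT (hc.mono Set.Icc_subset_Ici_self)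
        ⟨hM.le, hy.2.le⟩
      refine ⟨t, fun _ => ⟨lt_of_le_of_ne ht.1 ?_, hxt⟩⟩
      rintro rfl
      exact absurd hxt hy.2.ne'
    · exact ⟨0, fun h => absurd h hy⟩
  choose θ hθ using hex
  have hlt : ∀ y ∈ Set.Ioo 0 (x T), ∀ s, T ≤ s → (y < x s ↔ s < θ y) := by
    intro y hy s hs
    obtain ⟨h1, h2⟩ := hθ y hy
    conv_lhs => rw [← h2]
    exact hanti.lt_iff_gt h1.le hs
  have hgt : ∀ y ∈ Set.Ioo 0 (x T), ∀ s, T ≤ s → (x s < y ↔ θ y < s) := by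
    intro y hy s hs
    obtain ⟨h1, h2⟩ := hθ y hy
    conv_lhs => rw [← h2]
    exact hanti.lt_iff_gt hs h1.le
  refine ⟨θ, fun y hy => ⟨(hθ y hy).1, (hθ y hy).2, ?_⟩, ?_⟩
  · rw [Metric.continuousAt_iff']
    intro ε hε
    have hT := (hθ y hy).1
    set s₁ := max ((T + θ y) / 2) (θ y - ε)
    have hs₁ : T < s₁ := lt_of_lt_of_le (by linarith) (le_max_left _ _)
    have hs₁' : s₁ < θ y := max_lt (by linarith) (by linarith)
    have hu : y < x s₁ := (hlt y hy s₁ hs₁.le).2 hs₁'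
    have hl : x (θ y + ε) < y := (hgt y hy (θ y + ε) (by linarith)).2 (by linarith)
    filter_upwards [Ioo_mem_nhds hl hu, Ioo_mem_nhds hy.1 hy.2] with z hz hz'
    rw [Real.dist_eq, abs_lt]
    have h1 := (hlt z hz' s₁ hs₁.le).1 hz.2
    have h2 := (hgt z hz' (θ y + ε) (by linarith)).1 hz.1
    constructor <;> linarith [le_max_right ((T + θ y) / 2) (θ y - ε)]
  · rw [tendsto_atTop]
    intro M
    have h1 := hpos (max M T) (le_max_right _ _)
    filter_upwards [Ioo_mem_nhdsGT h1, Ioo_mem_nhdsGT (hpos T le_rfl)] with y hy hy'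
    exact (le_max_left M T).trans ((hlt y hy' (max M T) (le_max_right _ _)).1 hy.2).le

/-- An invariant graph over positive magnetizations, close to a polynomial. -/
theorem exists_half_manifold (hK : K = Real.exp (-2 * J)) (hp : X ^ 2 ∣ p) (hk : 1 ≤ k)
    (hN : 2 * k + 2 ≤ N) (ha : 0 < a) (hdef : invarianceDefect J K p =O[𝓝 0] (fun x : ℝ => x ^ N))
    (hslow : (fun x => D₁ 0 0 J K x (sStar K + p.eval x) - a * x ^ (2 * k + 1))
      =O[𝓝 0] (fun x : ℝ => x ^ (2 * k + 3))) :
    ∃ (b : ℝ) (η : ℝ → ℝ), 0 < b ∧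
      (∀ y ∈ Set.Ioo 0 b, D₁ 0 0 J K y (sStar K + η y) ≠ 0 ∧
        HasDerivAt η (D₂ 0 0 J K y (sStar K + η y) / D₁ 0 0 J K y (sStar K + η y)) y) ∧
      Tendsto (fun y => (η y - p.eval y) / y ^ (N - 1)) (𝓝[>] 0) (𝓝 0) ∧
      Tendsto (fun y => D₁ 0 0 J K y (sStar K + η y) / y ^ (2 * k + 1)) (𝓝[>] 0) (𝓝 a) := by
  obtain ⟨C, ρ, H⟩ := exists_slowFast hK hp hk hN ha hdef hslow
  obtain ⟨ρ₀, hρ₀, hcurve⟩ := exists_curve J K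
  obtain ⟨r, hr, hbox⟩ := exists_box_radius (K := K) hp H hρ₀
  have hr0 := hr.1
  -- Starting on the graph of p gives w = 0 at time 0, and abscissa r/2 puts the Lyapunov function
  -- below its threshold.
  obtain ⟨Y, hY0, hYc, hYd⟩ := hcurve (r / 2, sStar K + p.eval (r / 2))
  have S : IsSolutionInBox (slowField J K p) (fastField J K p) r (fun t => (Y t).1)
      (fun t => (Y t).2 - sStar K - p.eval (Y t).1) := by
    refine isSolutionInBox_of_curve hYc fun t ht hx hw => ?_
    obtain ⟨h1, h2⟩ := hbox _ _ hx hw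
    exact (hYd t ht.le h1 h2).hasDerivAt (Ici_mem_nhds ht)
  set x : ℝ → ℝ := fun t => (Y t).1 with hx
  set w : ℝ → ℝ := fun t => (Y t).2 - sStar K - p.eval (Y t).1 with hw
  have hx0 : x 0 = r / 2 := by simp [hx, hY0]
  have hw0 : w 0 = 0 := by simp [hw, hY0]
  have h0 : w 0 ^ 2 + x 0 ^ (2 * k + 2) < r ^ (2 * k + 2) := by
    rw [hx0, hw0, zero_pow two_ne_zero, zero_add]
    exact pow_lt_pow_left₀ (by linarith) (by linarith) (by lia)
  have hne : x 0 ≠ 0 := by rw [hx0]; positivity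
  have hxpos : ∀ t, 0 ≤ t → 0 < x t := by
    intro t ht
    have h1 := S.sign_eq H hr h0 hne ht
    rw [Real.sign_of_pos (by rw [hx0]; positivity : 0 < x 0)] at h1
    by_contra! hle
    rcases hle.lt_or_eq with h | h
    · rw [Real.sign_of_neg h] at h1; norm_num at h1
    · rw [h, Real.sign_zero] at h1; norm_num at h1
  obtain ⟨hxlim, -⟩ := S.tendsto_zero H hr h0 hne
  have hFlim := S.tendsto_slow_div_pow H hr h0 hne
  have hwlim := S.tendsto_fast_div_pow H hr h0 hne (j := N - 1) (by lia)
  have hder : ∀ t, 0 < t → HasDerivAt x (-(x t * slowField J K p (x t) (w t))) t ∧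
      HasDerivAt w (-fastField J K p (x t) (w t)) t := by
    intro t ht
    obtain ⟨h1, h2⟩ := S.abs_le_radius H hr h0 ht.le
    exact S.deriv t ht h1 h2
  -- After T the quotient F/x^{2k} is positive, so x decreases strictly and time can be written as a
  -- function of x.
  obtain ⟨T, hT⟩ := eventually_atTop.1 ((hFlim.eventually (lt_mem_nhds ha)).and
    (eventually_gt_atTop 0))
  have hT0 : 0 < T := (hT T le_rfl).2
  have hFpos : ∀ t, T ≤ t → 0 < x t * slowField J K p (x t) (w t) := by
    intro t ht
    have h1 := hxpos t (hT0.le.trans ht)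
    have h2 := (hT t ht).1
    rw [div_pos_iff_of_pos_right (by positivity)] at h2
    positivity
  have hanti : StrictAntiOn x (Set.Ici T) := by
    refine strictAntiOn_of_deriv_neg (convex_Ici T)
      (S.contx.mono (Set.Ici_subset_Ici.2 hT0.le)) fun t ht => ?_
    rw [interior_Ici, Set.mem_Ioi] at ht
    rw [(hder t (hT0.trans ht)).1.deriv]
    linarith [hFpos t ht.le]
  obtain ⟨θ, hθ, hθlim⟩ := exists_inverse_of_strictAntiOn
    (S.contx.mono (Set.Ici_subset_Ici.2 hT0.le)) hanti hxlim
  set η : ℝ → ℝ := fun y => w (θ y) + p.eval y with hη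
  have hD₁ : ∀ y ∈ Set.Ioo 0 (x T), D₁ 0 0 J K y (sStar K + η y)
      = x (θ y) * slowField J K p (x (θ y)) (w (θ y)) := by
    intro y hy
    rw [mul_slowField, (hθ y hy).2.1, hη]
    ring_nf
  have hIoo : Set.Ioo 0 (x T) ∈ 𝓝[>] (0 : ℝ) := Ioo_mem_nhdsGT (hxpos T hT0.le)
  refine ⟨x T, η, hxpos T hT0.le, fun y hy => ?_, ?_, ?_⟩
  · obtain ⟨h1, h2, h3⟩ := hθ y hy
    obtain ⟨dx, dw⟩ := hder (θ y) (hT0.trans h1)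
    have hpos := hFpos (θ y) h1.le
    have hne : D₁ 0 0 J K y (sStar K + η y) ≠ 0 := by rw [hD₁ y hy]; exact hpos.ne'
    refine ⟨hne, ?_⟩
    have hθd : HasDerivAt θ (-(x (θ y) * slowField J K p (x (θ y)) (w (θ y))))⁻¹ y := by
      refine HasDerivAt.of_local_left_inverse h3 dx (neg_ne_zero.2 hpos.ne') ?_
      filter_upwards [Ioo_mem_nhds hy.1 hy.2] with z hz using (hθ z hz).2.1
    -- The slope is w'/x' + p' = (D₂ - p'D₁)/D₁ + p' = D₂/D₁.
    refine ((dw.comp y hθd).add (p.hasDerivAt y)).congr_deriv ?_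
    rw [← hD₁ y hy, fastField, h2]
    have e : sStar K + p.eval y + w (θ y) = sStar K + η y := by simp only [hη]; ring
    rw [e]
    field_simp
    ring
  · refine (hwlim.comp hθlim).congr' ?_
    filter_upwards [hIoo] with y hy
    simp only [Function.comp_apply, (hθ y hy).2.1, hη, add_sub_cancel_right]
  · refine (hFlim.comp hθlim).congr' ?_
    filter_upwards [hIoo] with y hy
    have hy0 : y ≠ 0 := hy.1.ne'
    rw [hD₁ y hy]
    simp only [Function.comp_apply, (hθ y hy).2.1]
    rw [pow_succ]
    field_simp

end

section

open Polynomial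

variable {J K : ℝ} {p : ℝ[X]} {k N : ℕ} {a : ℝ}

/-! ### Regularity of the invariant graph -/

/-- Reflection exchanges the two shifted tangents up to sign. Together with the evenness of D₂ it
lets a graph over m > 0 be continued to m < 0. -/
theorem D₁_neg (J K x s : ℝ) : D₁ 0 0 J K (-x) s = -D₁ 0 0 J K x s := by
  have h1 : Real.tanh (K * -x) = -Real.tanh (K * x) := by rw [← Real.tanh_neg]; ring_nf
  have h2 : Real.tanh (K * -x - 2 * J) = -Real.tanh (K * x + 2 * J) := by
    rw [← Real.tanh_neg]; ring_nf
  have h3 : Real.tanh (K * -x + 2 * J) = -Real.tanh (K * x - 2 * J) := by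
    rw [← Real.tanh_neg]; ring_nf
  simp only [D₁_eq, slowCoeff, fastCoeff, defectTerm, h1, h2, h3, neg_sq]
  ring

theorem D₂_neg (J K x s : ℝ) : D₂ 0 0 J K (-x) s = D₂ 0 0 J K x s := by
  have h2 : Real.tanh (K * -x - 2 * J) = -Real.tanh (K * x + 2 * J) := by
    rw [← Real.tanh_neg]; ring_nf
  have h3 : Real.tanh (K * -x + 2 * J) = -Real.tanh (K * x - 2 * J) := by
    rw [← Real.tanh_neg]; ring_nf
  simp only [D₂_eq, fastCoeff, defectTerm, h2, h3, neg_sq]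
  ring

/-- Minus the numerator of the derivative of the slope `d = D₂ / D₁` along the dynamics. -/
noncomputable def slopeForm (J K : ℝ) (u : ℝ × ℝ × ℝ) : ℝ :=
  fderiv ℝ (fun q : ℝ × ℝ => D₂ 0 0 J K q.1 q.2) (u.1, u.2.1) (1, u.2.2)
    - u.2.2 * fderiv ℝ (fun q : ℝ × ℝ => D₁ 0 0 J K q.1 q.2) (u.1, u.2.1) (1, u.2.2)

theorem contDiffAt_slopeForm (J K : ℝ) {u : ℝ × ℝ × ℝ} (hu : |u.1| < 1) :
    ContDiffAt ℝ 1 (slopeForm J K) u := by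
  have hπ : ContDiffAt ℝ 1 (fun u : ℝ × ℝ × ℝ => (u.1, u.2.1)) u := by fun_prop
  have hv : ContDiffAt ℝ 1 (fun u : ℝ × ℝ × ℝ => ((1 : ℝ), u.2.2)) u := by fun_prop
  have h1 : ContDiffAt ℝ 1 (fun u : ℝ × ℝ × ℝ =>
      fderiv ℝ (fun q : ℝ × ℝ => D₁ 0 0 J K q.1 q.2) (u.1, u.2.1)) u :=
    ((contDiffAt_D₁ (n := 2) J K (q := (u.1, u.2.1)) hu).fderiv_right (m := 1)
      (by norm_num)).comp u hπ
  have h2 : ContDiffAt ℝ 1 (fun u : ℝ × ℝ × ℝ =>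
      fderiv ℝ (fun q : ℝ × ℝ => D₂ 0 0 J K q.1 q.2) (u.1, u.2.1)) u :=
    ((contDiffAt_D₂ (n := 2) J K (q := (u.1, u.2.1)) hu).fderiv_right (m := 1)
      (by norm_num)).comp u hπ
  exact (h2.clm_apply hv).sub ((by fun_prop : ContDiffAt ℝ 1 (fun u : ℝ × ℝ × ℝ => u.2.2) u).mul
    (h1.clm_apply hv))

theorem hasDerivAt_D₁_comp {h : ℝ → ℝ} {h' y : ℝ} (hy : |y| < 1) (hh : HasDerivAt h h' y) :
    HasDerivAt (fun y => D₁ 0 0 J K y (sStar K + h y))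
      (fderiv ℝ (fun q : ℝ × ℝ => D₁ 0 0 J K q.1 q.2) (y, sStar K + h y) (1, h')) y :=
  HasFDerivAt.comp_hasDerivAt (l := fun q : ℝ × ℝ => D₁ 0 0 J K q.1 q.2)
    (f := fun y => (y, sStar K + h y)) y
    ((contDiffAt_D₁ (n := 1) J K (q := (y, sStar K + h y)) hy).differentiableAt
      (by norm_num)).hasFDerivAt ((hasDerivAt_id' y).prodMk (hh.const_add (sStar K)))

theorem hasDerivAt_D₂_comp {h : ℝ → ℝ} {h' y : ℝ} (hy : |y| < 1) (hh : HasDerivAt h h' y) :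
    HasDerivAt (fun y => D₂ 0 0 J K y (sStar K + h y))
      (fderiv ℝ (fun q : ℝ × ℝ => D₂ 0 0 J K q.1 q.2) (y, sStar K + h y) (1, h')) y :=
  HasFDerivAt.comp_hasDerivAt (l := fun q : ℝ × ℝ => D₂ 0 0 J K q.1 q.2)
    (f := fun y => (y, sStar K + h y)) y
    ((contDiffAt_D₂ (n := 1) J K (q := (y, sStar K + h y)) hy).differentiableAt
      (by norm_num)).hasFDerivAt ((hasDerivAt_id' y).prodMk (hh.const_add (sStar K)))

theorem slopeForm_sub_isBigO (J K : ℝ) {l : Filter ℝ} {u v : ℝ → ℝ × ℝ × ℝ}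
    (hu : Tendsto u l (𝓝 (0, sStar K, 0))) (hv : Tendsto v l (𝓝 (0, sStar K, 0))) :
    (fun y => slopeForm J K (u y) - slopeForm J K (v y)) =O[l] (fun y => u y - v y) := by
  have h := ((contDiffAt_slopeForm J K (u := (0, sStar K, 0)) (by simp)).hasStrictFDerivAt
    (by norm_num)).isBigO_sub
  exact h.comp_tendsto (hu.prodMk_nhds hv)

/-- The left side is the derivative of the invariance defect of p, and the bound for that analytic
function may be differentiated. -/
theorem slopeForm_eval_isBigO {J K : ℝ} {n : ℕ}
    (hdef : invarianceDefect J K p =O[𝓝 0] (fun x : ℝ => x ^ (n + 1))) :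
    (fun y => slopeForm J K (y, sStar K + p.eval y, p.derivative.eval y)
      - p.derivative.derivative.eval y * D₁ 0 0 J K y (sStar K + p.eval y))
      =O[𝓝 0] (fun x : ℝ => x ^ n) := by
  refine (deriv_isBigO_of_analyticAt (analyticAt_invarianceDefect J K p) hdef).congr' ?_
    EventuallyEq.rfl
  filter_upwards [eventually_abs_lt_one] with y hy
  have h1 := hasDerivAt_D₁_comp (J := J) (K := K) hy (p.hasDerivAt y)
  have h2 := hasDerivAt_D₂_comp (J := J) (K := K) hy (p.hasDerivAt y)
  have h3 : HasDerivAt (invarianceDefect J K p) _ y := h2.sub ((p.derivative.hasDerivAt y).mul h1)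
  rw [h3.deriv, slopeForm]
  ring

theorem contDiffAt_two_of_hasDerivAt {η ζ r : ℝ → ℝ} {b : ℝ} (hb : 0 < b)
    (h1 : ∀ x ∈ Set.Ioo (-b) b, HasDerivAt η (ζ x) x)
    (h2 : ∀ x ∈ Set.Ioo (-b) b, HasDerivAt ζ (r x) x) (h3 : ContinuousOn r (Set.Ioo (-b) b)) :
    ContDiffAt ℝ 2 η 0 := by
  have hmem : Set.Ioo (-b) b ∈ 𝓝 (0 : ℝ) := Ioo_mem_nhds (by linarith) hb
  have e1 : Set.EqOn (deriv η) ζ (Set.Ioo (-b) b) := fun x hx => (h1 x hx).deriv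
  have e2 : Set.EqOn (deriv ζ) r (Set.Ioo (-b) b) := fun x hx => (h2 x hx).deriv
  have hζ : ContDiffOn ℝ (0 + 1) ζ (Set.Ioo (-b) b) := by
    rw [contDiffOn_succ_iff_deriv_of_isOpen isOpen_Ioo]
    refine ⟨fun x hx => (h2 x hx).differentiableAt.differentiableWithinAt, by simp, ?_⟩
    exact contDiffOn_zero.2 (h3.congr e2)
  have hη : ContDiffOn ℝ (1 + 1) η (Set.Ioo (-b) b) := by
    rw [contDiffOn_succ_iff_deriv_of_isOpen isOpen_Ioo]
    refine ⟨fun x hx => (h1 x hx).differentiableAt.differentiableWithinAt, by simp, ?_⟩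
    exact (by simpa using hζ : ContDiffOn ℝ 1 ζ _).congr e1
  rw [one_add_one_eq_two] at hη
  exact hη.contDiffAt hmem

/-- The even extension of a function that is twice differentiable to the right of the origin. -/
theorem contDiffAt_two_even_extension {η ζ r : ℝ → ℝ} {b L : ℝ} (hb : 0 < b)
    (h1 : ∀ x ∈ Set.Ioo 0 b, HasDerivAt η (ζ x) x) (h2 : ∀ x ∈ Set.Ioo 0 b, HasDerivAt ζ (r x) x)
    (h3 : ∀ x ∈ Set.Ioo 0 b, ContinuousAt r x) (hη : η =O[𝓝[>] 0] (fun x : ℝ => x ^ 2))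
    (hζ : (fun x => ζ x - L * x) =O[𝓝[>] 0] (fun x : ℝ => x ^ 2))
    (hr : Tendsto r (𝓝[>] 0) (𝓝 L)) :
    ContDiffAt ℝ 2 (fun x => if x = 0 then 0 else η |x|) 0 ∧
      ∀ x ∈ Set.Ioo (-b) b, HasDerivAt (fun x => if x = 0 then 0 else η |x|)
        (if x = 0 then 0 else SignType.sign x * ζ |x|) x := by
  -- The candidates for the function and its first two derivatives have parities even, odd, even. At
  -- 0, e' = 0 and z' = L come from the two order bounds, and continuity of c from the limit of r.
  set e : ℝ → ℝ := fun x => if x = 0 then 0 else η |x|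
  set z : ℝ → ℝ := fun x => if x = 0 then 0 else SignType.sign x * ζ |x|
  set c : ℝ → ℝ := fun x => if x = 0 then L else r |x|
  have habs : Tendsto (fun x : ℝ => |x|) (𝓝[≠] 0) (𝓝[>] 0) := by
    refine tendsto_nhdsWithin_iff.2 ⟨(continuous_abs.tendsto' _ _ abs_zero).mono_left
      nhdsWithin_le_nhds, ?_⟩
    filter_upwards [self_mem_nhdsWithin] with x hx using abs_pos.2 hx
  have e0 : HasDerivAt e 0 0 := by
    refine hasDerivAt_zero_of_isBigO (n := 2) le_rfl
      (isBigO_nhds_zero_of_punctured (by simp [e]) ?_)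
    refine (hη.comp_tendsto habs).congr' ?_ (Eventually.of_forall fun x => by simp)
    filter_upwards [self_mem_nhdsWithin] with x hx
    have hx0 : x ≠ 0 := hx
    simp only [Function.comp_apply, e, if_neg hx0]
  have z0 : HasDerivAt z L 0 := by
    have : HasDerivAt (fun x => z x - L * x) 0 0 := by
      refine hasDerivAt_zero_of_isBigO (n := 2) le_rfl
        (isBigO_nhds_zero_of_punctured (by simp [z]) ?_)
      have h := hζ.comp_tendsto habs
      refine IsBigO.trans (IsBigO.of_bound 1 ?_) (h.congr_right (fun x => by simp) :
        _ =O[_] fun x : ℝ => x ^ 2)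
      filter_upwards [self_mem_nhdsWithin] with x hx
      have hx0 : x ≠ 0 := hx
      simp only [Function.comp_apply, z, if_neg hx0, one_mul, Real.norm_eq_abs]
      rcases lt_or_gt_of_ne hx0 with h' | h'
      · rw [sign_neg h', abs_of_neg h', ← abs_neg]
        refine le_of_eq (congrArg _ ?_)
        rw [SignType.coe_neg, SignType.coe_one]
        ring
      · rw [sign_pos h', abs_of_pos h']
        simp
    simpa using this.fun_add ((hasDerivAt_id' (0 : ℝ)).const_mul L)
  have hpos : ∀ x : ℝ, 0 < x → ∀ᶠ y in 𝓝 x, 0 < y := fun x hx => Ioi_mem_nhds hx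
  have hneg : ∀ x : ℝ, x < 0 → ∀ᶠ y in 𝓝 x, y < 0 := fun x hx => Iio_mem_nhds hx
  have epos : ∀ x : ℝ, 0 < x → e =ᶠ[𝓝 x] η := fun x hx => (hpos x hx).mono fun y hy => by
    simp only [e, if_neg hy.ne', abs_of_pos hy]
  have eneg : ∀ x : ℝ, x < 0 → e =ᶠ[𝓝 x] fun y => η (-y) := fun x hx =>
    (hneg x hx).mono fun y hy => by simp only [e, if_neg hy.ne, abs_of_neg hy]
  have zpos : ∀ x : ℝ, 0 < x → z =ᶠ[𝓝 x] ζ := fun x hx => (hpos x hx).mono fun y hy => by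
    simp [z, if_neg hy.ne', abs_of_pos hy, sign_pos hy]
  have zneg : ∀ x : ℝ, x < 0 → z =ᶠ[𝓝 x] fun y => -ζ (-y) := fun x hx =>
    (hneg x hx).mono fun y hy => by simp [z, if_neg hy.ne, abs_of_neg hy, sign_neg hy]
  have cpos : ∀ x : ℝ, 0 < x → c =ᶠ[𝓝 x] r := fun x hx => (hpos x hx).mono fun y hy => by
    simp only [c, if_neg hy.ne', abs_of_pos hy]
  have cneg : ∀ x : ℝ, x < 0 → c =ᶠ[𝓝 x] fun y => r (-y) := fun x hx =>
    (hneg x hx).mono fun y hy => by simp only [c, if_neg hy.ne, abs_of_neg hy]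
  have hez : ∀ x ∈ Set.Ioo (-b) b, HasDerivAt e (z x) x := by
    intro x hx
    rcases lt_trichotomy x 0 with h | rfl | h
    · have hd := (h1 (-x) ⟨by linarith, by linarith [hx.1]⟩).scomp x (hasDerivAt_neg x)
      rw [(zneg x h).self_of_nhds]
      exact (hd.congr_of_eventuallyEq (eneg x h)).congr_deriv (by simp)
    · simpa [z] using e0
    · rw [(zpos x h).self_of_nhds]
      exact (h1 x ⟨h, hx.2⟩).congr_of_eventuallyEq (epos x h)
  refine ⟨contDiffAt_two_of_hasDerivAt (ζ := z) (r := c) hb hez ?_ ?_, hez⟩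
  · intro x hx
    rcases lt_trichotomy x 0 with h | rfl | h
    · have hd := ((h2 (-x) ⟨by linarith, by linarith [hx.1]⟩).scomp x (hasDerivAt_neg x)).neg
      rw [(cneg x h).self_of_nhds]
      exact (hd.congr_of_eventuallyEq (zneg x h)).congr_deriv (by simp)
    · simpa [c] using z0
    · rw [(cpos x h).self_of_nhds]
      exact (h2 x ⟨h, hx.2⟩).congr_of_eventuallyEq (zpos x h)
  · intro x hx
    refine ContinuousAt.continuousWithinAt ?_
    rcases lt_trichotomy x 0 with h | rfl | h
    · refine ContinuousAt.congr ?_ (cneg x h).symm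
      exact ContinuousAt.comp' (h3 (-x) ⟨by linarith, by linarith [hx.1]⟩)
        continuous_neg.continuousAt
    · rw [continuousAt_iff_punctured_nhds]
      simp only [c, if_true]
      refine (hr.comp habs).congr' ?_
      filter_upwards [self_mem_nhdsWithin] with y hy
      have hy0 : y ≠ 0 := hy
      simp only [Function.comp_apply, if_neg hy0]
    · exact (h3 x ⟨h, hx.2⟩).congr (cpos x h).symm

/-- Dividing by a function comparable to yⁿ costs n orders; this is applied with g = D₁ and n =
2k+1. -/
theorem isBigO_of_mul_div_tendsto {f g : ℝ → ℝ} {n m i : ℕ} (hn : n + m = i) (ha : a ≠ 0)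
    (hg : Tendsto (fun y => g y / y ^ n) (𝓝[>] 0) (𝓝 a))
    (h : (fun y => f y * g y) =O[𝓝[>] 0] (fun x : ℝ => x ^ i)) :
    f =O[𝓝[>] 0] (fun x : ℝ => x ^ m) := by
  have h1 := h.mul ((hg.inv₀ ha).isBigO_one ℝ)
  have h2 : (fun y : ℝ => y ^ n * f y) =O[𝓝[>] 0] (fun x : ℝ => x ^ (n + m)) := by
    subst hn
    refine h1.congr' ?_ (Eventually.of_forall fun x => mul_one _)
    filter_upwards [self_mem_nhdsWithin, hg.eventually_ne ha] with y hy hgy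
    have hy0 : y ≠ 0 := ne_of_gt hy
    have hg0 : g y ≠ 0 := fun h => by simp [h] at hgy
    field_simp
  obtain ⟨C, hC⟩ := h2.bound
  refine IsBigO.of_bound C ?_
  filter_upwards [hC, self_mem_nhdsWithin] with y hb hy
  have hpos : 0 < ‖y ^ n‖ := norm_pos_iff.2 (pow_ne_zero n (ne_of_gt hy))
  rw [norm_mul, pow_add, norm_mul] at hb
  refine le_of_mul_le_mul_left ?_ hpos
  linarith

end

section

open Polynomial

variable {J K : ℝ} {p : ℝ[X]} {k : ℕ} {a : ℝ} {η : ℝ → ℝ}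

/-! ### Existence of center manifolds -/

theorem isBigO_pow_of_le_right {m n : ℕ} (h : m ≤ n) :
    (fun x : ℝ => x ^ n) =O[𝓝[>] 0] (fun x : ℝ => x ^ m) :=
  (isBigO_pow_of_le h).mono nhdsWithin_le_nhds

theorem tendsto_zero_of_isBigO_pow {f : ℝ → ℝ} {n : ℕ} (hn : n ≠ 0)
    (h : f =O[𝓝[>] 0] (fun x : ℝ => x ^ n)) : Tendsto f (𝓝[>] 0) (𝓝 0) :=
  h.trans_tendsto (((continuous_pow n).tendsto' 0 0 (by simp [hn])).mono_left nhdsWithin_le_nhds)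

/-- Times D₁, the difference is D₂ - p'D₁ on the graph of η, that is, the defect of p plus (η - p)
times a bounded rate: O(x^{4k+3}). Division by D₁ leaves 2k+2. -/
theorem slope_sub_isBigO (hK : K = Real.exp (-2 * J)) (hp : X ^ 2 ∣ p) (ha : a ≠ 0)
    (hdef : invarianceDefect J K p =O[𝓝 0] (fun x : ℝ => x ^ (4 * k + 4)))
    (hω : (fun y => η y - p.eval y) =O[𝓝[>] 0] (fun x : ℝ => x ^ (4 * k + 3)))
    (hne : ∀ᶠ y in 𝓝[>] 0, D₁ 0 0 J K y (sStar K + η y) ≠ 0)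
    (hD : Tendsto (fun y => D₁ 0 0 J K y (sStar K + η y) / y ^ (2 * k + 1)) (𝓝[>] 0) (𝓝 a)) :
    (fun y => D₂ 0 0 J K y (sStar K + η y) / D₁ 0 0 J K y (sStar K + η y) - p.derivative.eval y)
      =O[𝓝[>] 0] (fun x : ℝ => x ^ (2 * k + 2)) := by
  refine isBigO_of_mul_div_tendsto (n := 2 * k + 1) (i := 4 * k + 3) (by ring) ha hD ?_
  have hpair : Tendsto (fun y => (y, η y - p.eval y)) (𝓝[>] 0) (𝓝 ((0 : ℝ), (0 : ℝ))) :=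
    (tendsto_id.mono_left nhdsWithin_le_nhds).prodMk_nhds
      (tendsto_zero_of_isBigO_pow (by omega) hω)
  have hrate : (fun y => fastRate J K y (sStar K + p.eval y) (η y - p.eval y)
      (p.derivative.eval y)) =O[𝓝[>] 0] (fun _ => (1 : ℝ)) := by
    have h1 := ((fastRate_sub_isBigO hK hp).comp_tendsto hpair).trans
      (hpair.isBigO_one ℝ)
    refine (h1.add (isBigO_const_const (4 * K / (1 + K ^ 2)) one_ne_zero _)).congr_left fun y => ?_
    exact sub_add_cancel _ _
  have h2 := ((hdef.mono nhdsWithin_le_nhds).trans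
    (isBigO_pow_of_le_right (by omega : 4 * k + 3 ≤ 4 * k + 4))).add
      ((hω.mul hrate).congr_right fun x => mul_one _)
  refine h2.congr' ?_ EventuallyEq.rfl
  filter_upwards [hne] with y hy
  have h3 := D₂_sub_mul_D₁_add J K y (sStar K + p.eval y) (η y - p.eval y) (p.derivative.eval y)
  rw [show sStar K + p.eval y + (η y - p.eval y) = sStar K + η y by ring] at h3
  rw [sub_mul (D₂ 0 0 J K y (sStar K + η y) / D₁ 0 0 J K y (sStar K + η y)),
    div_mul_cancel₀ _ hy, h3, invarianceDefect]

/-- After multiplication by D₁, the difference from p'' splits into the change of `slopeForm`, the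
differentiated defect of p, and the change of D₁. Each is O(x^{2k+2}), so division by D₁ leaves
O(x). -/
theorem tendsto_slope_deriv (hp : X ^ 2 ∣ p) (ha : a ≠ 0) {ζ : ℝ → ℝ}
    (hdef : invarianceDefect J K p =O[𝓝 0] (fun x : ℝ => x ^ (4 * k + 4)))
    (hω : (fun y => η y - p.eval y) =O[𝓝[>] 0] (fun x : ℝ => x ^ (4 * k + 3)))
    (hζ : (fun y => ζ y - p.derivative.eval y) =O[𝓝[>] 0] (fun x : ℝ => x ^ (2 * k + 2)))
    (hne : ∀ᶠ y in 𝓝[>] 0, D₁ 0 0 J K y (sStar K + η y) ≠ 0)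
    (hD : Tendsto (fun y => D₁ 0 0 J K y (sStar K + η y) / y ^ (2 * k + 1)) (𝓝[>] 0) (𝓝 a)) :
    Tendsto (fun y => slopeForm J K (y, sStar K + η y, ζ y) / D₁ 0 0 J K y (sStar K + η y))
      (𝓝[>] 0) (𝓝 (p.derivative.derivative.eval 0)) := by
  have hcont : ∀ q : ℝ[X], Tendsto (fun y => q.eval y) (𝓝[>] 0) (𝓝 (q.eval 0)) := fun q =>
    (q.continuous.tendsto 0).mono_left nhdsWithin_le_nhds
  have hp0 : Tendsto (fun y => p.eval y) (𝓝[>] 0) (𝓝 0) := by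
    simpa [eval_zero_of_sq_dvd hp] using hcont p
  have hp1 : Tendsto (fun y => p.derivative.eval y) (𝓝[>] 0) (𝓝 0) :=
    tendsto_zero_of_isBigO_pow one_ne_zero
      (by simpa using (isBigO_eval_derivative_of_dvd hp).mono nhdsWithin_le_nhds)
  have hω0 := tendsto_zero_of_isBigO_pow (by omega) hω
  have hζ0 := tendsto_zero_of_isBigO_pow (by omega) hζ
  have hid : Tendsto (fun y : ℝ => y) (𝓝[>] 0) (𝓝 0) := tendsto_id.mono_left nhdsWithin_le_nhds
  have hu : Tendsto (fun y => (y, sStar K + η y, ζ y)) (𝓝[>] 0) (𝓝 (0, sStar K, 0)) := by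
    refine hid.prodMk_nhds (Tendsto.prodMk_nhds ?_ ?_)
    · simpa using ((hω0.add hp0).const_add (sStar K))
    · simpa using hζ0.add hp1
  have hv : Tendsto (fun y => (y, sStar K + p.eval y, p.derivative.eval y)) (𝓝[>] 0)
      (𝓝 (0, sStar K, 0)) :=
    hid.prodMk_nhds (Tendsto.prodMk_nhds (by simpa using hp0.const_add (sStar K)) hp1)
  have e1 : (fun y => slopeForm J K (y, sStar K + η y, ζ y)
      - slopeForm J K (y, sStar K + p.eval y, p.derivative.eval y))
      =O[𝓝[>] 0] (fun x : ℝ => x ^ (2 * k + 2)) := by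
    refine (slopeForm_sub_isBigO J K hu hv).trans ?_
    simp only [Prod.mk_sub_mk, sub_self, add_sub_add_left_eq_sub]
    exact (isBigO_zero _ _).prod_left
      ((hω.trans (isBigO_pow_of_le_right (by omega))).prod_left hζ)
  have e2 : (fun y => slopeForm J K (y, sStar K + p.eval y, p.derivative.eval y)
      - p.derivative.derivative.eval y * D₁ 0 0 J K y (sStar K + p.eval y))
      =O[𝓝[>] 0] (fun x : ℝ => x ^ (2 * k + 2)) :=
    ((slopeForm_eval_isBigO hdef).mono nhdsWithin_le_nhds).trans
      (isBigO_pow_of_le_right (by omega))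
  have e3 : (fun y => p.derivative.derivative.eval y * (D₁ 0 0 J K y (sStar K + η y)
      - D₁ 0 0 J K y (sStar K + p.eval y))) =O[𝓝[>] 0] (fun x : ℝ => x ^ (2 * k + 2)) := by
    have h1 := (slow_increment_isBigO J K p).comp_tendsto (hid.prodMk_nhds hω0)
    have h2 : (fun y => (1 + (2 * (sStar K + p.eval y) + (η y - p.eval y)) / (y ^ 2 - 1))
        * slowCoeff J K y) =O[𝓝[>] 0] (fun _ => (1 : ℝ)) := h1.trans (hid.isBigO_one ℝ)
    have h3 := ((hcont p.derivative.derivative).isBigO_one ℝ).mul (hω.mul h2)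
    simp only [one_mul, mul_one] at h3
    refine (h3.congr_left fun y => ?_).trans (isBigO_pow_of_le_right (by omega))
    have h4 := D₁_add J K y (sStar K + p.eval y) (η y - p.eval y)
    rw [show sStar K + p.eval y + (η y - p.eval y) = sStar K + η y by ring] at h4
    rw [h4]
    ring
  have e4 := isBigO_of_mul_div_tendsto (n := 2 * k + 1) (m := 1) (i := 2 * k + 2)
    (f := fun y => slopeForm J K (y, sStar K + η y, ζ y) / D₁ 0 0 J K y (sStar K + η y)
      - p.derivative.derivative.eval y) rfl ha hD (by
    refine ((e1.add e2).sub e3).congr' ?_ EventuallyEq.rfl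
    filter_upwards [hne] with y hy
    rw [sub_mul, div_mul_cancel₀ _ hy]
    ring)
  simpa using (tendsto_zero_of_isBigO_pow one_ne_zero e4).add (hcont p.derivative.derivative)

theorem hasDerivAt_slope {y : ℝ} (hy : |y| < 1) (hne : D₁ 0 0 J K y (sStar K + η y) ≠ 0)
    (hη : HasDerivAt η (D₂ 0 0 J K y (sStar K + η y) / D₁ 0 0 J K y (sStar K + η y)) y) :
    HasDerivAt (fun y => D₂ 0 0 J K y (sStar K + η y) / D₁ 0 0 J K y (sStar K + η y))
      (slopeForm J K (y, sStar K + η y,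
          D₂ 0 0 J K y (sStar K + η y) / D₁ 0 0 J K y (sStar K + η y))
        / D₁ 0 0 J K y (sStar K + η y)) y := by
  refine ((hasDerivAt_D₂_comp hy hη).div (hasDerivAt_D₁_comp hy hη) hne).congr_deriv ?_
  simp only [slopeForm]
  field_simp

theorem exists_isCenterManifold (hK : K = Real.exp (-2 * J)) (h3 : K ^ 2 ≤ 3) :
    ∃ η : ℝ → ℝ, IsCenterManifold J K η := by
  obtain ⟨k, a, hk, ha, hslow⟩ := exists_slow_expansion hK h3
  -- The defect is then O(x^{4k+4}), so η - p is of order 4k+3; two losses of 2k+1 leave order 1,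
  -- enough for a limit of the second derivative.
  obtain ⟨p, hp, hdef⟩ := exists_polynomial_invarianceDefect_isBigO hK (4 * k + 2)
  obtain ⟨b₀, η, hb₀, hη₀, hlim, hD⟩ := exists_half_manifold (N := 4 * k + 4) hK hp hk (by omega) ha
    hdef (hslow p hp (hdef.trans (isBigO_pow_of_le (by omega))))
  -- Staying below 1 keeps the denominator x² - 1 of the drift away from zero.
  set b := min b₀ 1 with hb_def
  have hb : 0 < b := lt_min hb₀ one_pos
  have hη : ∀ y ∈ Set.Ioo 0 b, D₁ 0 0 J K y (sStar K + η y) ≠ 0 ∧ HasDerivAt η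
      (D₂ 0 0 J K y (sStar K + η y) / D₁ 0 0 J K y (sStar K + η y)) y := fun y hy =>
    hη₀ y ⟨hy.1, hy.2.trans_le (min_le_left _ _)⟩
  have hlt : ∀ y ∈ Set.Ioo 0 b, |y| < 1 := fun y hy => by
    rw [abs_of_pos hy.1]; exact hy.2.trans_le (min_le_right _ _)
  have hne : ∀ᶠ y in 𝓝[>] 0, D₁ 0 0 J K y (sStar K + η y) ≠ 0 := by
    filter_upwards [Ioo_mem_nhdsGT hb] with y hy using (hη y hy).1
  have hω : (fun y => η y - p.eval y) =O[𝓝[>] 0] (fun x : ℝ => x ^ (4 * k + 3)) := by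
    refine (isLittleO_of_tendsto' ?_ hlim).isBigO
    filter_upwards [self_mem_nhdsWithin] with y hy h
    exact absurd h (pow_ne_zero _ (ne_of_gt hy))
  set ζ : ℝ → ℝ := fun y => D₂ 0 0 J K y (sStar K + η y) / D₁ 0 0 J K y (sStar K + η y)
  set r : ℝ → ℝ := fun y => slopeForm J K (y, sStar K + η y, ζ y) / D₁ 0 0 J K y (sStar K + η y)
  have hζ := slope_sub_isBigO hK hp ha.ne' hdef hω hne hD
  have hr := tendsto_slope_deriv hp ha.ne' hdef hω hζ hne hD
  have hd : ∀ y ∈ Set.Ioo 0 b, HasDerivAt ζ (r y) y := fun y hy =>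
    hasDerivAt_slope (hlt y hy) (hη y hy).1 (hη y hy).2
  have hrc : ∀ y ∈ Set.Ioo 0 b, ContinuousAt r y := by
    intro y hy
    refine ContinuousAt.div ?_ (hasDerivAt_D₁_comp (hlt y hy) (hη y hy).2).continuousAt (hη y hy).1
    exact ContinuousAt.comp (f := fun y => (y, sStar K + η y, ζ y)) (g := slopeForm J K)
      (contDiffAt_slopeForm J K (hlt y hy)).continuousAt
      (continuousAt_id.prodMk ((continuousAt_const.add (hη y hy).2.continuousAt).prodMk
        (hd y hy).continuousAt))
  have hη2 : η =O[𝓝[>] 0] (fun x : ℝ => x ^ 2) := by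
    simpa using (hω.trans (isBigO_pow_of_le_right (by omega))).add
      ((isBigO_eval_of_dvd hp).mono nhdsWithin_le_nhds)
  have hζ2 : (fun y => ζ y - p.derivative.derivative.eval 0 * y) =O[𝓝[>] 0]
      (fun x : ℝ => x ^ 2) := by
    have hdvd : X ^ 2 ∣ p.derivative - C (p.derivative.derivative.eval 0) * X := by
      have hp0 : p.derivative.coeff 0 = 0 := by
        obtain ⟨q, rfl⟩ := hp
        simp [coeff_zero_eq_eval_zero]
      rw [X_pow_dvd_iff]
      intro d hd
      interval_cases d
      · simpa using hp0
      · rw [coeff_sub, coeff_C_mul, coeff_X_one, ← coeff_zero_eq_eval_zero,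
          coeff_derivative (derivative p) 0]
        simp
    have h1 : (fun y => p.derivative.eval y - p.derivative.derivative.eval 0 * y) =O[𝓝 0]
        (fun x : ℝ => x ^ 2) := by simpa using isBigO_eval_of_dvd hdvd
    simpa using (hζ.trans (isBigO_pow_of_le_right (by omega))).add (h1.mono nhdsWithin_le_nhds)
  obtain ⟨hC, hder⟩ := contDiffAt_two_even_extension hb (fun y hy => (hη y hy).2) hd hrc hη2 hζ2 hr
  refine ⟨_, hC, by simp, by simpa using (hder 0 ⟨by linarith, hb⟩).deriv, ?_⟩
  filter_upwards [Ioo_mem_nhds (neg_lt_zero.2 hb) hb] with x hx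
  rw [(hder x hx).deriv, drift_apply]
  rcases lt_trichotomy x 0 with h | rfl | h
  · have h1 := (hη (-x) ⟨by linarith, by linarith [hx.1]⟩).1
    simp only [if_neg h.ne, abs_of_neg h, sign_neg h, SignType.coe_neg, SignType.coe_one]
    rw [D₁_neg] at h1
    rw [D₁_neg, D₂_neg]
    have h2 := neg_ne_zero.1 h1
    field_simp
  · simp [D₁_zero_left, D₂_fixedPoint hK]
  · have h1 := (hη x ⟨h, hx.2⟩).1
    simp only [if_neg h.ne', abs_of_pos h, sign_pos h, SignType.coe_one]
    field_simp

end

section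

/-! ### Equilibrium magnetizations -/

section Statics

variable {J K κ m u : ℝ}

/-- The magnetization produced by the mean field `κ * m`. -/
noncomputable def meanFieldResponse (K κ m : ℝ) : ℝ :=
  Real.sinh (κ * m) / √(Real.sinh (κ * m) ^ 2 + K ^ 2)

theorem exp_neg_four_mul (hK : K = Real.exp (-2 * J)) : Real.exp (-4 * J) = K ^ 2 := by
  rw [hK, ← Real.exp_nat_mul]; congr 1; push_cast; ring

theorem hasDerivAt_freeEnergy (hK : K = Real.exp (-2 * J)) (κ m : ℝ) :
    HasDerivAt (freeEnergy 0 J κ) (κ * (m - meanFieldResponse K κ m)) m := by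
  have hpos : 0 < K := hK ▸ Real.exp_pos _
  have hu : HasDerivAt (fun m : ℝ => κ * m + 0) κ m := by
    simpa using (hasDerivAt_id' m).const_mul κ
  have hin : 0 < Real.sinh (κ * m + 0) ^ 2 + Real.exp (-4 * J) := by positivity
  have hs := Real.sqrt_pos.2 hin
  have hc := Real.cosh_pos (κ * m + 0)
  have h1 := ((hu.sinh.fun_pow 2).add_const (Real.exp (-4 * J))).sqrt hin.ne'
  have h2 := (hu.cosh.fun_add h1).log (by positivity)
  have h3 := ((((hasDerivAt_id' m).fun_pow 2).const_mul (κ / 2)).sub_const J).fun_sub h2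
  refine h3.congr_deriv ?_
  rw [meanFieldResponse]
  simp only [add_zero, exp_neg_four_mul hK] at *
  field_simp
  ring

theorem hasDerivAt_meanFieldResponse_zero (hK : 0 < K) (κ : ℝ) :
    HasDerivAt (meanFieldResponse K κ) (κ / K) 0 := by
  have hu : HasDerivAt (fun m : ℝ => κ * m) κ 0 := by
    simpa using (hasDerivAt_id' (0 : ℝ)).const_mul κ
  have hin : Real.sinh (κ * 0) ^ 2 + K ^ 2 ≠ 0 := by positivity
  have h1 := ((hu.sinh.fun_pow 2).add_const (K ^ 2)).sqrt hin
  refine (hu.sinh.fun_div h1 (by positivity)).congr_deriv ?_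
  simp [Real.sqrt_sq hK.le]
  field_simp

theorem iteratedDeriv_two_freeEnergy (hK : K = Real.exp (-2 * J)) (κ : ℝ) :
    iteratedDeriv 2 (freeEnergy 0 J κ) 0 = κ * (1 - κ / K) := by
  have hpos : 0 < K := hK ▸ Real.exp_pos _
  rw [iteratedDeriv_succ, iteratedDeriv_one,
    show deriv (freeEnergy 0 J κ) = fun m => κ * (m - meanFieldResponse K κ m) from
      funext fun m => (hasDerivAt_freeEnergy hK κ m).deriv]
  exact (((hasDerivAt_id' 0).fun_sub (hasDerivAt_meanFieldResponse_zero hpos κ)).const_mul κ).deriv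

theorem abs_meanFieldResponse_le_one (K κ m : ℝ) : |meanFieldResponse K κ m| ≤ 1 := by
  rw [meanFieldResponse, abs_div, abs_of_nonneg (Real.sqrt_nonneg _)]
  refine div_le_one_of_le₀ (Real.le_sqrt_of_sq_le ?_) (Real.sqrt_nonneg _)
  rw [sq_abs]
  exact le_add_of_nonneg_right (sq_nonneg K)

theorem freeEnergy_neg (J κ m : ℝ) : freeEnergy 0 J κ (-m) = freeEnergy 0 J κ m := by
  simp [freeEnergy]

/-- The response is bounded by 1, so the free energy increases beyond m = 1; with evenness, a
minimizer over [-1, 1] is global. -/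
theorem exists_isEquilibriumMagnetization (hK : K = Real.exp (-2 * J)) (hκ : 0 ≤ κ) :
    ∃ m, IsEquilibriumMagnetization 0 J κ m := by
  have hd := hasDerivAt_freeEnergy hK κ
  have hc : Continuous (freeEnergy 0 J κ) :=
    continuous_iff_continuousAt.2 fun m => (hd m).continuousAt
  obtain ⟨m, -, hm⟩ := isCompact_Icc.exists_isMinOn (α := ℝ) (s := Set.Icc (-1 : ℝ) 1)
    ⟨0, by norm_num⟩ hc.continuousOn
  have hmono : MonotoneOn (freeEnergy 0 J κ) (Set.Ici 1) := by
    refine monotoneOn_of_hasDerivWithinAt_nonneg (convex_Ici 1) hc.continuousOn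
      (fun x _ => (hd x).hasDerivWithinAt) fun x hx => ?_
    rw [interior_Ici] at hx
    have := (abs_le.1 (abs_meanFieldResponse_le_one K κ x)).2
    exact mul_nonneg hκ (by linarith [hx.out])
  refine ⟨m, fun x _ => ?_⟩
  have habs : freeEnergy 0 J κ x = freeEnergy 0 J κ |x| := by
    rcases abs_choice x with h | h <;> rw [h]
    rw [freeEnergy_neg]
  rcases le_or_gt |x| 1 with h | h
  · exact hm (abs_le.1 h)
  · show freeEnergy 0 J κ m ≤ freeEnergy 0 J κ x
    rw [habs]
    exact (hm ⟨by norm_num, le_rfl⟩ : freeEnergy 0 J κ m ≤ freeEnergy 0 J κ 1).trans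
      (hmono Set.self_mem_Ici h.le h.le)

theorem IsEquilibriumMagnetization.eq_meanFieldResponse (hK : K = Real.exp (-2 * J)) (hκ : κ ≠ 0)
    (h : IsEquilibriumMagnetization 0 J κ m) : m = meanFieldResponse K κ m := by
  have h1 := (h.isLocalMin univ_mem).hasDerivAt_eq_zero (hasDerivAt_freeEnergy hK κ m)
  exact sub_eq_zero.1 ((mul_eq_zero.1 h1).resolve_left hκ)

/-- For κ > K the response has slope κ/K > 1 at 0, hence the free energy decreases strictly to the
right of 0. -/
theorem IsEquilibriumMagnetization.ne_zero (hK : K = Real.exp (-2 * J)) (hκ : K < κ)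
    (h : IsEquilibriumMagnetization 0 J κ m) : m ≠ 0 := by
  rintro rfl
  have hpos : 0 < K := hK ▸ Real.exp_pos _
  have hd := hasDerivAt_freeEnergy hK κ
  have h1 := (hasDerivAt_meanFieldResponse_zero hpos κ).tendsto_slope_zero_right
  have h2 : ∀ᶠ x in 𝓝[>] 0, x < meanFieldResponse K κ x := by
    filter_upwards [h1.eventually (lt_mem_nhds ((one_lt_div hpos).2 hκ)), self_mem_nhdsWithin]
      with x hx hx0
    have hx0 : 0 < x := hx0
    simp only [zero_add, meanFieldResponse, mul_zero, Real.sinh_zero, zero_div, sub_zero,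
      smul_eq_mul, lt_inv_mul_iff₀ hx0, mul_one] at hx ⊢
    exact hx
  obtain ⟨δ, hδ, hsub⟩ := mem_nhdsGT_iff_exists_Ioo_subset.1 h2
  have hδ : 0 < δ := hδ
  obtain ⟨c, hc, hce⟩ := exists_hasDerivAt_eq_slope (freeEnergy 0 J κ) _ hδ
    (fun x _ => (hd x).continuousAt.continuousWithinAt) fun x _ => hd x
  have hle : freeEnergy 0 J κ 0 ≤ freeEnergy 0 J κ δ := h (Set.mem_univ δ)
  have h3 : c < meanFieldResponse K κ c := hsub hc
  have h4 : 0 ≤ (freeEnergy 0 J κ δ - freeEnergy 0 J κ 0) / (δ - 0) :=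
    div_nonneg (by linarith) (by linarith)
  rw [← hce] at h4
  nlinarith

theorem IsEquilibriumMagnetization.abs_le_one (hK : K = Real.exp (-2 * J)) (hκ : κ ≠ 0)
    (h : IsEquilibriumMagnetization 0 J κ m) : |m| ≤ 1 := by
  rw [h.eq_meanFieldResponse hK hκ]
  exact abs_meanFieldResponse_le_one K κ m

/-- The stationarity equation squared and cleared of its denominator; the distance to criticality is
isolated on the left. -/
theorem IsEquilibriumMagnetization.sq_sub_sq_mul (hK : K = Real.exp (-2 * J)) (hκ : κ ≠ 0)
    (h : IsEquilibriumMagnetization 0 J κ m) :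
    (κ ^ 2 - K ^ 2) * Real.sinh (κ * m) ^ 2
      = (κ * m) ^ 2 * Real.sinh (κ * m) ^ 2
        - K ^ 2 * (Real.sinh (κ * m) ^ 2 - (κ * m) ^ 2) := by
  have hpos : 0 < K := hK ▸ Real.exp_pos _
  have h1 := congrArg (· ^ 2) (h.eq_meanFieldResponse hK hκ)
  simp only [meanFieldResponse, div_pow,
    Real.sq_sqrt (by positivity : 0 ≤ Real.sinh (κ * m) ^ 2 + K ^ 2)] at h1
  rw [eq_div_iff (by positivity)] at h1
  linear_combination (-κ ^ 2) * h1

theorem sinh_sq_eq (u : ℝ) : Real.sinh u ^ 2 = (Real.cosh (2 * u) - 1) / 2 := by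
  rw [Real.cosh_two_mul, Real.cosh_sq]; ring

theorem nonneg_of_hasDerivAt_nonneg {f f' : ℝ → ℝ} (h0 : f 0 = 0)
    (h : ∀ x, HasDerivAt f (f' x) x) (h' : ∀ x, 0 ≤ x → 0 ≤ f' x) {x : ℝ} (hx : 0 ≤ x) :
    0 ≤ f x := by
  have hm : MonotoneOn f (Set.Ici 0) := by
    refine monotoneOn_of_hasDerivWithinAt_nonneg (convex_Ici 0)
      (fun x _ => (h x).continuousAt.continuousWithinAt) (fun x _ => (h x).hasDerivWithinAt) ?_
    intro x hx
    rw [interior_Ici] at hx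
    exact h' x hx.out.le
  simpa [h0] using hm Set.self_mem_Ici hx hx

/-- The difference of the two sides and its first three derivatives vanish at 0; the fourth
derivative is nonnegative by sinh x ≥ x and cosh x ≥ 1. With v = 2u this is the inequality needed
for sinh²u. -/
theorem pow_six_div_le {v : ℝ} (hv : 0 ≤ v) :
    v ^ 6 / 40 ≤ 5 * v ^ 2 + 12 + (v ^ 2 - 12) * Real.cosh v := by
  have hid := fun x : ℝ => hasDerivAt_id' x
  have hs := Real.hasDerivAt_sinh
  have hc := Real.hasDerivAt_cosh
  have hp := fun (n : ℕ) (x : ℝ) => hasDerivAt_pow n x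
  have h4 : ∀ x : ℝ, 0 ≤ x → 0 ≤ 8 * x * Real.sinh x + x ^ 2 * Real.cosh x - 9 * x ^ 2 := by
    intro x hx
    nlinarith [mul_nonneg hx (sub_nonneg.2 (Real.self_le_sinh_iff.2 hx)),
      mul_nonneg (sq_nonneg x) (sub_nonneg.2 (Real.one_le_cosh x))]
  have h3 : ∀ x : ℝ, 0 ≤ x →
      0 ≤ -6 * Real.sinh x + 6 * x * Real.cosh x + x ^ 2 * Real.sinh x - 3 * x ^ 3 := fun x =>
    nonneg_of_hasDerivAt_nonneg (by simp) (fun x =>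
      ((((hs x).const_mul (-6)).fun_add (((hid x).const_mul 6).fun_mul (hc x))).fun_add
        ((hp 2 x).fun_mul (hs x))).fun_sub ((hp 3 x).const_mul 3) |>.congr_deriv (by
          push_cast; ring)) h4
  have h2 : ∀ x : ℝ, 0 ≤ x → 0 ≤ 10 - 10 * Real.cosh x + 4 * x * Real.sinh x
      + x ^ 2 * Real.cosh x - 3 / 4 * x ^ 4 := fun x =>
    nonneg_of_hasDerivAt_nonneg (by simp) (fun x =>
      (((((hc x).const_mul 10).const_sub 10).fun_add (((hid x).const_mul 4).fun_mul (hs x))).fun_add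
        ((hp 2 x).fun_mul (hc x))).fun_sub ((hp 4 x).const_mul (3 / 4)) |>.congr_deriv (by
          push_cast; ring)) h3
  have h1 : ∀ x : ℝ, 0 ≤ x → 0 ≤ 10 * x + 2 * x * Real.cosh x + (x ^ 2 - 12) * Real.sinh x
      - 3 / 20 * x ^ 5 := fun x =>
    nonneg_of_hasDerivAt_nonneg (by simp) (fun x =>
      ((((hid x).const_mul 10).fun_add (((hid x).const_mul 2).fun_mul (hc x))).fun_add
        (((hp 2 x).sub_const 12).fun_mul (hs x))).fun_sub ((hp 5 x).const_mul (3 / 20))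
          |>.congr_deriv (by push_cast; ring)) h2
  have h0 := nonneg_of_hasDerivAt_nonneg
    (f := fun x => 5 * x ^ 2 + 12 + (x ^ 2 - 12) * Real.cosh x - x ^ 6 / 40) (by simp) (fun x =>
      ((((hp 2 x).const_mul 5).add_const 12).fun_add
        (((hp 2 x).sub_const 12).fun_mul (hc x))).fun_sub ((hp 6 x).div_const 40)
          |>.congr_deriv (by push_cast; ring)) h1 hv
  linarith

theorem pow_six_div_five_le (u : ℝ) :
    u ^ 6 / 5 ≤ u ^ 2 * Real.sinh u ^ 2 - 3 * (Real.sinh u ^ 2 - u ^ 2) := by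
  have h1 := pow_six_div_le (v := 2 * |u|) (by positivity)
  have h2 : Real.cosh (2 * |u|) = Real.cosh (2 * u) := by
    rw [← Real.cosh_abs (2 * u), abs_mul, abs_two]
  have h3 : |u| ^ 6 = u ^ 6 := (by decide : Even 6).pow_abs u
  simp only [mul_pow, h2, sq_abs, h3] at h1
  rw [sinh_sq_eq]
  linarith

theorem sq_le_sinh_sq (u : ℝ) : u ^ 2 ≤ Real.sinh u ^ 2 := by
  rw [sq_le_sq, Real.abs_sinh]
  exact Real.self_le_sinh_iff.2 (abs_nonneg u)

/-- This excludes a jump of the order parameter: for K² ≤ 3, u⁶/5 is at most (κ²-K²) sinh²u, and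
sinh²u stays bounded because |m| ≤ 1. -/
theorem tendsto_mul_equilibrium (hK : K = Real.exp (-2 * J)) (h3 : K ^ 2 ≤ 3) {mEq : ℝ → ℝ}
    (h : ∀ᶠ κ in 𝓝[>] K, IsEquilibriumMagnetization 0 J κ (mEq κ)) :
    Tendsto (fun κ => κ * mEq κ) (𝓝[>] K) (𝓝[≠] 0) := by
  have hpos : 0 < K := hK ▸ Real.exp_pos _
  rw [tendsto_nhdsWithin_iff]
  constructor
  · have hlim : Tendsto (fun κ => 5 * (Real.sinh (K + 1) ^ 2) * (κ ^ 2 - K ^ 2)) (𝓝[>] K) (𝓝 0) :=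
      ((by fun_prop : Continuous fun κ : ℝ => 5 * (Real.sinh (K + 1) ^ 2) * (κ ^ 2 - K ^ 2)).tendsto'
        K 0 (by simp)).mono_left nhdsWithin_le_nhds
    have h6 : Tendsto (fun κ => (κ * mEq κ) ^ 6) (𝓝[>] K) (𝓝 0) := by
      refine squeeze_zero' (Eventually.of_forall fun κ => by positivity) ?_ hlim
      filter_upwards [h, Ioo_mem_nhdsGT (lt_add_one K)] with κ hm hκ
      have hκ0 : 0 < κ := hpos.trans hκ.1
      have e1 := hm.sq_sub_sq_mul hK hκ0.ne'
      have e2 := pow_six_div_five_le (κ * mEq κ)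
      have e3 := mul_nonneg (sub_nonneg.2 h3) (sub_nonneg.2 (sq_le_sinh_sq (κ * mEq κ)))
      have e4 : Real.sinh (κ * mEq κ) ^ 2 ≤ Real.sinh (K + 1) ^ 2 := by
        rw [← sq_abs, Real.abs_sinh]
        refine pow_le_pow_left₀ (Real.sinh_nonneg_iff.2 (abs_nonneg _)) (Real.sinh_le_sinh.2 ?_) 2
        rw [abs_mul, abs_of_pos hκ0]
        nlinarith [hm.abs_le_one hK hκ0.ne', hκ.2]
      have e5 : 0 ≤ κ ^ 2 - K ^ 2 := by nlinarith [hκ.1]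
      nlinarith [mul_le_mul_of_nonneg_left e4 e5]
    have h7 := (h6.rpow_const (p := (1 / 6 : ℝ)) (Or.inr (by norm_num)))
    rw [Real.zero_rpow (by norm_num)] at h7
    refine (tendsto_zero_iff_abs_tendsto_zero _).2 (h7.congr fun κ => ?_)
    rw [← (by decide : Even 6).pow_abs (κ * mEq κ), ← Real.rpow_natCast,
      ← Real.rpow_mul (abs_nonneg _)]
    norm_num
  · filter_upwards [h, self_mem_nhdsWithin] with κ hm hκ
    exact mul_ne_zero (hpos.trans hκ).ne' (hm.ne_zero hK hκ)

end Statics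

end

section

/-! ### Static exponents -/

section StaticExponents

variable {J K : ℝ}

/-- sinh²u = (cosh 2u - 1)/2, and in the sum of the Taylor polynomials of exp at 2u and -2u the odd
terms cancel. -/
theorem sinh_sq_isBigO :
    (fun u : ℝ => Real.sinh u ^ 2 - (u ^ 2 + u ^ 4 / 3 + 2 * u ^ 6 / 45)) =O[𝓝 0]
      (fun u : ℝ => u ^ 8) := by
  have h := Real.exp_sub_sum_range_isBigO_pow 8
  have h1 := h.comp_tendsto ((by fun_prop : Continuous fun u : ℝ => 2 * u).tendsto' 0 0 (by simp))
  have h2 := h.comp_tendsto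
    ((by fun_prop : Continuous fun u : ℝ => -(2 * u)).tendsto' 0 0 (by simp))
  have e1 : (fun u : ℝ => (2 * u) ^ 8) =O[𝓝 0] (fun u : ℝ => u ^ 8) := by
    simpa only [mul_pow] using isBigO_const_mul_self ((2 : ℝ) ^ 8) _ _
  have e2 : (fun u : ℝ => (-(2 * u)) ^ 8) =O[𝓝 0] (fun u : ℝ => u ^ 8) := by
    simpa only [(by decide : Even 8).neg_pow] using e1
  refine (((h1.trans e1).add (h2.trans e2)).const_mul_left (1 / 4)).congr_left fun u => ?_
  simp only [Function.comp_apply, sinh_sq_eq, Real.cosh_eq, Finset.sum_range_succ,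
    Finset.sum_range_zero, Nat.factorial]
  push_cast
  ring

theorem tendsto_div_of_sub_isBigO {f : ℝ → ℝ} {c : ℝ} {n m : ℕ} (hnm : n < m)
    (h : (fun u => f u - c * u ^ n) =O[𝓝[≠] 0] (fun u : ℝ => u ^ m)) :
    Tendsto (fun u => f u / u ^ n) (𝓝[≠] 0) (𝓝 c) := by
  have h1 := (h.trans_isLittleO
    ((isLittleO_pow_pow hnm).mono nhdsWithin_le_nhds)).tendsto_div_nhds_zero
  refine (by simpa using h1.add_const c : Tendsto _ _ (𝓝 c)).congr' ?_
  filter_upwards [self_mem_nhdsWithin] with u hu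
  have hu : u ^ n ≠ 0 := pow_ne_zero _ hu
  field_simp
  ring

theorem tendsto_sinh_sq_div : Tendsto (fun u => Real.sinh u ^ 2 / u ^ 2) (𝓝[≠] 0) (𝓝 1) := by
  refine tendsto_div_of_sub_isBigO (m := 4) (by norm_num) ?_
  have h := (sinh_sq_isBigO.trans (isBigO_pow_of_le (by norm_num : 4 ≤ 8))).add
    (((isBigO_refl (fun u : ℝ => u ^ 4) _).const_mul_left (1 / 3)).add
      ((isBigO_pow_of_le (by norm_num : 4 ≤ 6)).const_mul_left (2 / 45)))
  exact (h.congr_left fun u => by ring).mono nhdsWithin_le_nhds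

/-- Dividing the squared equation by sinh²u ~ u² gives (κ²-K²)/u^{2j} → ℓ; since κ²-K² ~ 2K(κ-K) and
u ~ Km, m^{2j}/(κ-K) tends to 2K/(K^{2j}ℓ). -/
theorem isMagnetizationExponent_of_tendsto (hK : K = Real.exp (-2 * J)) (h3 : K ^ 2 ≤ 3) {j : ℕ}
    (hj : j ≠ 0) {ℓ : ℝ} (hℓ : 0 < ℓ)
    (h : Tendsto (fun u => (u ^ 2 * Real.sinh u ^ 2 - K ^ 2 * (Real.sinh u ^ 2 - u ^ 2))
      / u ^ (2 * j + 2)) (𝓝[≠] 0) (𝓝 ℓ)) :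
    IsMagnetizationExponent J K (1 / (2 * j)) := by
  have hpos : 0 < K := hK ▸ Real.exp_pos _
  have hj' : (0 : ℝ) < j := by positivity
  refine ⟨(2 * K / (K ^ (2 * j) * ℓ)) ^ (1 / (2 * j) : ℝ), by positivity, fun mEq hm => ?_⟩
  have hu := tendsto_mul_equilibrium hK h3 hm
  have hq : Tendsto (fun κ => (κ ^ 2 - K ^ 2) / (κ * mEq κ) ^ (2 * j)) (𝓝[>] K) (𝓝 ℓ) := by
    have h1 := (h.div tendsto_sinh_sq_div one_ne_zero).comp hu
    rw [div_one] at h1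
    refine h1.congr' ?_
    filter_upwards [hm, self_mem_nhdsWithin] with κ hmκ hκ
    have hκ0 : 0 < κ := hpos.trans hκ
    have hm0 := hmκ.ne_zero hK hκ
    have hs : Real.sinh (κ * mEq κ) ≠ 0 := Real.sinh_ne_zero.2 (mul_ne_zero hκ0.ne' hm0)
    simp only [Function.comp_apply, Pi.div_apply]
    rw [← hmκ.sq_sub_sq_mul hK hκ0.ne']
    field_simp
    ring
  have hid : Tendsto (fun κ : ℝ => κ) (𝓝[>] K) (𝓝 K) := tendsto_id.mono_left nhdsWithin_le_nhds
  have hm2 : Tendsto (fun κ => mEq κ ^ (2 * j) / (κ - K)) (𝓝[>] K)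
      (𝓝 (2 * K / (K ^ (2 * j) * ℓ))) := by
    have h1 := (hid.add_const K).div ((hid.pow (2 * j)).mul hq) (by positivity)
    rw [← two_mul] at h1
    refine h1.congr' ?_
    filter_upwards [hm, self_mem_nhdsWithin] with κ hmκ hκ
    have hκ' : K < κ := hκ
    have hκ0 : 0 < κ := hpos.trans hκ
    have hm0 := hmκ.ne_zero hK hκ
    have hd : κ - K ≠ 0 := (sub_pos.2 hκ').ne'
    have hd2 : κ + K ≠ 0 := by positivity
    simp only [Pi.div_apply]
    rw [show κ ^ 2 - K ^ 2 = (κ - K) * (κ + K) by ring, mul_pow]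
    field_simp
  refine (hm2.rpow_const (p := 1 / (2 * j)) (Or.inr (by positivity))).congr' ?_
  filter_upwards [self_mem_nhdsWithin] with κ hκ
  have hd : 0 ≤ κ - K := (sub_pos.2 hκ).le
  rw [← (even_two_mul j).pow_abs, Real.div_rpow (by positivity) hd, ← Real.rpow_natCast,
    ← Real.rpow_mul (abs_nonneg _)]
  congr 1
  push_cast
  rw [mul_one_div_cancel (by positivity), Real.rpow_one]

theorem isMagnetizationExponent_half (hK : K = Real.exp (-2 * J)) (h3 : K ^ 2 < 3) :
    IsMagnetizationExponent J K (1 / 2) := by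
  have h := isMagnetizationExponent_of_tendsto hK h3.le one_ne_zero (ℓ := 1 - K ^ 2 / 3)
    (by linarith) (tendsto_div_of_sub_isBigO (m := 6) (by norm_num) (by
      have h1 := (sinh_sq_isBigO.mul (isBigO_refl (fun u : ℝ => u ^ 2 - K ^ 2) _)).trans
        (((isBigO_refl (fun u : ℝ => u ^ 8) _).mul (((by fun_prop : Continuous fun u : ℝ =>
          u ^ 2 - K ^ 2).tendsto 0).isBigO_one ℝ)).trans
            (by simpa using isBigO_pow_of_le (by norm_num : 6 ≤ 8)))
      have h2 := h1.add (((isBigO_refl (fun u : ℝ => u ^ 6) _).const_mul_left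
        (1 / 3 - 2 * K ^ 2 / 45)).add
          ((isBigO_pow_of_le (by norm_num : 6 ≤ 8)).const_mul_left (2 / 45)))
      exact (h2.congr_left fun u => by ring).mono nhdsWithin_le_nhds))
  simpa using h

theorem isMagnetizationExponent_quarter (hK : K = Real.exp (-2 * J)) (h3 : K ^ 2 = 3) :
    IsMagnetizationExponent J K (1 / 4) := by
  have h := isMagnetizationExponent_of_tendsto hK h3.le two_ne_zero (ℓ := 1 / 5)
    (by norm_num) (tendsto_div_of_sub_isBigO (m := 8) (by norm_num) (by
      have h1 := (sinh_sq_isBigO.mul (isBigO_refl (fun u : ℝ => u ^ 2 - 3) _)).trans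
        (((isBigO_refl (fun u : ℝ => u ^ 8) _).mul (((by fun_prop : Continuous fun u : ℝ =>
          u ^ 2 - 3).tendsto 0).isBigO_one ℝ)))
      simp only [mul_one] at h1
      have h2 := h1.add ((isBigO_refl (fun u : ℝ => u ^ 8) _).const_mul_left (2 / 45))
      rw [h3]
      exact (h2.congr_left fun u => by ring).mono nhdsWithin_le_nhds))
  convert h using 1
  norm_num

/-- From F''(0) = κ(K-κ)/K, the rescaled correlation length is √(K/κ), which tends to 1. -/
theorem isCorrelationExponent_half (hK : K = Real.exp (-2 * J)) :
    IsCorrelationExponent J K (1 / 2) := by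
  have hpos : 0 < K := hK ▸ Real.exp_pos _
  refine ⟨1, one_pos, ?_⟩
  have hid : Tendsto (fun κ : ℝ => κ) (𝓝[<] K) (𝓝 K) := tendsto_id.mono_left nhdsWithin_le_nhds
  have h1 := ((tendsto_const_nhds (x := K)).div hid hpos.ne').sqrt
  rw [div_self hpos.ne', Real.sqrt_one] at h1
  refine h1.congr' ?_
  filter_upwards [Ioo_mem_nhdsLT hpos] with κ hκ
  have hd : 0 < K - κ := sub_pos.2 hκ.2
  have hκ0 := hκ.1
  rw [correlationLength, iteratedDeriv_two_freeEnergy hK, ← Real.sqrt_eq_rpow, one_div_mul_eq_div,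
    ← Real.sqrt_div' _ (by rw [one_sub_div hpos.ne']; positivity)]
  congr 1
  simp only [Pi.div_apply]
  field_simp

end StaticExponents

/-! ### Uniqueness of the dynamical exponent -/

section Uniqueness

variable {J K : ℝ}

theorem eq_of_tendsto_mul_rpow_atTop {f : ℝ → ℝ} {a b A B : ℝ} (hA : A ≠ 0) (hB : B ≠ 0)
    (ha : Tendsto (fun t => f t * t ^ a) atTop (𝓝 A))
    (hb : Tendsto (fun t => f t * t ^ b) atTop (𝓝 B)) : a = b := by
  have key : ∀ {a b A B : ℝ}, A ≠ 0 → B ≠ 0 → Tendsto (fun t => f t * t ^ a) atTop (𝓝 A) →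
      Tendsto (fun t => f t * t ^ b) atTop (𝓝 B) → ¬ a < b := by
    intro a b A B hA hB ha hb hlt
    have h := hb.mul (tendsto_rpow_neg_atTop (sub_pos.2 hlt))
    rw [mul_zero] at h
    refine hA (tendsto_nhds_unique (ha.congr' ?_) h)
    filter_upwards [eventually_gt_atTop 0] with t ht
    rw [mul_assoc, ← Real.rpow_add ht]
    congr 2
    ring
  exact le_antisymm (not_lt.1 (key hB hA hb ha)) (not_lt.1 (key hA hB ha hb))

theorem IsRelaxationExponent.unique {a b : ℝ} (ha : IsRelaxationExponent J K a)
    (hb : IsRelaxationExponent J K b) : a = b := by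
  obtain ⟨A, hA, r₁, hr₁, h₁⟩ := ha
  obtain ⟨B, hB, r₂, hr₂, h₂⟩ := hb
  set m := min r₁ r₂ / 2
  have hm : 0 < m := half_pos (lt_min hr₁ hr₂)
  have hm₁ : |m| < r₁ := by
    rw [abs_of_pos hm]; exact (half_lt_self (lt_min hr₁ hr₂)).trans_le (min_le_left _ _)
  have hm₂ : |m| < r₂ := by
    rw [abs_of_pos hm]; exact (half_lt_self (lt_min hr₁ hr₂)).trans_le (min_le_right _ _)
  obtain ⟨⟨X, hX, hX0⟩, hlim₁⟩ := h₁ m (sStar K) hm.ne' hm₁ (by simpa using hr₁)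
  have e₁ := (hlim₁ X hX hX0).2
  have e₂ := ((h₂ m (sStar K) hm.ne' hm₂ (by simpa using hr₂)).2 X hX hX0).2
  rw [Real.sign_of_pos hm, one_mul] at e₁ e₂
  exact eq_of_tendsto_mul_rpow_atTop hA.ne' hB.ne' e₁ e₂

/-- Existence of minimizers is essential here: without it the condition on all choices would be
vacuous. The substitution κ = K + 1/t reduces to decay at infinity. -/
theorem IsMagnetizationExponent.unique (hK : K = Real.exp (-2 * J)) {a b : ℝ}
    (ha : IsMagnetizationExponent J K a) (hb : IsMagnetizationExponent J K b) : a = b := by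
  have hpos : 0 < K := hK ▸ Real.exp_pos _
  obtain ⟨A, hA, h₁⟩ := ha
  obtain ⟨B, hB, h₂⟩ := hb
  choose! mEq hmEq using fun (κ : ℝ) (hκ : 0 ≤ κ) => exists_isEquilibriumMagnetization hK hκ
  have hm : ∀ᶠ κ in 𝓝[>] K, IsEquilibriumMagnetization 0 J κ (mEq κ) := by
    filter_upwards [self_mem_nhdsWithin] with κ hκ using hmEq κ (hpos.trans hκ).le
  have hlim : Tendsto (fun t : ℝ => K + t⁻¹) atTop (𝓝[>] K) := by
    rw [tendsto_nhdsWithin_iff]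
    refine ⟨by simpa using tendsto_inv_atTop_zero.const_add K, ?_⟩
    filter_upwards [eventually_gt_atTop 0] with t ht
    simpa using ht
  have key : ∀ {a A : ℝ}, Tendsto (fun κ : ℝ => |mEq κ| / (κ - K) ^ a) (𝓝[>] K) (𝓝 A) →
      Tendsto (fun t : ℝ => |mEq (K + t⁻¹)| * t ^ a) atTop (𝓝 A) := by
    intro a A h
    refine (h.comp hlim).congr' ?_
    filter_upwards [eventually_gt_atTop 0] with t ht
    simp [Real.inv_rpow ht.le]
  exact eq_of_tendsto_mul_rpow_atTop hA.ne' hB.ne' (key (h₁ mEq hm)) (key (h₂ mEq hm))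

theorem IsCorrelationExponent.unique {a b : ℝ} (ha : IsCorrelationExponent J K a)
    (hb : IsCorrelationExponent J K b) : a = b := by
  obtain ⟨A, hA, h₁⟩ := ha
  obtain ⟨B, hB, h₂⟩ := hb
  have hlim : Tendsto (fun t : ℝ => K - t⁻¹) atTop (𝓝[<] K) := by
    rw [tendsto_nhdsWithin_iff]
    refine ⟨by simpa using tendsto_inv_atTop_zero.const_sub K, ?_⟩
    filter_upwards [eventually_gt_atTop 0] with t ht
    simpa using ht
  have key : ∀ {a A : ℝ}, Tendsto (fun κ : ℝ => correlationLength J κ * (K - κ) ^ a) (𝓝[<] K)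
      (𝓝 A) → Tendsto (fun t : ℝ => correlationLength J (K - t⁻¹) * t ^ (-a)) atTop (𝓝 A) := by
    intro a A h
    refine (h.comp hlim).congr' ?_
    filter_upwards [eventually_gt_atTop 0] with t ht
    simp [Real.inv_rpow ht.le, Real.rpow_neg ht.le]
  exact neg_injective (eq_of_tendsto_mul_rpow_atTop hA.ne' hB.ne' (key h₁) (key h₂))

theorem isDynamicalExponent_iff (hK : K = Real.exp (-2 * J)) {a : ℝ} (ha : a ≠ 0)
    (h₁ : IsRelaxationExponent J K a) (h₂ : IsMagnetizationExponent J K a) (z : ℝ) :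
    IsDynamicalExponent J K z ↔ z = 2 := by
  have h₃ := isCorrelationExponent_half hK
  constructor
  · rintro ⟨a', b', n', ha', hb', hn', h⟩
    rw [ha'.unique h₁, hb'.unique hK h₂, hn'.unique h₃] at h
    -- With z = 0 the quotient takes the default value 0, which would force a = 0.
    have hz : z ≠ 0 := by
      rintro rfl
      exact ha (by simpa using h)
    field_simp at h
    linarith
  · rintro rfl
    exact ⟨a, a, 1 / 2, h₁, h₂, h₃, by norm_num⟩

end Uniqueness

/-! ### Relaxation on the line and at its end point -/

section Relaxation

variable {J K : ℝ}

theorem relaxesAs_critical (hK : K = Real.exp (-2 * J)) (h3 : K ^ 2 < 3) :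
    RelaxesAs J K (1 / 2) (√(3 * (1 + K ^ 2) / (2 * K ^ 2 * (3 - K ^ 2)))) := by
  have hpos : 0 < K := hK ▸ Real.exp_pos _
  have h3' : 0 < 3 - K ^ 2 := sub_pos.2 h3
  -- The index 2 gives a defect O(x⁴), the order 2k+2 for k = 1; the tricritical case needs index 4
  -- for k = 2.
  obtain ⟨p, hp, hdef⟩ := exists_polynomial_invarianceDefect_isBigO hK 2
  have h := relaxesAs_of_normalForm (k := 1) hK hp le_rfl (by positivity) hdef
    (slow_expansion_critical hK hp hdef)
  rw [Real.sqrt_eq_rpow]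
  convert h using 2
  · norm_num
  · push_cast
    field_simp
  · norm_num

theorem relaxesAs_tricritical (hK : K = Real.exp (-2 * J)) (h3 : K ^ 2 = 3) :
    RelaxesAs J K (1 / 4) ((5 / 9 : ℝ) ^ (1 / 4 : ℝ)) := by
  obtain ⟨p, hp, hdef⟩ := exists_polynomial_invarianceDefect_isBigO hK 4
  have h := relaxesAs_of_normalForm (k := 2) (a := 9 / 20) hK hp one_le_two (by norm_num) hdef
    (slow_expansion_tricritical hK h3 hp hdef)
  convert h using 2 <;> norm_num

end Relaxation

end

end NagleKardar

/-! ### Assembly of the theorem -/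

theorem mainTheorem1 (J K : ℝ) (hK : K = Real.exp (-2 * J)) :
    -- the fixed point and the linearised drift there
    (NagleKardar.drift J K (0, NagleKardar.sStar K) = (0, 0) ∧
      HasFDerivAt (NagleKardar.drift J K)
        ((0 : ℝ × ℝ →L[ℝ] ℝ).prod
          ((-(4 * K / (1 + K ^ 2))) • ContinuousLinearMap.snd ℝ ℝ ℝ))
        (0, NagleKardar.sStar K)) ∧
    -- center manifolds exist on the second-order line and at its end point
    (K ≤ √3 → ∃ η : ℝ → ℝ, NagleKardar.IsCenterManifold J K η) ∧
    -- every center manifold and its reduced equation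
    (∀ η : ℝ → ℝ, NagleKardar.IsCenterManifold J K η →
      (fun x : ℝ => η x - (-(K / 2) * x ^ 2)) =O[𝓝 0] (fun x : ℝ => x ^ 4) ∧
      (fun x : ℝ => NagleKardar.reducedDrift J K η x
          - K ^ 2 * (K ^ 2 - 3) / (3 * (1 + K ^ 2)) * x ^ 3)
        =O[𝓝 0] (fun x : ℝ => x ^ 5)) ∧
    -- the critical line
    (K < √3 →
      K ^ 2 * (K ^ 2 - 3) / (3 * (1 + K ^ 2)) < 0 ∧
      NagleKardar.RelaxesAs J K (1 / 2)
        (√(3 * (1 + K ^ 2) / (2 * K ^ 2 * (3 - K ^ 2)))) ∧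
      NagleKardar.IsRelaxationExponent J K (1 / 2) ∧
      NagleKardar.IsMagnetizationExponent J K (1 / 2) ∧
      NagleKardar.IsCorrelationExponent J K (1 / 2) ∧
      ∀ z : ℝ, NagleKardar.IsDynamicalExponent J K z ↔ z = 2) ∧
    -- the tricritical point
    (K = √3 →
      K ^ 2 * (K ^ 2 - 3) / (3 * (1 + K ^ 2)) = 0 ∧
      (∀ η : ℝ → ℝ, NagleKardar.IsCenterManifold J K η →
        (fun x : ℝ => NagleKardar.reducedDrift J K η x - (-(9 / 20) * x ^ 5))
          =O[𝓝 0] (fun x : ℝ => x ^ 7)) ∧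
      NagleKardar.RelaxesAs J K (1 / 4) ((5 / 9 : ℝ) ^ (1 / 4 : ℝ)) ∧
      NagleKardar.IsRelaxationExponent J K (1 / 4) ∧
      NagleKardar.IsMagnetizationExponent J K (1 / 4) ∧
      NagleKardar.IsCorrelationExponent J K (1 / 2) ∧
      ∀ z : ℝ, NagleKardar.IsDynamicalExponent J K z ↔ z = 2) := by
  have hpos : 0 < K := hK ▸ Real.exp_pos _
  refine ⟨⟨NagleKardar.drift_fixedPoint hK, NagleKardar.hasFDerivAt_drift hK⟩, fun h => ?_,
    fun η hη => hη.expansion hK, fun h => ?_, fun h => ?_⟩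
  · exact NagleKardar.exists_isCenterManifold hK ((Real.le_sqrt' hpos).1 h)
  · have h3 : K ^ 2 < 3 := (Real.lt_sqrt hpos.le).1 h
    have h3' : 0 < 3 - K ^ 2 := sub_pos.2 h3
    have hrel := NagleKardar.relaxesAs_critical hK h3
    have hrelExp : NagleKardar.IsRelaxationExponent J K (1 / 2) :=
      ⟨_, Real.sqrt_pos.2 (by positivity), hrel⟩
    have hmag := NagleKardar.isMagnetizationExponent_half hK h3
    exact ⟨div_neg_of_neg_of_pos (mul_neg_of_pos_of_neg (by positivity) (by linarith))
      (by positivity), hrel, hrelExp, hmag, NagleKardar.isCorrelationExponent_half hK,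
      NagleKardar.isDynamicalExponent_iff hK (by norm_num) hrelExp hmag⟩
  · have h3 : K ^ 2 = 3 := by rw [h]; exact Real.sq_sqrt (by norm_num)
    have hrel := NagleKardar.relaxesAs_tricritical hK h3
    have hrelExp : NagleKardar.IsRelaxationExponent J K (1 / 4) := ⟨_, by positivity, hrel⟩
    have hmag := NagleKardar.isMagnetizationExponent_quarter hK h3
    exact ⟨by simp [h3], fun η hη => hη.expansion_tricritical hK h3, hrel, hrelExp, hmag,
      NagleKardar.isCorrelationExponent_half hK,
      NagleKardar.isDynamicalExponent_iff hK (by norm_num) hrelExp hmag⟩
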